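/- Let $H(q,p)=\tfrac12|p|^2-\tfrac1{|q|}+p_1q_2-p_2q_1$ on $T^*(\mathbb R^2\setminus\{0\})$ be the Hamiltonian of the rotating Kepler problem. Let $\Psi^{-1}(q,p)=(-p,q)$ be the symplectic map that exchanges position and momentum, and let $\Phi:T^*\mathbb R^2\to T^*(S^2\setminus\{N\})$ be the cotangent lift of the inverse stereographic projection from the north pole $N$. For $c>\tfrac32$ let $\Sigma_R^c\subset T^*S^2$ be the bounded component of the closure in $T^*S^2$ of the image of $H^{-1}(-c)$ under $(q,p)\mapsto\Phi(-p,q)$, and let $\lambda_{can}$ be the canonical 1-form of $T^*S^2$, restricted to $\Sigma_R^c$. The systole $l_1(\Sigma_R^c,\lambda_{can})$ is the smallest period of a periodic Reeb orbit, and the systolic volume is $\mathfrak S(\Sigma_R^c,\lambda_{can})=l_1(\Sigma_R^c,\lambda_{can})^{-2}\int_{\Sigma_R^c}\lambda_{can}\wedge d\lambda_{can}$, where $\Sigma_R^c$ is oriented by $\lambda_{can}\wedge d\lambda_{can}$. **Theorem.** Let $c>\tfrac32$. The equation $c=\frac1{2x^2}-x$ has exactly one positive solution $x=L_R(c)$.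 The smallest period of a periodic Reeb orbit of $(\Sigma_R^c,\lambda_{can})$ exists and is $$l_1(\Sigma_R^c,\lambda_{can})=2\pi L_R(c).$$ It is realized by the retrograde orbit, that is, by the circular solution of Hamilton's equations of $H$ at energy $-c$ of radius $r=L_R(c)^2$, with angular velocity $r^{-3/2}+1$ in the rotating frame: after a rescaling of time by a positive constant, its image in $\Sigma_R^c$ is a Reeb orbit of period $2\pi L_R(c)$. Moreover, the contact volume is finite, the integral below converges absolutely, and $$\mathfrak S(\Sigma_R^c,\lambda_{can})=\frac1{(2\pi L_R(c))^2}\int_0^\infty\int_0^{2\pi}\frac{32\pi r}{\Big((r^2+2c)+\sqrt{(r^2+2c)^2+16r\cos\theta}\Big)^2}\,d\theta\,dr .$$ -/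

import Mathlib

open MeasureTheory Set
open scoped ENNReal ContDiff

noncomputable section

namespace RotatingKepler

/-- The Euclidean plane. -/
abbrev Plane := EuclideanSpace ℝ (Fin 2)

/-- Euclidean three-space. -/
abbrev Space := EuclideanSpace ℝ (Fin 3)

/-- The canonical one-form `λ = p dq` at a point `z = (q, p)`, evaluated at a vector
`v = (dq, dp)`. -/
def liouville {V : Type*} [NormedAddCommGroup V] [InnerProductSpace ℝ V] (z v : V × V) : ℝ :=
  inner ℝ z.2 v.1

/-- The canonical two-form `dλ = dp ∧ dq`. -/
def symp {V : Type*} [NormedAddCommGroup V] [InnerProductSpace ℝ V] (v w : V × V) : ℝ :=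
  inner ℝ v.2 w.1 - inner ℝ w.2 v.1

/-- The cotangent bundle of the unit sphere `S²`: pairs `(ξ, η)` with `ξ ∈ S²` and `η ⟂ ξ`, where
`η` stands for the covector `⟨η, ·⟩` on `T_ξ S² = ξ^⟂`. Its canonical one-form is the
restriction of `liouville`. -/
def cotangentSphere : Set (Space × Space) :=
  {z | ‖z.1‖ = 1 ∧ inner ℝ z.1 z.2 = 0}

/-! ### The rotating Kepler problem and its regularization -/

/-- The Hamiltonian `H(q, p) = |p|²/2 - 1/|q| + p₁q₂ - p₂q₁` of the rotating Kepler problem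
(meaningful for `q ≠ 0`). -/
def hamiltonian (z : Plane × Plane) : ℝ :=
  ‖z.2‖ ^ 2 / 2 - 1 / ‖z.1‖ + (z.2 0 * z.1 1 - z.2 1 * z.1 0)

/-- `γ` is an integral curve of the Hamiltonian vector field `X_H`, `ι_{X_H} ω = -dH`, of the
rotating Kepler problem. -/
def IsHamiltonianOrbit (γ : ℝ → Plane × Plane) : Prop :=
  ∀ t, (γ t).1 ≠ 0 ∧ ∃ v, HasDerivAt γ v t ∧ ∀ w, symp v w = -(fderiv ℝ hamiltonian (γ t) w)

/-- Inverse stereographic projection from the north pole, `ℝ² → S² \ {N}`. -/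
def stereo (x : Plane) : Space :=
  !₂[2 * x 0 / (‖x‖ ^ 2 + 1), 2 * x 1 / (‖x‖ ^ 2 + 1), (‖x‖ ^ 2 - 1) / (‖x‖ ^ 2 + 1)]

/-- The cotangent lift `T*ℝ² → T*(S² \ {N})` of `stereo`; see `stereoLift_mem` and
`stereoLift_pairing`. -/
def stereoLift (x y : Plane) : Space × Space :=
  (stereo x,
    !₂[(‖x‖ ^ 2 + 1) / 2 * y 0 - inner ℝ x y * x 0,
       (‖x‖ ^ 2 + 1) / 2 * y 1 - inner ℝ x y * x 1,
       inner ℝ x y])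

theorem stereoLift_mem (x y : Plane) : stereoLift x y ∈ cotangentSphere := by
  have hpos : x 0 ^ 2 + x 1 ^ 2 + 1 ≠ 0 := by positivity
  constructor
  · have h : ‖stereo x‖ ^ 2 = 1 := by
      rw [EuclideanSpace.real_norm_sq_eq]
      simp only [stereo, EuclideanSpace.real_norm_sq_eq x, Fin.sum_univ_two, Fin.sum_univ_three]
      simp
      field_simp
      ring
    have h0 := norm_nonneg (stereo x)
    change ‖stereo x‖ = 1
    nlinarith
  · simp only [stereoLift, stereo, EuclideanSpace.real_norm_sq_eq x, PiLp.inner_apply,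
      Fin.sum_univ_two, Fin.sum_univ_three]
    simp
    field_simp
    ring

/-- The covector of `stereoLift x y` evaluated at the image of `u` under the differential of
`stereo` at `x` is `⟨y, u⟩`. -/
theorem stereoLift_pairing (x y u : Plane) (v : Space)
    (h : HasDerivAt (fun t : ℝ => stereo (x + t • u)) v 0) :
    inner ℝ (stereoLift x y).2 v = inner ℝ y u := by
  have hpos : x 0 ^ 2 + x 1 ^ 2 + 1 ≠ 0 := by positivity
  have hx (i : Fin 2) : HasDerivAt (fun t : ℝ => x i + t * u i) (u i) 0 := by
    simpa using ((hasDerivAt_id (0 : ℝ)).mul_const (u i)).const_add (x i)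
  have hn : HasDerivAt (fun t : ℝ => (x 0 + t * u 0) ^ 2 + (x 1 + t * u 1) ^ 2)
      (2 * (x 0 * u 0 + x 1 * u 1)) 0 := by
    refine (((hx 0).pow 2).add ((hx 1).pow 2)).congr_deriv ?_
    simp
    ring
  have hv (i : Fin 3) : HasDerivAt (fun t : ℝ => stereo (x + t • u) i) (v i) 0 := by
    exact ((EuclideanSpace.proj (𝕜 := ℝ) i).hasFDerivAt (x := stereo (x + (0 : ℝ) • u))).comp_hasDerivAt
      (0 : ℝ) h
  have h0 := (hv 0).unique (((hx 0).const_mul 2).div (hn.add_const 1) (by simpa using hpos)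
    |>.congr_of_eventuallyEq (.of_forall fun t => by
      simp [stereo, EuclideanSpace.real_norm_sq_eq, Fin.sum_univ_two]))
  have h1 := (hv 1).unique (((hx 1).const_mul 2).div (hn.add_const 1) (by simpa using hpos)
    |>.congr_of_eventuallyEq (.of_forall fun t => by
      simp [stereo, EuclideanSpace.real_norm_sq_eq, Fin.sum_univ_two]))
  have h2 := (hv 2).unique ((hn.sub_const 1).div (hn.add_const 1) (by simpa using hpos)
    |>.congr_of_eventuallyEq (.of_forall fun t => by
      simp [stereo, EuclideanSpace.real_norm_sq_eq, Fin.sum_univ_two]))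
  simp only [stereoLift, EuclideanSpace.real_norm_sq_eq x, PiLp.inner_apply,
    Fin.sum_univ_two, Fin.sum_univ_three, h0, h1, h2]
  simp
  field_simp
  ring

/-- The symplectic map `(q, p) ↦ (x, y) = (-p, q)`, which switches position and momentum,
followed by the cotangent lift of the stereographic projection. -/
def moser (z : Plane × Plane) : Space × Space :=
  stereoLift (-z.2) z.1

/-- The closure in `T*S²` of the image of the energy level `H⁻¹(-c)`. (As `T*S²` is closed in
`ℝ³ × ℝ³`, the closure may be taken there.) -/
def energyClosure (c : ℝ) : Set (Space × Space) :=
  closure (moser '' {z | z.1 ≠ 0 ∧ hamiltonian z = -c})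

/-- The regularized energy hypersurface `Σ_R^c ⊆ T*S²`: the bounded component of
`energyClosure c`. -/
def hypersurface (c : ℝ) : Set (Space × Space) :=
  {z ∈ energyClosure c | Bornology.IsBounded (connectedComponentIn (energyClosure c) z)}

/-- The retrograde circular orbit of radius `r` in the rotating frame: the angular velocity
`r^(-3/2)` of the Kepler motion and the angular velocity `1` of the frame add up. -/
def retrogradeOrbit (r t : ℝ) : Plane × Plane :=
  (!₂[r * Real.cos ((1 / (r * √r) + 1) * t), -(r * Real.sin ((1 / (r * √r) + 1) * t))],
   !₂[-(1 / √r * Real.sin ((1 / (r * √r) + 1) * t)),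
      -(1 / √r * Real.cos ((1 / (r * √r) + 1) * t))])

/-! ### Reeb orbits, systole and contact volume of a hypersurface in `T*S²` with `λ_can` -/

/-- The tangent space of a submanifold `S` at `z`: velocities of curves in `S` through `z`. -/
def tangentVectors (S : Set (Space × Space)) (z : Space × Space) : Set (Space × Space) :=
  {w | ∃ δ : ℝ → Space × Space, (∀ s, δ s ∈ S) ∧ δ 0 = z ∧ HasDerivAt δ w 0}

/-- `γ` is an integral curve in `S` of the Reeb vector field `R` of `λ_can|_S`, i.e. of the field
with `λ(R) = 1` and `dλ(R, w) = 0` for all `w` tangent to `S`. -/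
def IsReebOrbit (S : Set (Space × Space)) (γ : ℝ → Space × Space) : Prop :=
  ∀ t, γ t ∈ S ∧ ∃ v, HasDerivAt γ v t ∧ liouville (γ t) v = 1 ∧
    ∀ w ∈ tangentVectors S (γ t), symp v w = 0

/-- The set of periods of periodic Reeb orbits of `(S, λ_can)`. -/
def reebPeriods (S : Set (Space × Space)) : Set ℝ :=
  {T | 0 < T ∧ ∃ γ, IsReebOrbit S γ ∧ Function.Periodic γ T}

/-- The systole of `(S, λ_can)`: the smallest period of its periodic Reeb orbits. -/
def systole (S : Set (Space × Space)) : ℝ :=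
  sInf (reebPeriods S)

/-- The three-form `λ ∧ dλ` at `z`. -/
def contactForm3 (z v₁ v₂ v₃ : Space × Space) : ℝ :=
  liouville z v₁ * symp v₂ v₃ - liouville z v₂ * symp v₁ v₃ + liouville z v₃ * symp v₁ v₂

/-- A measurable piece `map '' piece` of a three-dimensional submanifold `S`, given in a smooth
injective regular parametrization of an open part of `S`. -/
structure Patch (S : Set (Space × Space)) where
  map : (Fin 3 → ℝ) → Space × Space
  domain : Set (Fin 3 → ℝ)
  piece : Set (Fin 3 → ℝ)
  isOpen_domain : IsOpen domain
  contDiffOn_map : ContDiffOn ℝ ∞ map domain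
  injOn_map : InjOn map domain
  injective_fderiv : ∀ a ∈ domain, Function.Injective (fderiv ℝ map a)
  mapsTo_map : MapsTo map domain S
  measurableSet_piece : MeasurableSet piece
  piece_subset : piece ⊆ domain

/-- The integral of `λ ∧ dλ` over a patch, which is oriented by `λ ∧ dλ` itself. -/
def Patch.volume {S : Set (Space × Space)} (P : Patch S) : ℝ≥0∞ :=
  ∫⁻ a in P.piece, ENNReal.ofReal |contactForm3 (P.map a)
    (fderiv ℝ P.map a (Pi.single 0 1)) (fderiv ℝ P.map a (Pi.single 1 1))
    (fderiv ℝ P.map a (Pi.single 2 1))|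

/-- The contact volume `∫_S λ ∧ dλ` of a three-dimensional `S` (oriented by `λ ∧ dλ`), as the
supremum over all finite families of pairwise disjoint patches. -/
def contactVolume (S : Set (Space × Space)) : ℝ≥0∞ :=
  ⨆ (n : ℕ) (P : Fin n → Patch S)
    (_ : Pairwise fun i j => Disjoint ((P i).map '' (P i).piece) ((P j).map '' (P j).piece)),
    ∑ i, (P i).volume

/-- The systolic volume `Vol / l₁ⁿ` of a contact manifold of dimension `2n - 1 = 3`. -/
def systolicVolume (S : Set (Space × Space)) : ℝ :=
  (contactVolume S).toReal / systole S ^ 2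

end RotatingKepler

end

/-! Notation: (ξ, η) is a point of T*S² with components indexed by 0, 1, 2, ρ = |q| is `radius`, A
is `angMom`, K is `levelFun c`. The hypersurface. Multiplying H + c by |q| turns H = -c into K = 1,
which still makes sense over the north pole, where the collisions lie. As -c is below the critical
value -3/2, the set K = 1 avoids ρ = 1. Its part ρ < 1 is bounded, while every point with ρ > 1 can
be moved to infinity inside the level, so Σ_R^c is `boundedLevel c` (`hypersurface_eq`). There 1 +
ρA > 0. This number is the derivative of K along the ray of η and also λ(X_K); hence each ray of
nonzero covectors meets the level exactly once and the Reeb field is X_K / (1 + ρA). The periods. A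
is conserved, and the Kepler energy is -k²/2 with k² = 2(c + A) > 1. Along a Reeb orbit with time s
put dτ = ds/(1 + ρA) and dθ = ρ dτ; then θ is the physical time and also the angle by which the
frame turns. `vertPhase` rotates with phase kτ and has squared modulus 1 - (kA)², the squared
eccentricity; `horPos` ± i `horMom` rotates with phase θ ± kτ. Kepler's equation says that k²θ - τ -
η₂ is constant. On a closed eccentric orbit therefore kτ = 2πm and θ = 2πn with m = k³n > n > 0, and
T = τ + Aθ yields kT = 2π(m + kAn) ≥ 2π(m - n) ≥ 2π. On a circular orbit a single phase gives the
same bound, so T ≥ 2π/k always (`le_period`). Finally kA ≤ 1 gives c ≥ k²/2 - 1/k; since 1/(2x²) - x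
decreases, 1/k ≥ L, and the retrograde circle attains 2πL (`isLeast_reebPeriods`). The volume. All
families of patches are bounded at once by Lebesgue measure in ℝ⁶: the thickening (b₀ξ, b₁η + b₂ξ)
has Jacobian b₀²b₁ times the density of λ ∧ dλ up to sign (`abs_det_thicken`), and disjoint patches
have disjoint thickenings. One polar patch fills the thickened level up to a null set, so it carries
the whole contact volume (`contactVolume_eq_of_patch`); its density does not depend on the polar
angle φ, which integrates to 2π. -/

namespace RotatingKepler

/-! ### The regularized energy level in `T*S²` -/

/-- The distance `|q|` to the origin in position space, as a function on `T*S²`. -/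
noncomputable def radius (z : Space × Space) : ℝ := ‖z.2‖ * (1 - z.1 2)

/-- The angular momentum `p₁q₂ - p₂q₁`, as a function on `T*S²`. -/
def angMom (z : Space × Space) : ℝ := z.1 1 * z.2 0 - z.1 0 * z.2 1

/-- The regularized energy, equal to `1` on the energy level `H = -c`. -/
noncomputable def levelFun (c : ℝ) (z : Space × Space) : ℝ :=
  ‖z.2‖ + (c - 1 / 2 + angMom z) * radius z

/-- The part of the regularized energy level over the bounded Hill region. -/
def boundedLevel (c : ℝ) : Set (Space × Space) :=
  {z | z ∈ cotangentSphere ∧ levelFun c z = 1 ∧ radius z < 1}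

theorem norm_sq_coords (v : Space) : ‖v‖ ^ 2 = v 0 ^ 2 + v 1 ^ 2 + v 2 ^ 2 := by
  rw [EuclideanSpace.real_norm_sq_eq, Fin.sum_univ_three]

theorem inner_coords (v w : Space) : inner ℝ v w = v 0 * w 0 + v 1 * w 1 + v 2 * w 2 := by
  simp [PiLp.inner_apply, Fin.sum_univ_three, mul_comm]

theorem mem_cotangentSphere_iff (z : Space × Space) : z ∈ cotangentSphere ↔
    z.1 0 ^ 2 + z.1 1 ^ 2 + z.1 2 ^ 2 = 1 ∧
      z.1 0 * z.2 0 + z.1 1 * z.2 1 + z.1 2 * z.2 2 = 0 := by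
  rw [← norm_sq_coords, ← inner_coords]
  rw [pow_eq_one_iff_of_nonneg (norm_nonneg _) two_ne_zero]
  rfl

theorem radius_nonneg {z : Space × Space} (hz : z ∈ cotangentSphere) : 0 ≤ radius z := by
  obtain ⟨h, -⟩ := (mem_cotangentSphere_iff z).1 hz
  refine mul_nonneg (norm_nonneg _) ?_
  nlinarith [sq_nonneg (z.1 0), sq_nonneg (z.1 1)]

/-- Cauchy–Schwarz: A pairs η with the field of rotations about the vertical axis, whose squared
length at ξ is 1 - ξ₂², and the right side is (1 - ξ₂²)|η|². -/
theorem angMom_sq_le {z : Space × Space} (hz : z ∈ cotangentSphere) :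
    angMom z ^ 2 ≤ radius z * (2 * ‖z.2‖ - radius z) := by
  obtain ⟨h, -⟩ := (mem_cotangentSphere_iff z).1 hz
  have e : radius z * (2 * ‖z.2‖ - radius z) = ‖z.2‖ ^ 2 * (1 - z.1 2 ^ 2) := by
    unfold radius; ring
  have h2 : 1 - z.1 2 ^ 2 = z.1 0 ^ 2 + z.1 1 ^ 2 := by linarith
  rw [e, h2, norm_sq_coords]
  unfold angMom
  nlinarith [sq_nonneg (z.1 0 * z.2 0 + z.1 1 * z.2 1),
    mul_nonneg (sq_nonneg (z.2 2)) (add_nonneg (sq_nonneg (z.1 0)) (sq_nonneg (z.1 1)))]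

theorem abs_angMom_le {z : Space × Space} (hz : z ∈ cotangentSphere) : |angMom z| ≤ ‖z.2‖ := by
  refine abs_le_of_sq_le_sq ?_ (norm_nonneg _)
  nlinarith [angMom_sq_le hz, sq_nonneg (‖z.2‖ - radius z)]

section BoundedLevel

variable {c : ℝ} {z : Space × Space}

/-- At ρ = 1 the level equation gives |η| = 3/2 - c - A, and `angMom_sq_le` becomes (A + 1)² ≤ 3 -
2c < 0. -/
theorem radius_ne_one (hc : 3 / 2 < c) (hz : z ∈ cotangentSphere) (hl : levelFun c z = 1) :
    radius z ≠ 1 := by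
  intro h
  have h1 := angMom_sq_le hz
  rw [levelFun, h] at hl
  rw [h] at h1
  nlinarith [sq_nonneg (angMom z + 1)]

/-- With |η| eliminated by the level equation, A ≤ -1 would give (1 - ρ²)² ≤ (A + ρ²)² ≤ ρ⁴ - 2cρ² +
2ρ, that is (ρ - 1)² + (2c - 3)ρ² ≤ 0. The contact condition, the bound on |η| and k > 1 all rest on
this inequality. -/
theorem neg_one_lt_angMom (hc : 3 / 2 < c) (hz : z ∈ boundedLevel c) : -1 < angMom z := by
  obtain ⟨hT, hl, hρ⟩ := hz
  have h1 := angMom_sq_le hT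
  have h0 := radius_nonneg hT
  unfold levelFun at hl
  by_contra! hA
  have he : ‖z.2‖ = 1 - (c - 1 / 2 + angMom z) * radius z := by linarith
  rw [he] at h1
  have h2 : (angMom z + radius z ^ 2) ^ 2 ≤
      radius z ^ 4 - 2 * c * radius z ^ 2 + 2 * radius z := by linarith
  have h3 : (1 - radius z ^ 2) ^ 2 ≤ (angMom z + radius z ^ 2) ^ 2 := by
    rw [← neg_sq (angMom z + _)]
    refine sq_le_sq' ?_ ?_ <;> nlinarith
  nlinarith [sq_nonneg (radius z - 1), mul_nonneg h0 h0]

/-- On the level, 1 + ρA is the derivative of `levelFun` along the ray of η; its positivity is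
fibrewise starshapedness, which makes λ a contact form. -/
theorem neg_lt_radius_mul_angMom (hc : 3 / 2 < c) (hz : z ∈ boundedLevel c) :
    0 < 1 + radius z * angMom z := by
  have h := neg_one_lt_angMom hc hz
  have h0 := radius_nonneg hz.1
  nlinarith [hz.2.2]

theorem norm_le_one (hc : 3 / 2 < c) (hz : z ∈ boundedLevel c) : ‖z.2‖ ≤ 1 := by
  have h := neg_one_lt_angMom hc hz
  have h0 := radius_nonneg hz.1
  have hl := hz.2.1
  unfold levelFun at hl
  nlinarith

theorem norm_pos_of_level (hl : levelFun c z = 1) : 0 < ‖z.2‖ := by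
  refine (norm_nonneg _).lt_of_ne' fun h => ?_
  simp [levelFun, radius, h] at hl

/-! ### Radial projection to the energy level -/

/-- The linear coefficient of `s ↦ levelFun c (ξ, s • η)`. -/
noncomputable def linCoeff (c : ℝ) (z : Space × Space) : ℝ := ‖z.2‖ + (c - 1 / 2) * radius z

/-- The factor by which the covector has to be scaled to reach the energy level. -/
noncomputable def scale (c : ℝ) (z : Space × Space) : ℝ :=
  -- A root of (Aρ)s² + Bs = 1 with B = `linCoeff`. The square root stands in the denominator so
  -- that Aρ = 0 needs no separate case; this is the root with ρ < 1 after scaling.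
  2 / (linCoeff c z + √(linCoeff c z ^ 2 + 4 * (angMom z * radius z)))

theorem radius_smul {s : ℝ} (hs : 0 ≤ s) (z : Space × Space) :
    radius (z.1, s • z.2) = s * radius z := by
  simp [radius, norm_smul, abs_of_nonneg hs, mul_assoc]

theorem angMom_smul (s : ℝ) (z : Space × Space) : angMom (z.1, s • z.2) = s * angMom z := by
  simp [angMom]; ring

theorem levelFun_smul {s : ℝ} (hs : 0 ≤ s) (z : Space × Space) :
    levelFun c (z.1, s • z.2) = s * linCoeff c z + s ^ 2 * (angMom z * radius z) := by
  rw [levelFun, radius_smul hs, angMom_smul, linCoeff, norm_smul, Real.norm_of_nonneg hs]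
  ring

theorem smul_mem_cotangentSphere (s : ℝ) (hz : z ∈ cotangentSphere) :
    (z.1, s • z.2) ∈ cotangentSphere := by
  refine ⟨hz.1, ?_⟩
  change inner ℝ z.1 (s • z.2) = 0
  rw [inner_smul_right, hz.2, mul_zero]

theorem linCoeff_pos (hc : 3 / 2 < c) (hz : z ∈ cotangentSphere) (h : z.2 ≠ 0) :
    0 < linCoeff c z := by
  have h1 : 0 < ‖z.2‖ := norm_pos_iff.2 h
  have h2 := radius_nonneg hz
  unfold linCoeff
  nlinarith

/-- For ρ > 0 and c > 3/2 one has B > |η| + ρ, so B² > 4|η|ρ ≥ -4Aρ. -/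
theorem discr_pos (hc : 3 / 2 < c) (hz : z ∈ cotangentSphere) (h : z.2 ≠ 0) :
    0 < linCoeff c z ^ 2 + 4 * (angMom z * radius z) := by
  have h1 : 0 < ‖z.2‖ := norm_pos_iff.2 h
  have hA := neg_le_of_abs_le (abs_angMom_le hz)
  have hB := linCoeff_pos hc hz h
  rcases (radius_nonneg hz).eq_or_lt with h2 | h2
  · rw [← h2, mul_zero, mul_zero, add_zero]; positivity
  · have hB' : ‖z.2‖ + radius z < linCoeff c z := by unfold linCoeff; nlinarith
    nlinarith [sq_nonneg (‖z.2‖ - radius z), mul_le_mul_of_nonneg_right hA h2.le]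

theorem scale_pos (hc : 3 / 2 < c) (hz : z ∈ cotangentSphere) (h : z.2 ≠ 0) : 0 < scale c z := by
  have := linCoeff_pos hc hz h
  exact div_pos two_pos (add_pos_of_pos_of_nonneg this (Real.sqrt_nonneg _))

theorem scale_mem (hc : 3 / 2 < c) (hz : z ∈ cotangentSphere) (h : z.2 ≠ 0) :
    (z.1, scale c z • z.2) ∈ boundedLevel c := by
  have hs := scale_pos hc hz h
  have hB := linCoeff_pos hc hz h
  have hD := discr_pos hc hz h
  have hq := Real.sqrt_pos.2 hD
  have hq2 := Real.sq_sqrt hD.le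
  refine ⟨smul_mem_cotangentSphere _ hz, ?_, ?_⟩
  · rw [levelFun_smul hs.le]
    unfold scale
    set q := √(linCoeff c z ^ 2 + 4 * (angMom z * radius z))
    have : angMom z * radius z = (q ^ 2 - linCoeff c z ^ 2) / 4 := by linarith
    rw [this]
    field_simp
    ring
  · rw [radius_smul hs.le]
    unfold scale
    set q := √(linCoeff c z ^ 2 + 4 * (angMom z * radius z))
    rw [div_mul_eq_mul_div, div_lt_one (by positivity)]
    rcases (radius_nonneg hz).eq_or_lt with h2 | h2
    · rw [← h2]; linarith
    -- Otherwise squaring q ≤ 2ρ - B gives A ≤ ρ - B < -|η|, against |A| ≤ |η|.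
    · by_contra! hcon
      have hA := neg_le_of_abs_le (abs_angMom_le hz)
      have hB' : ‖z.2‖ + radius z < linCoeff c z := by unfold linCoeff; nlinarith
      have h3 : q ^ 2 ≤ (2 * radius z - linCoeff c z) ^ 2 := by
        refine sq_le_sq' ?_ ?_ <;> linarith
      nlinarith

theorem linCoeff_add (hl : levelFun c z = 1) : linCoeff c z + angMom z * radius z = 1 := by
  unfold linCoeff; unfold levelFun at hl; linarith

theorem scale_eq_one (hc : 3 / 2 < c) (hz : z ∈ boundedLevel c) : scale c z = 1 := by
  have h := neg_lt_radius_mul_angMom hc hz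
  have hl := linCoeff_add hz.2.1
  have e : linCoeff c z ^ 2 + 4 * (angMom z * radius z) = (1 + radius z * angMom z) ^ 2 := by
    have : linCoeff c z = 1 - angMom z * radius z := by linarith
    rw [this]; ring
  rw [scale, e, Real.sqrt_sq h.le, div_eq_one_iff_eq (by nlinarith)]
  linarith

/-- Each ray of covectors meets the energy level at most once. -/
theorem eq_one_of_smul_mem (hc : 3 / 2 < c) (hz : z ∈ boundedLevel c) {s : ℝ} (hs : 0 < s)
    (hsz : (z.1, s • z.2) ∈ boundedLevel c) : s = 1 := by
  have h1 := neg_lt_radius_mul_angMom hc hz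
  have h2 := neg_lt_radius_mul_angMom hc hsz
  rw [radius_smul hs.le, angMom_smul] at h2
  have h3 := linCoeff_add hz.2.1
  have h4 := hsz.2.1
  rw [levelFun_smul hs.le] at h4
  have h5 : (s - 1) * (1 + s * (angMom z * radius z)) = 0 := by
    have : linCoeff c z = 1 - angMom z * radius z := by linarith
    rw [this] at h4; linarith
  rcases mul_eq_zero.1 h5 with h | h
  · linarith
  -- The second root has sρA = -1. Positivity of 1 + ρA forces s < 1 at the scaled point and s > 1
  -- at the original one.
  · have h6 : s * (radius z * angMom z) = -1 := by linarith
    have h7 : s < 1 := by nlinarith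
    nlinarith

end BoundedLevel

/-! ### Continuity and derivatives of the coordinate functions on T*S². -/

theorem isClosed_cotangentSphere : IsClosed cotangentSphere := by
  refine (isClosed_eq (by fun_prop) continuous_const).inter
    (isClosed_eq (by fun_prop) continuous_const)

theorem continuous_coord (i : Fin 3) : Continuous fun v : Space => v i :=
  (EuclideanSpace.proj (𝕜 := ℝ) i).continuous

theorem continuous_radius : Continuous radius := by
  have := continuous_coord 2
  unfold radius
  fun_prop

theorem continuous_angMom : Continuous angMom := by
  have h0 := continuous_coord 0
  have h1 := continuous_coord 1
  unfold angMom
  fun_prop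

theorem continuous_levelFun (c : ℝ) : Continuous (levelFun c) := by
  have := continuous_radius
  have := continuous_angMom
  unfold levelFun
  fun_prop

theorem hasDerivAt_coord {f : ℝ → Space} {v : Space} {t : ℝ} (h : HasDerivAt f v t) (i : Fin 3) :
    HasDerivAt (fun s => f s i) (v i) t :=
  ((EuclideanSpace.proj (𝕜 := ℝ) i).hasFDerivAt (x := f t)).comp_hasDerivAt t h

theorem hasDerivAt_of_coord {f : ℝ → Space} {v : Space} {t : ℝ}
    (h : ∀ i, HasDerivAt (fun s => f s i) (v i) t) : HasDerivAt f v t := by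
  have := (EuclideanSpace.equiv (Fin 3) ℝ).symm.hasFDerivAt.comp_hasDerivAt t (hasDerivAt_pi.2 h)
  exact this

theorem hasDerivAt_norm_space {f : ℝ → Space} {v : Space} {t : ℝ} (h : HasDerivAt f v t)
    (h0 : f t ≠ 0) : HasDerivAt (fun s => ‖f s‖) (inner ℝ (f t) v / ‖f t‖) t := by
  have h1 := (h.norm_sq).sqrt (by positivity)
  simp only [Real.sqrt_sq (norm_nonneg _)] at h1
  refine h1.congr_deriv ?_
  ring

theorem hasDerivAt_angMom {δ : ℝ → Space × Space} {w : Space × Space} {t : ℝ}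
    (h : HasDerivAt δ w t) : HasDerivAt (fun s => angMom (δ s))
      (w.1 1 * (δ t).2 0 + (δ t).1 1 * w.2 0 - (w.1 0 * (δ t).2 1 + (δ t).1 0 * w.2 1)) t := by
  have h1 := h.fst
  have h2 := h.snd
  exact ((hasDerivAt_coord h1 1).mul (hasDerivAt_coord h2 0)).sub
    ((hasDerivAt_coord h1 0).mul (hasDerivAt_coord h2 1))

theorem hasDerivAt_radius {δ : ℝ → Space × Space} {w : Space × Space} {t : ℝ}
    (h : HasDerivAt δ w t) (h0 : (δ t).2 ≠ 0) : HasDerivAt (fun s => radius (δ s))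
      (inner ℝ (δ t).2 w.2 / ‖(δ t).2‖ * (1 - (δ t).1 2) - ‖(δ t).2‖ * w.1 2) t := by
  refine ((hasDerivAt_norm_space h.snd h0).mul ((hasDerivAt_coord h.fst 2).const_sub 1)).congr_deriv
    ?_
  ring

/-- Projecting a curve of non-zero covectors radially to the energy level only adds a radial
component to its velocity. -/
theorem exists_tangent_of_curve {c : ℝ} (hc : 3 / 2 < c) {ζ : ℝ → Space × Space}
    {w : Space × Space} (hζ : ∀ s, ζ s ∈ cotangentSphere) (h0 : ∀ s, (ζ s).2 ≠ 0)
    (hz : ζ 0 ∈ boundedLevel c) (hw : HasDerivAt ζ w 0) :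
    ∃ κ : ℝ, HasDerivAt (fun s => ((ζ s).1, scale c (ζ s) • (ζ s).2))
      (w.1, w.2 + κ • (ζ 0).2) 0 := by
  have hD := discr_pos hc (hζ 0) (h0 0)
  have hB := linCoeff_pos hc (hζ 0) (h0 0)
  have d1 := hasDerivAt_radius hw (h0 0)
  have d2 := hasDerivAt_angMom hw
  have d3 := hasDerivAt_norm_space hw.snd (h0 0)
  have d4 : DifferentiableAt ℝ (fun s => scale c (ζ s)) 0 := by
    have e4 : DifferentiableAt ℝ (fun s => linCoeff c (ζ s)) 0 :=
      (d3.add (d1.const_mul (c - 1 / 2))).differentiableAt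
    have e5 : DifferentiableAt ℝ
        (fun s => √(linCoeff c (ζ s) ^ 2 + 4 * (angMom (ζ s) * radius (ζ s)))) 0 :=
      ((e4.pow 2).add ((d2.mul d1).differentiableAt.const_mul 4)).sqrt hD.ne'
    exact (differentiableAt_const _).div (e4.add e5) (by positivity)
  refine ⟨deriv (fun s => scale c (ζ s)) 0, ?_⟩
  have := hw.fst.prodMk (d4.hasDerivAt.smul hw.snd)
  rw [scale_eq_one hc hz, one_smul] at this
  exact this

end RotatingKepler

namespace RotatingKepler

/-! ### The Reeb vector field -/

/-- The generator `(a, b, c) ↦ (b, -a, 0)` of the rotations about the vertical axis. -/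
noncomputable def rotGen (v : Space) : Space := !₂[v 1, -v 0, 0]

/-- The cross product. -/
noncomputable def cross (v w : Space) : Space :=
  !₂[v 1 * w 2 - v 2 * w 1, v 2 * w 0 - v 0 * w 2, v 0 * w 1 - v 1 * w 0]

/-- The Reeb vector field of `λ_can` on `boundedLevel c`. -/
noncomputable def reebField (c : ℝ) (z : Space × Space) : Space × Space :=
  -- The field in the brackets is the Hamiltonian field of `levelFun`, with its coefficient of η
  -- simplified by `inv_norm_eq`. The multiples of ξ in the second component are the constraint
  -- force that keeps η ⟂ ξ.
  (1 + radius z * angMom z)⁻¹ •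
    ((1 / ‖z.2‖ ^ 2) • z.2 + radius z • rotGen z.1,
      radius z • rotGen z.2 +
        (‖z.2‖ * (c + angMom z - 1 / 2)) • (!₂[0, 0, 1] - z.1 2 • z.1 : Space) - z.1)

/-- The velocities allowed by the equations that define `boundedLevel c`. -/
structure IsTangent (c : ℝ) (z w : Space × Space) : Prop where
  sphere : inner ℝ z.1 w.1 = 0
  perp : inner ℝ z.1 w.2 + inner ℝ z.2 w.1 = 0
  level : inner ℝ z.2 w.2 / ‖z.2‖ +
    ((w.1 1 * z.2 0 + z.1 1 * w.2 0 - (w.1 0 * z.2 1 + z.1 0 * w.2 1)) * radius z +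
    (c - 1 / 2 + angMom z) *
      (inner ℝ z.2 w.2 / ‖z.2‖ * (1 - z.1 2) - ‖z.2‖ * w.1 2)) = 0

theorem IsTangent.sub {c : ℝ} {z w w' : Space × Space} (h : IsTangent c z w)
    (h' : IsTangent c z w') : IsTangent c z (w - w') := by
  refine ⟨?_, ?_, ?_⟩
  · rw [Prod.fst_sub, inner_sub_right, h.1, h'.1, sub_zero]
  · rw [Prod.fst_sub, Prod.snd_sub, inner_sub_right, inner_sub_right]
    linarith [h.2, h'.2]
  · have h1 := h.3
    have h2 := h'.3
    simp only [Prod.fst_sub, Prod.snd_sub, inner_sub_right, PiLp.sub_apply]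
    linear_combination h1 - h2

theorem IsTangent.smul {c : ℝ} {z w : Space × Space} (h : IsTangent c z w) (a : ℝ) :
    IsTangent c z (a • w) := by
  refine ⟨?_, ?_, ?_⟩
  · rw [Prod.smul_fst, inner_smul_right, h.1, mul_zero]
  · rw [Prod.smul_fst, Prod.smul_snd, inner_smul_right, inner_smul_right]
    linear_combination a * h.2
  · have h1 := h.3
    simp only [Prod.smul_fst, Prod.smul_snd, inner_smul_right, PiLp.smul_apply, smul_eq_mul]
    linear_combination a * h1

variable {c : ℝ} {z : Space × Space}

/-- Velocities of curves in `boundedLevel c` satisfy the linearized equations. -/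
theorem isTangent_of_hasDerivAt {δ : ℝ → Space × Space} {w : Space × Space} {t : ℝ}
    (hδ : ∀ s, δ s ∈ boundedLevel c) (h : HasDerivAt δ w t) : IsTangent c (δ t) w := by
  have h0 : (δ t).2 ≠ 0 := norm_pos_iff.1 (norm_pos_of_level (hδ t).2.1)
  have hf : HasDerivAt (fun s => (δ s).1) w.1 t := h.fst
  have hs : HasDerivAt (fun s => (δ s).2) w.2 t := h.snd
  refine ⟨?_, ?_, ?_⟩
  · have h1 : HasDerivAt (fun s => ‖(δ s).1‖ ^ 2) 0 t := by
      have : (fun s => ‖(δ s).1‖ ^ 2) = fun _ => 1 := by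
        funext s; rw [(hδ s).1.1, one_pow]
      rw [this]
      exact hasDerivAt_const _ _
    have h2 := hf.norm_sq.unique h1
    linarith
  · have h1 : HasDerivAt (fun s => inner ℝ (δ s).1 (δ s).2) 0 t := by
      have : (fun s => inner ℝ (δ s).1 (δ s).2) = fun _ => (0 : ℝ) := by
        funext s; exact (hδ s).1.2
      rw [this]
      exact hasDerivAt_const _ _
    have h2 := (hf.inner ℝ hs).unique h1
    rwa [real_inner_comm (δ t).2 w.1] at h2
  · have h1 : HasDerivAt (fun s => levelFun c (δ s)) 0 t := by
      have : (fun s => levelFun c (δ s)) = fun _ => (1 : ℝ) := by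
        funext s; exact (hδ s).2.1
      rw [this]
      exact hasDerivAt_const _ _
    exact ((hasDerivAt_norm_space h.snd h0).add (((hasDerivAt_angMom h).const_add (c - 1 / 2)).mul
      (hasDerivAt_radius h h0))).unique h1

/-- Only this inclusion is needed in general. In place of the converse, uniqueness of the Reeb field
uses two explicit tangent vectors, `exists_tangent_vertical` and `exists_tangent_horizontal`. -/
theorem isTangent_of_mem {w : Space × Space} (hw : w ∈ tangentVectors (boundedLevel c) z) :
    IsTangent c z w := by
  obtain ⟨δ, h1, rfl, h2⟩ := hw
  exact isTangent_of_hasDerivAt h1 h2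

theorem inv_norm_eq (hl : levelFun c z = 1) :
    1 / ‖z.2‖ = 1 + (c + angMom z - 1 / 2) * (1 - z.1 2) := by
  have h := norm_pos_of_level hl
  unfold levelFun radius at hl
  field_simp
  linarith

theorem reebField_isTangent (hl : levelFun c z = 1) (hT : z ∈ cotangentSphere) :
    IsTangent c z (reebField c z) := by
  have he := norm_pos_of_level hl
  have hi := inv_norm_eq hl
  have hn := norm_sq_coords z.2
  obtain ⟨h1, h2⟩ := (mem_cotangentSphere_iff z).1 hT
  refine IsTangent.smul ⟨?_, ?_, ?_⟩ _
  · simp only [inner_coords, rotGen, PiLp.add_apply, PiLp.smul_apply, smul_eq_mul]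
    simp
    linear_combination (‖z.2‖ ^ 2)⁻¹ * h2
  · simp only [inner_coords, rotGen, PiLp.add_apply, PiLp.sub_apply, PiLp.smul_apply, smul_eq_mul]
    simp
    have : (‖z.2‖ ^ 2)⁻¹ * ‖z.2‖ ^ 2 = 1 := by field_simp
    linear_combination (-‖z.2‖ * (c + angMom z - 1 / 2) * z.1 2 - 1) * h1 + this -
      (‖z.2‖ ^ 2)⁻¹ * hn
  · have hin : inner ℝ z.2 (radius z • rotGen z.2 +
        (‖z.2‖ * (c + angMom z - 1 / 2)) • (!₂[0, 0, 1] - z.1 2 • z.1 : Space) - z.1) =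
        ‖z.2‖ * (c + angMom z - 1 / 2) * z.2 2 := by
      simp only [inner_coords, rotGen, PiLp.add_apply, PiLp.sub_apply, PiLp.smul_apply, smul_eq_mul]
      simp
      linear_combination (-‖z.2‖ * (c + angMom z - 1 / 2) * z.1 2 - 1) * h2
    simp only [hin]
    simp only [rotGen, PiLp.add_apply, PiLp.sub_apply, PiLp.smul_apply, smul_eq_mul]
    simp
    have hb : (‖z.2‖ ^ 2)⁻¹ * ‖z.2‖ = 1 + (c + angMom z - 1 / 2) * (1 - z.1 2) := by
      rw [← hi]; field_simp
    have hc : ‖z.2‖ * (c + angMom z - 1 / 2) * z.2 2 / ‖z.2‖ = (c + angMom z - 1 / 2) * z.2 2 := by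
      field_simp
    rw [one_div] at hc
    rw [hc]
    linear_combination -(c + angMom z - 1 / 2) * z.2 2 * hb

theorem liouville_reebField (hc : 3 / 2 < c) (hz : z ∈ boundedLevel c) :
    liouville z (reebField c z) = 1 := by
  have h := neg_lt_radius_mul_angMom hc hz
  have he := norm_pos_of_level hz.2.1
  have hn := norm_sq_coords z.2
  have e : inner ℝ z.2 ((1 / ‖z.2‖ ^ 2) • z.2 + radius z • rotGen z.1) =
      1 + radius z * angMom z := by
    simp only [inner_coords, rotGen, angMom, PiLp.add_apply, PiLp.smul_apply, smul_eq_mul]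
    simp
    have : (‖z.2‖ ^ 2)⁻¹ * ‖z.2‖ ^ 2 = 1 := by field_simp
    linear_combination this - (‖z.2‖ ^ 2)⁻¹ * hn
  rw [liouville, reebField, Prod.smul_fst, inner_smul_right, e, inv_mul_cancel₀ h.ne']

theorem symp_smul_left (a : ℝ) (v w : Space × Space) : symp (a • v) w = a * symp v w := by
  simp only [symp, Prod.smul_fst, Prod.smul_snd, inner_smul_left, inner_smul_right]
  simp
  ring

theorem symp_sub_left (v v' w : Space × Space) : symp (v - v') w = symp v w - symp v' w := by
  simp only [symp, Prod.fst_sub, Prod.snd_sub, inner_sub_left, inner_sub_right]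
  ring

/-- Up to a factor the contraction is minus the linearized level equation, modulo multiples of ξ ·
w.1 = 0 that come from the constraint force. -/
theorem symp_reebField {w : Space × Space} (hl : levelFun c z = 1)
    (hw : IsTangent c z w) : symp (reebField c z) w = 0 := by
  have he := norm_pos_of_level hl
  have hi := inv_norm_eq hl
  have hn := norm_sq_coords z.2
  obtain ⟨h1, h2, h3⟩ := hw
  have hb : (‖z.2‖ ^ 2)⁻¹ = (1 + (c + angMom z - 1 / 2) * (1 - z.1 2)) / ‖z.2‖ := by
    rw [← hi]; field_simp
  rw [reebField, symp_smul_left]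
  simp only [inner_coords] at h1 h2 h3
  simp only [symp, inner_coords, rotGen, PiLp.add_apply, PiLp.sub_apply, PiLp.smul_apply,
    smul_eq_mul]
  simp
  right
  rw [hb]
  field_simp at h3 ⊢
  linear_combination (-1) * h3 +
    (-‖z.2‖ ^ 2 * (2 * (c + angMom z) - 1) * z.1 2 - 2 * ‖z.2‖) * h1

/-! ### The frame ξ, η, ξ × η and uniqueness of the Reeb field. -/

theorem norm_cross_sq (hT : z ∈ cotangentSphere) : ‖cross z.1 z.2‖ ^ 2 = ‖z.2‖ ^ 2 := by
  obtain ⟨h1, h2⟩ := (mem_cotangentSphere_iff z).1 hT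
  rw [norm_sq_coords, norm_sq_coords]
  simp only [cross]
  simp
  linear_combination (z.2 0 ^ 2 + z.2 1 ^ 2 + z.2 2 ^ 2) * h1 -
    (z.1 0 * z.2 0 + z.1 1 * z.2 1 + z.1 2 * z.2 2) * h2

theorem inner_cross_left (v w : Space) : inner ℝ v (cross v w) = 0 := by
  simp only [inner_coords, cross]; simp; ring

theorem inner_cross_right (v w : Space) : inner ℝ w (cross v w) = 0 := by
  simp only [inner_coords, cross]; simp; ring

/-- The covector can be turned within the energy level. -/
theorem exists_tangent_vertical (hc : 3 / 2 < c) (hz : z ∈ boundedLevel c) :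
    ∃ κ : ℝ, ((0 : Space), cross z.1 z.2 + κ • z.2) ∈ tangentVectors (boundedLevel c) z := by
  have hn := norm_cross_sq hz.1
  have he : z.2 ≠ 0 := norm_pos_iff.1 (norm_pos_of_level hz.2.1)
  set ζ : ℝ → Space × Space := fun s => (z.1, Real.cos s • z.2 + Real.sin s • cross z.1 z.2)
  have hζ0 : ζ 0 = z := by simp [ζ]
  have hT : ∀ s, ζ s ∈ cotangentSphere := fun s => ⟨hz.1.1, by
    simp only [ζ, inner_add_right, inner_smul_right, inner_cross_left, hz.1.2]; simp⟩
  have h0 : ∀ s, (ζ s).2 ≠ 0 := fun s h => by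
    have h1 : inner ℝ z.2 (ζ s).2 = 0 := by rw [h, inner_zero_right]
    have h2 : inner ℝ (cross z.1 z.2) (ζ s).2 = 0 := by rw [h, inner_zero_right]
    simp only [ζ, inner_add_right, inner_smul_right, inner_cross_right, real_inner_self_eq_norm_sq,
      real_inner_comm (z.2) (cross _ _), hn] at h1 h2
    have h3 : ‖z.2‖ ^ 2 ≠ 0 := by positivity
    have h4 : Real.cos s = 0 := by simpa [h3, he] using h1
    have h5 : Real.sin s = 0 := by simpa [h3, he] using h2
    have := Real.sin_sq_add_cos_sq s
    rw [h4, h5] at this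
    norm_num at this
  have hd : HasDerivAt ζ ((0 : Space), cross z.1 z.2) 0 := by
    have := (hasDerivAt_const (0 : ℝ) z.1).prodMk (((Real.hasDerivAt_cos 0).smul_const z.2).add
      ((Real.hasDerivAt_sin 0).smul_const (cross z.1 z.2)))
    simpa using this
  obtain ⟨κ, hκ⟩ := exists_tangent_of_curve hc hT h0 (hζ0 ▸ hz) hd
  rw [hζ0] at hκ
  refine ⟨κ, _, fun s => scale_mem hc (hT s) (h0 s), ?_, hκ⟩
  simp only [hζ0, scale_eq_one hc hz, one_smul]

/-- The curve which rotates the base point perpendicularly to the covector. -/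
noncomputable def baseCurve (z : Space × Space) (s : ℝ) : Space × Space :=
  (Real.cos s • z.1 + (Real.sin s / ‖z.2‖) • cross z.1 z.2, z.2)

theorem baseCurve_zero (z : Space × Space) : baseCurve z 0 = z := by simp [baseCurve]

theorem baseCurve_mem (hT : z ∈ cotangentSphere) (he : z.2 ≠ 0) (s : ℝ) :
    baseCurve z s ∈ cotangentSphere := by
  have hn := norm_cross_sq hT
  have he' : ‖z.2‖ ≠ 0 := norm_ne_zero_iff.2 he
  constructor
  · rw [← pow_eq_one_iff_of_nonneg (norm_nonneg _) two_ne_zero]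
    rw [baseCurve, norm_add_sq_real, norm_smul, norm_smul, mul_pow, mul_pow, hn, inner_smul_left,
      inner_smul_right, inner_cross_left, hT.1]
    simp only [Real.norm_eq_abs, sq_abs, div_pow]
    field_simp
    simp only [mul_zero, add_zero]
    rw [← add_mul, Real.cos_sq_add_sin_sq, one_mul]
  · change inner ℝ (_ + _) z.2 = 0
    rw [real_inner_comm, inner_add_right, inner_smul_right, inner_smul_right, inner_cross_right,
      real_inner_comm, hT.2]
    simp

/-- Kept apart from the tangent vector it yields, because the same curve later approaches the fibre
over the north pole in `boundedLevel_subset_energyClosure`. -/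
theorem exists_hasDerivAt_baseCurve (hc : 3 / 2 < c) (hz : z ∈ boundedLevel c) :
    ∃ κ : ℝ, HasDerivAt (fun s => ((baseCurve z s).1, scale c (baseCurve z s) • z.2))
      ((1 / ‖z.2‖) • cross z.1 z.2, κ • z.2) 0 := by
  have he : z.2 ≠ 0 := norm_pos_iff.1 (norm_pos_of_level hz.2.1)
  have hd : HasDerivAt (baseCurve z) ((1 / ‖z.2‖) • cross z.1 z.2, 0) 0 := by
    have := (((Real.hasDerivAt_cos 0).smul_const z.1).add
      (((Real.hasDerivAt_sin 0).div_const ‖z.2‖).smul_const (cross z.1 z.2))).prodMk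
      (hasDerivAt_const (0 : ℝ) z.2)
    have e : baseCurve z = fun s => (Real.cos s • z.1 + (Real.sin s / ‖z.2‖) • cross z.1 z.2, z.2) :=
      rfl
    rw [e]
    simpa using this
  obtain ⟨κ, hκ⟩ := exists_tangent_of_curve hc (baseCurve_mem hz.1 he) (fun _ => he)
    (by rwa [baseCurve_zero]) hd
  refine ⟨κ, ?_⟩
  rw [baseCurve_zero, zero_add] at hκ
  exact hκ

theorem exists_tangent_horizontal (hc : 3 / 2 < c) (hz : z ∈ boundedLevel c) :
    ∃ κ : ℝ, ((1 / ‖z.2‖) • cross z.1 z.2, κ • z.2) ∈ tangentVectors (boundedLevel c) z := by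
  have he : z.2 ≠ 0 := norm_pos_iff.1 (norm_pos_of_level hz.2.1)
  obtain ⟨κ, hκ⟩ := exists_hasDerivAt_baseCurve hc hz
  refine ⟨κ, _, fun s => scale_mem hc (baseCurve_mem hz.1 he s) he, ?_, hκ⟩
  rw [baseCurve_zero, scale_eq_one hc hz, one_smul]

/-- The expansion of a vector in the orthogonal frame `ξ, η, ξ × η`. -/
theorem norm_sq_smul_eq_frame (hT : z ∈ cotangentSphere) (he : z.2 ≠ 0) (v : Space) :
    ‖z.2‖ ^ 2 • v = (‖z.2‖ ^ 2 * inner ℝ z.1 v) • z.1 + inner ℝ z.2 v • z.2 +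
      inner ℝ (cross z.1 z.2) v • cross z.1 z.2 := by
  have he' : ‖z.2‖ ≠ 0 := norm_ne_zero_iff.2 he
  have hn := norm_cross_sq hT
  have i1 : inner ℝ z.1 z.1 = (1 : ℝ) := by rw [real_inner_self_eq_norm_sq, hT.1, one_pow]
  have i2 := hT.2
  have i3 := inner_cross_left z.1 z.2
  have i4 := inner_cross_right z.1 z.2
  rw [← real_inner_self_eq_norm_sq] at hn
  have hE : inner ℝ z.2 z.2 = ‖z.2‖ ^ 2 := real_inner_self_eq_norm_sq _
  set n := cross z.1 z.2
  -- Frame times dual frame is the identity; the product in the other order is then the completeness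
  -- relation that is wanted.
  have key : !![z.1 0, z.1 1, z.1 2; z.2 0, z.2 1, z.2 2; n 0, n 1, n 2] *
      !![z.1 0, z.2 0 / ‖z.2‖ ^ 2, n 0 / ‖z.2‖ ^ 2; z.1 1, z.2 1 / ‖z.2‖ ^ 2, n 1 / ‖z.2‖ ^ 2;
        z.1 2, z.2 2 / ‖z.2‖ ^ 2, n 2 / ‖z.2‖ ^ 2] = (1 : Matrix (Fin 3) (Fin 3) ℝ) := by
    simp only [inner_coords] at i1 i2 i3 i4 hn hE
    ext i j
    fin_cases i <;> fin_cases j <;> simp [Matrix.mul_apply, Fin.sum_univ_three] <;>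
      field_simp <;> linarith
  have key2 := mul_eq_one_comm.1 key
  simp only [inner_coords]
  ext i
  have k0 := congrFun (congrFun key2 i) 0
  have k1 := congrFun (congrFun key2 i) 1
  have k2 := congrFun (congrFun key2 i) 2
  fin_cases i <;> simp [Matrix.mul_apply, Fin.sum_univ_three, Matrix.one_apply] at k0 k1 k2 ⊢ <;>
    field_simp at k0 k1 k2 <;> linear_combination (-v 0) * k0 - v 1 * k1 - v 2 * k2

theorem inner_eq_frame (hT : z ∈ cotangentSphere) (he : z.2 ≠ 0) (v w : Space) :
    ‖z.2‖ ^ 2 * inner ℝ v w = ‖z.2‖ ^ 2 * inner ℝ z.1 v * inner ℝ z.1 w +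
      inner ℝ z.2 v * inner ℝ z.2 w +
      inner ℝ (cross z.1 z.2) v * inner ℝ (cross z.1 z.2) w := by
  have h := congrArg (fun u => inner ℝ u w) (norm_sq_smul_eq_frame hT he v)
  simpa only [inner_add_left, real_inner_smul_left] using h

/-- A tangent vector on which `λ` vanishes and which is orthogonal to the tangent space with
respect to `dλ` is zero. -/
theorem eq_zero_of_symp_eq_zero (hc : 3 / 2 < c) (hz : z ∈ boundedLevel c) {u : Space × Space}
    (hu : IsTangent c z u) (hl : liouville z u = 0)
    (hs : ∀ w ∈ tangentVectors (boundedLevel c) z, symp u w = 0) : u = 0 := by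
  have he := norm_pos_of_level hz.2.1
  have he0 : z.2 ≠ 0 := norm_pos_iff.1 he
  have hn := norm_cross_sq hz.1
  obtain ⟨h1, h2, h3⟩ := hu
  have hl' : inner ℝ z.2 u.1 = 0 := hl
  -- The unknown radial terms κ η pair with u.1 to κ λ(u) = 0. So the vertical vector tests the ξ ×
  -- η component of u.1, and the horizontal one that of u.2.
  obtain ⟨κ₁, k1⟩ := exists_tangent_vertical hc hz
  obtain ⟨κ₂, k2⟩ := exists_tangent_horizontal hc hz
  have s1 := hs _ k1
  have s2 := hs _ k2
  simp only [symp, inner_zero_right, inner_add_left, real_inner_smul_left, hl', mul_zero,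
    inner_smul_right, zero_sub, add_zero, sub_zero, neg_eq_zero] at s1 s2
  have s3 : inner ℝ (cross z.1 z.2) u.2 = 0 := by
    rw [real_inner_comm]
    exact (mul_eq_zero.1 s2).resolve_left (by positivity)
  have hu1 : u.1 = 0 := by
    have h := norm_sq_smul_eq_frame hz.1 he0 u.1
    rw [h1, hl', s1] at h
    simpa [he0] using h
  rw [hu1] at h3 h2
  have h4 : inner ℝ z.2 u.2 = 0 := by
    have hi := inv_norm_eq hz.2.1
    have hρ := neg_lt_radius_mul_angMom hc hz
    have h5 := norm_sq_smul_eq_frame hz.1 he0 u.2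
    have h6 : inner ℝ z.1 u.2 = 0 := by simpa using h2
    rw [h6, s3] at h5
    simp only [mul_zero, zero_smul, zero_add, add_zero] at h5
    have c0 := congrArg (fun v : Space => v 0) h5
    have c1 := congrArg (fun v : Space => v 1) h5
    simp only [PiLp.smul_apply, smul_eq_mul] at c0 c1
    set b : ℝ := inner ℝ z.2 u.2
    simp only [PiLp.zero_apply, zero_mul, mul_zero, zero_add, sub_zero] at h3
    have c0' : u.2 0 = b * z.2 0 / ‖z.2‖ ^ 2 := by field_simp; linarith
    have c1' : u.2 1 = b * z.2 1 / ‖z.2‖ ^ 2 := by field_simp; linarith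
    rw [c0', c1'] at h3
    -- What remains of u is radial, and the radial derivative of `levelFun` is 1 + ρA.
    have h7 : b / ‖z.2‖ ^ 2 * (1 + radius z * angMom z) = 0 := by
      have hlev := hz.2.1
      unfold levelFun radius at hlev
      have hA : angMom z = z.1 1 * z.2 0 - z.1 0 * z.2 1 := rfl
      rw [← sub_eq_zero.2 h3]
      have : b / ‖z.2‖ = b / ‖z.2‖ ^ 2 * ‖z.2‖ := by field_simp
      rw [this]
      unfold radius
      linear_combination (-b / ‖z.2‖ ^ 2) * hlev + b / ‖z.2‖ ^ 2 * ‖z.2‖ * (1 - z.1 2) * hA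
    simpa [hρ.ne', he.ne'] using h7
  have hu2 : u.2 = 0 := by
    have h := norm_sq_smul_eq_frame hz.1 he0 u.2
    have h6 : inner ℝ z.1 u.2 = 0 := by simpa using h2
    rw [h6, h4, s3] at h
    simpa [he0] using h
  exact Prod.ext hu1 hu2

/-- Reeb orbits are integral curves of the Reeb vector field. -/
theorem IsReebOrbit.hasDerivAt (hc : 3 / 2 < c) {γ : ℝ → Space × Space}
    (h : IsReebOrbit (boundedLevel c) γ) (t : ℝ) : HasDerivAt γ (reebField c (γ t)) t := by
  obtain ⟨hm, v, hv, hl, hs⟩ := h t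
  have hR := reebField_isTangent hm.2.1 hm.1
  have hvt := isTangent_of_hasDerivAt (fun s => (h s).1) hv
  have : v - reebField c (γ t) = 0 := by
    refine eq_zero_of_symp_eq_zero hc hm (hvt.sub hR) ?_ fun w hw => ?_
    · have := liouville_reebField hc hm
      simp only [liouville, Prod.fst_sub, inner_sub_right] at this hl ⊢
      linarith
    · rw [symp_sub_left, hs w hw, symp_reebField hm.2.1 (isTangent_of_mem hw), sub_zero]
  rwa [← sub_eq_zero.1 this]

theorem isReebOrbit_of_hasDerivAt (hc : 3 / 2 < c) {γ : ℝ → Space × Space}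
    (hm : ∀ t, γ t ∈ boundedLevel c) (h : ∀ t, HasDerivAt γ (reebField c (γ t)) t) :
    IsReebOrbit (boundedLevel c) γ := fun t =>
  ⟨hm t, _, h t, liouville_reebField hc (hm t), fun _ hw =>
    symp_reebField (hm t).2.1 (isTangent_of_mem hw)⟩

end RotatingKepler

namespace RotatingKepler

/-! ### Integration of the Reeb flow -/

/-- If `f' = -i φ' f`, a non-zero value of `f` is attained again only after `φ` has changed by a
multiple of `2π`. -/
theorem exists_phase_eq {f : ℝ → ℂ} {φ φ' : ℝ → ℝ} {T : ℝ} (hφ : ∀ t, HasDerivAt φ (φ' t) t)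
    (hf : ∀ t, HasDerivAt f (-(Complex.I * φ' t * f t)) t) (hT : f T = f 0) (h0 : f 0 ≠ 0) :
    ∃ n : ℤ, φ T - φ 0 = 2 * Real.pi * n := by
  have hd : ∀ t, HasDerivAt (fun s => f s * Complex.exp (Complex.I * φ s)) 0 t := fun t => by
    refine ((hf t).mul (((hφ t).ofReal_comp).const_mul Complex.I).cexp).congr_deriv ?_
    ring
  have hconst := is_const_of_deriv_eq_zero (fun t => (hd t).differentiableAt)
    (fun t => (hd t).deriv) T 0
  simp only [hT] at hconst
  have h1 := mul_left_cancel₀ h0 hconst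
  rw [Complex.exp_eq_exp_iff_exists_int] at h1
  obtain ⟨n, hn⟩ := h1
  refine ⟨n, ?_⟩
  have h2 : Complex.I * ((φ T : ℂ) - φ 0 - 2 * Real.pi * n) = 0 := by linear_combination hn
  have h3 := (mul_eq_zero.1 h2).resolve_left Complex.I_ne_zero
  have h4 : ((φ T - φ 0 - 2 * Real.pi * n : ℝ) : ℂ) = 0 := by push_cast; exact h3
  linarith [Complex.ofReal_eq_zero.1 h4]

section Flow

variable {c : ℝ} {γ : ℝ → Space × Space}

/-- The coordinates of an integral curve of the Reeb vector field. -/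
theorem hasDerivAt_reeb_coords {t : ℝ} (h : HasDerivAt γ (reebField c (γ t)) t) :
    let z := γ t
    let g := (1 + radius z * angMom z)⁻¹
    let κ := c + angMom z - 1 / 2
    HasDerivAt (fun s => (γ s).1 0) (g * (z.2 0 / ‖z.2‖ ^ 2 + radius z * z.1 1)) t ∧
    HasDerivAt (fun s => (γ s).1 1) (g * (z.2 1 / ‖z.2‖ ^ 2 - radius z * z.1 0)) t ∧
    HasDerivAt (fun s => (γ s).1 2) (g * (z.2 2 / ‖z.2‖ ^ 2)) t ∧
    HasDerivAt (fun s => (γ s).2 0)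
      (g * (radius z * z.2 1 - ‖z.2‖ * κ * z.1 2 * z.1 0 - z.1 0)) t ∧
    HasDerivAt (fun s => (γ s).2 1)
      (g * (-radius z * z.2 0 - ‖z.2‖ * κ * z.1 2 * z.1 1 - z.1 1)) t ∧
    HasDerivAt (fun s => (γ s).2 2)
      (g * (‖z.2‖ * κ * (1 - z.1 2 ^ 2) - z.1 2)) t := by
  intro z g κ
  refine ⟨(hasDerivAt_coord h.fst 0).congr_deriv ?_, (hasDerivAt_coord h.fst 1).congr_deriv ?_,
    (hasDerivAt_coord h.fst 2).congr_deriv ?_, (hasDerivAt_coord h.snd 0).congr_deriv ?_,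
    (hasDerivAt_coord h.snd 1).congr_deriv ?_, (hasDerivAt_coord h.snd 2).congr_deriv ?_⟩
  all_goals
    simp [reebField, rotGen, g, κ, z, -mul_eq_mul_left_iff]
    ring

theorem hasDerivAt_reeb_norm (hm : ∀ t, γ t ∈ boundedLevel c)
    (h : ∀ t, HasDerivAt γ (reebField c (γ t)) t) (t : ℝ) : HasDerivAt (fun s => ‖(γ s).2‖)
    ((1 + radius (γ t) * angMom (γ t))⁻¹ * ((c + angMom (γ t) - 1 / 2) * (γ t).2 2)) t := by
  have he := norm_pos_of_level (hm t).2.1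
  obtain ⟨h1, h2⟩ := (mem_cotangentSphere_iff _).1 (hm t).1
  refine (hasDerivAt_norm_space (h t).snd (norm_pos_iff.1 he)).congr_deriv ?_
  rw [div_eq_iff he.ne']
  simp [reebField, rotGen, inner_coords]
  linear_combination (-(1 + radius (γ t) * angMom (γ t))⁻¹ *
    (‖(γ t).2‖ * (c + angMom (γ t) - 1 / 2) * (γ t).1 2 + 1)) * h2

theorem angMom_const (h : ∀ t, HasDerivAt γ (reebField c (γ t)) t) (t : ℝ) : angMom (γ t) = angMom (γ 0) := by
  have hd : ∀ t, HasDerivAt (fun s => angMom (γ s)) 0 t := fun t => by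
    refine (hasDerivAt_angMom (h t)).congr_deriv ?_
    simp [reebField, rotGen]
    ring
  exact is_const_of_deriv_eq_zero (fun t => (hd t).differentiableAt) (fun t => (hd t).deriv) t 0

end Flow

/-! ### The Kepler motion as a rotation of complex quantities. -/

/-- The vertical components of the regularized position and momentum on the Kepler sphere. -/
noncomputable def vertPhase (k : ℝ) (z : Space × Space) : ℂ :=
  (‖z.2‖ * (1 + z.1 2) - 1 : ℝ) + (k * z.2 2 : ℝ) * Complex.I

/-- The horizontal component of the regularized position on the Kepler sphere. -/
noncomputable def horPos (k : ℝ) (z : Space × Space) : ℂ :=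
  (k * (‖z.2‖ * z.1 0) : ℝ) + (k * (‖z.2‖ * z.1 1) : ℝ) * Complex.I

/-- The horizontal component of the regularized momentum on the Kepler sphere, where
`κ = (k² - 1) / 2`. -/
noncomputable def horMom (κ : ℝ) (z : Space × Space) : ℂ :=
  (z.2 0 / ‖z.2‖ + κ * (z.2 2 * z.1 0) : ℝ) + (z.2 1 / ‖z.2‖ + κ * (z.2 2 * z.1 1) : ℝ) * Complex.I

section Kepler

variable {c k : ℝ} {z : Space × Space}

theorem angMom_sq_eq (hT : z ∈ cotangentSphere) :
    angMom z ^ 2 = (1 - z.1 2 ^ 2) * ‖z.2‖ ^ 2 - z.2 2 ^ 2 := by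
  obtain ⟨h1, h2⟩ := (mem_cotangentSphere_iff z).1 hT
  rw [norm_sq_coords]
  unfold angMom
  linear_combination (z.2 0 ^ 2 + z.2 1 ^ 2 + z.2 2 ^ 2) * h1 -
    (z.1 0 * z.2 0 + z.1 1 * z.2 1 - z.1 2 * z.2 2) * h2 - z.2 2 ^ 2 * h1

/-- In Kepler terms `vertPhase` is |q||p|² - 1 - ik p·q = e · exp(-iE) with eccentricity e and
eccentric anomaly E. Nonnegativity of e² is the bound |kA| ≤ 1. -/
theorem normSq_vertPhase (hz : z ∈ boundedLevel c) (hk : k ^ 2 = 2 * (c + angMom z)) :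
    Complex.normSq (vertPhase k z) = 1 - (k * angMom z) ^ 2 := by
  have hA := angMom_sq_eq hz.1
  have hl := hz.2.1
  unfold levelFun radius at hl
  rw [vertPhase, Complex.normSq_add_mul_I, mul_pow k (angMom z), hA]
  linear_combination 2 * ‖z.2‖ * (1 + z.1 2) * hl + ‖z.2‖ ^ 2 * (1 - z.1 2 ^ 2) * hk

/-- Both signs of ε are kept: the combination vanishes exactly when ε(kA) = -1, on one of the two
kinds of circular orbits, and there the other sign still carries a phase. -/
theorem normSq_horPos_add (hz : z ∈ boundedLevel c) (hk : k ^ 2 = 2 * (c + angMom z)) {ε : ℝ}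
    (hε : ε ^ 2 = 1) :
    Complex.normSq (horPos k z + ε * Complex.I * horMom (c + angMom z - 1 / 2) z) =
      (1 + ε * (k * angMom z)) ^ 2 := by
  obtain ⟨h1, h2⟩ := (mem_cotangentSphere_iff z).1 hz.1
  have hA := angMom_sq_eq hz.1
  have he := norm_pos_of_level hz.2.1
  have hi := inv_norm_eq hz.2.1
  have hn := norm_sq_coords z.2
  have hl := hz.2.1
  unfold levelFun radius at hl
  have e1 : horPos k z + ε * Complex.I * horMom (c + angMom z - 1 / 2) z =
      (k * (‖z.2‖ * z.1 0) - ε * (z.2 1 / ‖z.2‖ + (c + angMom z - 1 / 2) * (z.2 2 * z.1 1)) : ℝ) +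
      (k * (‖z.2‖ * z.1 1) + ε * (z.2 0 / ‖z.2‖ + (c + angMom z - 1 / 2) * (z.2 2 * z.1 0)) : ℝ) *
        Complex.I := by
    unfold horPos horMom
    push_cast
    linear_combination (ε * (z.2 1 / ‖z.2‖ + (c + angMom z - 1 / 2) * (z.2 2 * z.1 1)) : ℂ) *
      Complex.I_sq
  rw [e1, Complex.normSq_add_mul_I]
  set κ := c + angMom z - 1 / 2 with hκ
  have hk' : k ^ 2 = 1 + 2 * κ := by rw [hk, hκ]; ring
  have e2 : (k * (‖z.2‖ * z.1 0) - ε * (z.2 1 / ‖z.2‖ + κ * (z.2 2 * z.1 1))) ^ 2 +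
      (k * (‖z.2‖ * z.1 1) + ε * (z.2 0 / ‖z.2‖ + κ * (z.2 2 * z.1 0))) ^ 2 =
      k ^ 2 * ‖z.2‖ ^ 2 * (1 - z.1 2 ^ 2) + 2 * ε * (k * angMom z) +
      ((z.2 0 ^ 2 + z.2 1 ^ 2) * (1 / ‖z.2‖) ^ 2 -
        2 * κ * z.2 2 ^ 2 * z.1 2 * (1 / ‖z.2‖) + κ ^ 2 * z.2 2 ^ 2 * (1 - z.1 2 ^ 2)) := by
    have hx : z.1 0 ^ 2 + z.1 1 ^ 2 = 1 - z.1 2 ^ 2 := by linarith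
    have hy : z.1 0 * z.2 0 + z.1 1 * z.2 1 = - (z.1 2 * z.2 2) := by linarith
    have hAA : angMom z = z.1 1 * z.2 0 - z.1 0 * z.2 1 := rfl
    have hee : ‖z.2‖ * (1 / ‖z.2‖) = 1 := by field_simp
    simp only [div_eq_mul_one_div (z.2 0), div_eq_mul_one_div (z.2 1)]
    rw [hAA]
    generalize 1 / ‖z.2‖ = i at *
    linear_combination (k ^ 2 * ‖z.2‖ ^ 2 + κ ^ 2 * z.2 2 ^ 2) * hx +
      2 * κ * z.2 2 * i * hy + 2 * ε * k * (z.1 1 * z.2 0 - z.1 0 * z.2 1) * hee +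
      ((z.2 1 * i + κ * (z.2 2 * z.1 1)) ^ 2 + (z.2 0 * i + κ * (z.2 2 * z.1 0)) ^ 2) * hε
  have e3 : (z.2 0 ^ 2 + z.2 1 ^ 2) * (1 / ‖z.2‖) ^ 2 = 1 - z.2 2 ^ 2 * (1 / ‖z.2‖) ^ 2 := by
    field_simp
    linarith
  rw [e2, e3, hi]
  linear_combination (-(k * angMom z) ^ 2) * hε - k ^ 2 * hA + z.2 2 ^ 2 * hk'

theorem one_lt_keplerRate (hc : 3 / 2 < c) (hz : z ∈ boundedLevel c) (hk0 : 0 < k)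
    (hk : k ^ 2 = 2 * (c + angMom z)) : 1 < k := by
  have := neg_one_lt_angMom hc hz
  nlinarith

end Kepler

section Flow

variable {c : ℝ} {γ : ℝ → Space × Space}
-- Vertical components do not feel rotations about the vertical axis, so only the Kepler phase kτ
-- appears.
theorem hasDerivAt_vertPhase (hm : ∀ t, γ t ∈ boundedLevel c)
    (h : ∀ t, HasDerivAt γ (reebField c (γ t)) t) {k : ℝ}
    (hk : k ^ 2 = 2 * (c + angMom (γ 0))) (t : ℝ) :
    HasDerivAt (fun s => vertPhase k (γ s))
      (-(Complex.I * ((k * (1 + radius (γ t) * angMom (γ t))⁻¹ : ℝ) : ℂ) *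
        vertPhase k (γ t))) t := by
  have hA := angMom_const h t
  have he := norm_pos_of_level (hm t).2.1
  have hl := (hm t).2.1
  obtain ⟨-, -, d2, -, -, d5⟩ := hasDerivAt_reeb_coords (h t)
  have dn := hasDerivAt_reeb_norm hm h t
  have r := ((dn.mul (d2.const_add 1)).sub_const 1).ofReal_comp
  have i := (d5.const_mul k).ofReal_comp
  refine (r.add (i.mul_const Complex.I)).congr_deriv ?_
  unfold levelFun radius at hl
  have hi := inv_norm_eq (hm t).2.1
  rw [← hA] at hk
  simp only []
  generalize (1 + radius (γ t) * angMom (γ t))⁻¹ = g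
  have e1 : g * ((c + angMom (γ t) - 1 / 2) * (γ t).2 2) * (1 + (γ t).1 2) +
      ‖(γ t).2‖ * (g * ((γ t).2 2 / ‖(γ t).2‖ ^ 2)) = k * g * (k * (γ t).2 2) := by
    have : ‖(γ t).2‖ * (g * ((γ t).2 2 / ‖(γ t).2‖ ^ 2)) = g * (γ t).2 2 * (1 / ‖(γ t).2‖) := by
      field_simp
    rw [this, hi]
    linear_combination (-g * (γ t).2 2) * hk
  have e2 : k * (g * (‖(γ t).2‖ * (c + angMom (γ t) - 1 / 2) * (1 - (γ t).1 2 ^ 2) -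
      (γ t).1 2)) = -(k * g * (‖(γ t).2‖ * (1 + (γ t).1 2) - 1)) := by
    linear_combination k * g * (1 + (γ t).1 2) * hl
  rw [e1, e2, vertPhase]
  push_cast
  linear_combination (k * g * (k * (γ t).2 2) : ℂ) * Complex.I_sq

/-- The frame turns the horizontal plane with speed ρg, while position and momentum rotate into each
other with speed kg. The combinations with ±i diagonalize the second rotation, hence the speed g(ρ +
εk). -/
theorem hasDerivAt_horPhase (hm : ∀ t, γ t ∈ boundedLevel c)
    (h : ∀ t, HasDerivAt γ (reebField c (γ t)) t) {k : ℝ} (hk : k ^ 2 = 2 * (c + angMom (γ 0))) {ε : ℝ}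
    (hε : ε ^ 2 = 1) (t : ℝ) :
    HasDerivAt (fun s => horPos k (γ s) + ε * Complex.I * horMom (c + angMom (γ 0) - 1 / 2) (γ s))
      (-(Complex.I * (((1 + radius (γ t) * angMom (γ t))⁻¹ * (radius (γ t) + ε * k) : ℝ) : ℂ) *
        (horPos k (γ t) + ε * Complex.I * horMom (c + angMom (γ 0) - 1 / 2) (γ t)))) t := by
  have hA := angMom_const h t
  have he := norm_pos_of_level (hm t).2.1
  have hl := (hm t).2.1
  have hi := inv_norm_eq (hm t).2.1
  obtain ⟨d0, d1, d2, d3, d4, d5⟩ := hasDerivAt_reeb_coords (h t)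
  have dn := hasDerivAt_reeb_norm hm h t
  set κ := c + angMom (γ 0) - 1 / 2 with hκ
  rw [← hA] at hk
  have hk' : k ^ 2 = 1 + 2 * κ := by rw [hk, hκ, hA]; ring
  simp only [hA, ← hκ] at d0 d1 d2 d3 d4 d5 dn hi ⊢
  unfold levelFun at hl
  have hl' : ‖(γ t).2‖ + κ * ‖(γ t).2‖ * (1 - (γ t).1 2) = 1 := by
    rw [hA] at hl; unfold radius at hl; rw [hκ]; linarith
  set g := (1 + radius (γ t) * angMom (γ 0))⁻¹
  set e := ‖(γ t).2‖ with hee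
  set ρ := radius (γ t)
  have hei : e * (1 / e) = 1 := by field_simp
  -- Templates for one horizontal coordinate of position and of momentum: r and q stand for the
  -- coordinates that the frame rotation mixes in, with opposite signs for the two indices.
  have ep (a b r : ℝ) : k * (g * (κ * (γ t).2 2) * a + e * (g * (b / e ^ 2 + ρ * r))) =
      g * k * (b / e + κ * ((γ t).2 2 * a)) + g * ρ * (k * (e * r)) := by
    field_simp
    ring
  have em (a b r q : ℝ) : (g * (ρ * q - e * κ * (γ t).1 2 * a - a) * e -
      b * (g * (κ * (γ t).2 2))) / e ^ 2 + κ * (g * (e * κ * (1 - (γ t).1 2 ^ 2) - (γ t).1 2) * a +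
      (γ t).2 2 * (g * (b / e ^ 2 + ρ * r))) =
      g * ρ * (q / e + κ * ((γ t).2 2 * r)) - g * k * (k * (e * a)) := by
    have : (g * (ρ * q - e * κ * (γ t).1 2 * a - a) * e -
        b * (g * (κ * (γ t).2 2))) / e ^ 2 = g * (ρ * q - e * κ * (γ t).1 2 * a - a) * (1 / e) -
        b * (g * (κ * (γ t).2 2)) / e ^ 2 := by field_simp
    rw [this, div_eq_mul_one_div q]
    linear_combination g * ((-κ * (γ t).1 2 * a) * hei - a * hi +
      (κ * (1 + (γ t).1 2) + 1) * a * hl' + e * a * hk')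
  have p0 := ((dn.mul d0).const_mul k).congr_deriv (ep ((γ t).1 0) ((γ t).2 0) ((γ t).1 1))
  have p1 := ((dn.mul d1).const_mul k).congr_deriv (Eq.trans (by ring)
    (ep ((γ t).1 1) ((γ t).2 1) (-(γ t).1 0)))
  have m0 := ((d3.div dn he.ne').add ((d5.mul d0).const_mul κ)).congr_deriv
    (em ((γ t).1 0) ((γ t).2 0) ((γ t).1 1) ((γ t).2 1))
  have m1 := ((d4.div dn he.ne').add ((d5.mul d1).const_mul κ)).congr_deriv (Eq.trans (by ring)
    (em ((γ t).1 1) ((γ t).2 1) (-(γ t).1 0) (-(γ t).2 0)))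
  have p := p0.ofReal_comp.add (p1.ofReal_comp.mul_const Complex.I)
  have m := m0.ofReal_comp.add (m1.ofReal_comp.mul_const Complex.I)
  refine (p.add (m.const_mul (ε * Complex.I : ℂ))).congr_deriv ?_
  have hε' : (ε : ℂ) ^ 2 = 1 := by exact_mod_cast hε
  rw [horPos, horMom]
  push_cast
  linear_combination (g * k * ε ^ 2 * (((γ t).2 0 / e + κ * ((γ t).2 2 * (γ t).1 0)) +
      ((γ t).2 1 / e + κ * ((γ t).2 2 * (γ t).1 1)) * Complex.I) +
      g * ρ * (k * (e * (γ t).1 1)) +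
      g * ρ * ε * Complex.I * ((γ t).2 1 / e + κ * ((γ t).2 2 * (γ t).1 1)) : ℂ) * Complex.I_sq -
    (g * k * (((γ t).2 0 / e + κ * ((γ t).2 2 * (γ t).1 0)) +
      ((γ t).2 1 / e + κ * ((γ t).2 2 * (γ t).1 1)) * Complex.I) : ℂ) * hε'

end Flow

/-! ### Winding numbers and the lower bound for the periods. -/

/-- The lower bound for the periods in terms of the winding numbers of the Kepler ellipse and of
the rotating frame. -/
theorem le_period_of_windings {k A a b T : ℝ} (hk : 1 < k) (hA : -1 ≤ k * A)
    (hb : b = a / k ^ 2) (hT : T = a + A * b) (hT0 : 0 < T) {m n : ℤ}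
    (hm : k * a = 2 * Real.pi * m) (hn : b = 2 * Real.pi * n) : 2 * Real.pi / k ≤ T := by
  have hk0 : 0 < k := by linarith
  have hpi := Real.pi_pos
  have hA' : 0 < 1 + A / k ^ 2 := by
    have : (1 + A / k ^ 2) * k ^ 3 = k ^ 3 + k * A := by field_simp
    have h3 : 1 < k ^ 3 := by nlinarith [mul_pos hk0 hk0]
    have h4 : 0 < (1 + A / k ^ 2) * k ^ 3 := by linarith
    exact (pos_iff_pos_of_mul_pos h4).2 (by positivity)
  have ha : 0 < a := by
    have : T = a * (1 + A / k ^ 2) := by rw [hT, hb]; ring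
    rw [this] at hT0
    exact (pos_iff_pos_of_mul_pos hT0).2 hA'
  have hb0 : 0 < b := by rw [hb]; positivity
  have hn0 : (0 : ℝ) < n := by
    rw [hn] at hb0
    exact (pos_iff_pos_of_mul_pos hb0).1 (by positivity)
  -- Kepler's third law reads m = k³n, with k > 1 and n > 0.
  have hmn : (n : ℝ) < m := by
    have h1 : 2 * Real.pi * m = k ^ 3 * (2 * Real.pi * n) := by
      rw [← hm, ← hn, hb]; field_simp
    have h3 : 1 < k ^ 3 := by nlinarith [mul_pos hk0 hk0]
    have h2 : (m : ℝ) = k ^ 3 * n := by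
      have : 2 * Real.pi * (m - k ^ 3 * n) = 0 := by linarith
      have := (mul_eq_zero.1 this).resolve_left (by positivity)
      linarith
    nlinarith
  -- By integrality and kA ≥ -1, m + kAn ≥ m - n ≥ 1.
  have hmn' : (n : ℝ) + 1 ≤ m := by exact_mod_cast hmn
  have e : T * k = 2 * Real.pi * m + k * A * (2 * Real.pi * n) := by
    rw [hT, ← hm, ← hn]; ring
  rw [div_le_iff₀ hk0, e]
  nlinarith [mul_pos hpi hn0]

section Flow

variable {c : ℝ} {γ : ℝ → Space × Space}

theorem continuous_coords (h : Continuous γ) : Continuous fun s =>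
    (1 + radius (γ s) * angMom (γ s)) := by
  have h1 := continuous_radius.comp h
  have h2 := continuous_angMom.comp h
  exact continuous_const.add (h1.mul h2)

/-- A periodic integral curve of the Reeb vector field has period at least `2π / k`, where
`-k² / 2` is the Kepler energy. -/
theorem le_period (hc : 3 / 2 < c) (hm : ∀ t, γ t ∈ boundedLevel c)
    (h : ∀ t, HasDerivAt γ (reebField c (γ t)) t) {T k : ℝ} (hT : 0 < T)
    (hper : γ T = γ 0) (hk0 : 0 < k) (hk : k ^ 2 = 2 * (c + angMom (γ 0))) :
    2 * Real.pi / k ≤ T := by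
  set A := angMom (γ 0) with hA0
  have hA := angMom_const h
  have hk1 := one_lt_keplerRate hc (hm 0) hk0 hk
  set g : ℝ → ℝ := fun s => (1 + radius (γ s) * angMom (γ s))⁻¹ with hg
  have hgpos : ∀ s, 0 < 1 + radius (γ s) * angMom (γ s) := fun s =>
    neg_lt_radius_mul_angMom hc (hm s)
  have hγ : Continuous γ := continuous_iff_continuousAt.2 fun t => (h t).continuousAt
  have hgc : Continuous g := (continuous_coords hγ).inv₀ fun s => (hgpos s).ne'
  set τ : ℝ → ℝ := fun s => ∫ x in (0 : ℝ)..s, g x with hτ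
  have dτ : ∀ t, HasDerivAt τ (g t) t := fun t =>
    intervalIntegral.integral_hasDerivAt_right (hgc.intervalIntegrable _ _)
      (hgc.stronglyMeasurableAtFilter _ _) hgc.continuousAt
  have hτ0 : τ 0 = 0 := by simp [hτ]
  -- Kepler's equation solved for the physical time, whose derivative is ρg. The term in η₂ cancels
  -- over a period.
  set θ : ℝ → ℝ := fun s => τ s / k ^ 2 + (γ s).2 2 / k ^ 2 with hθ
  have dθ : ∀ t, HasDerivAt θ (g t * radius (γ t)) t := fun t => by
    obtain ⟨-, -, -, -, -, d5⟩ := hasDerivAt_reeb_coords (h t)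
    refine (((dτ t).div_const _).add (d5.div_const _)).congr_deriv ?_
    have hl := (hm t).2.1
    have hAt := hA t
    simp only [hg]
    generalize (1 + radius (γ t) * angMom (γ t))⁻¹ = g'
    unfold levelFun radius at hl
    unfold radius
    rw [hA0, ← hAt] at hk
    rw [← add_div, div_eq_iff (by positivity)]
    linear_combination g' * (((γ t).1 2 - 1) * hl - ‖(γ t).2‖ * (1 - (γ t).1 2) * hk)
  have hθ0 : θ T - θ 0 = τ T / k ^ 2 := by
    simp only [hθ, hper, hτ0]; ring
  -- Integrates ds = (1 + ρA) dτ = dτ + A dθ.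
  have hTτ : T = τ T + A * (θ T - θ 0) := by
    have hd : ∀ t, HasDerivAt (fun s => s - τ s - A * θ s) 0 t := fun t => by
      refine (((hasDerivAt_id t).sub (dτ t)).sub ((dθ t).const_mul A)).congr_deriv ?_
      have h1 := (hgpos t).ne'
      simp only [hg]
      rw [← hA t] at hA0
      rw [hA0]
      field_simp
      ring
    have := is_const_of_deriv_eq_zero (fun t => (hd t).differentiableAt) (fun t => (hd t).deriv) T 0
    simp only [hτ0] at this
    linarith
  have key (ε : ℝ) (hε : ε ^ 2 = 1) (hne : 1 + ε * (k * A) ≠ 0) :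
      ∃ n : ℤ, θ T - θ 0 + ε * (k * τ T) = 2 * Real.pi * n := by
    have d : ∀ t, HasDerivAt (fun s => θ s + ε * (k * τ s)) (g t * (radius (γ t) + ε * k)) t :=
      fun t => ((dθ t).add (((dτ t).const_mul k).const_mul ε)).congr_deriv (by ring)
    obtain ⟨n, hn⟩ := exists_phase_eq d (hasDerivAt_horPhase hm h hk hε) (T := T)
      (by simp only [hper]) (fun h0 => by
        have := normSq_horPos_add (hm 0) hk hε
        rw [h0, map_zero] at this
        exact hne (pow_eq_zero_iff two_ne_zero |>.1 this.symm))
    exact ⟨n, by rw [← hn, hτ0]; ring⟩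
  have hkA : (k * A) ^ 2 ≤ 1 := by
    have := normSq_vertPhase (hm 0) hk
    linarith [Complex.normSq_nonneg (vertPhase k (γ 0))]
  have hpi := Real.pi_pos
  -- When kA = ε the eccentricity is zero and `vertPhase` carries no phase, but kT = kτ + εθ is ε
  -- times the change of the phase θ + εkτ, hence a positive multiple of 2π.
  have circ (ε : ℝ) (hε : ε ^ 2 = 1) (hεA : ε * (k * A) = 1) : 2 * Real.pi / k ≤ T := by
    obtain ⟨n, hn⟩ := key ε hε (by rw [hεA]; norm_num)
    have e : T * k = 2 * Real.pi * (ε * n) := by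
      rw [hTτ]
      linear_combination ε * hn - (k * τ T) * hε + (ε * (θ T - θ 0)) * hεA -
        (k * A * (θ T - θ 0)) * hε
    have hTk : 0 < T * k := by positivity
    rw [e] at hTk
    have h1 : 0 < ε * n := (pos_iff_pos_of_mul_pos hTk).1 (by positivity)
    have h2 : 1 ≤ ε * n := by
      rcases sq_eq_one_iff.1 hε with rfl | rfl
      · rw [one_mul] at h1 ⊢; exact_mod_cast h1
      · have : (0 : ℝ) < ((-n : ℤ) : ℝ) := by push_cast; linarith
        have : (1 : ℝ) ≤ ((-n : ℤ) : ℝ) := by exact_mod_cast this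
        push_cast at this; linarith
    rw [div_le_iff₀ hk0, e]
    nlinarith
  by_cases h1 : k * A = 1
  · exact circ 1 (by norm_num) (by rw [h1]; norm_num)
  by_cases h2 : k * A = -1
  · exact circ (-1) (by norm_num) (by rw [h2]; norm_num)
  obtain ⟨j, hj⟩ := key 1 (by norm_num) fun h0 => h2 (by linarith)
  have hne : vertPhase k (γ 0) ≠ 0 := fun h0 => by
    have := normSq_vertPhase (hm 0) hk
    rw [h0, map_zero] at this
    rcases sq_eq_one_iff.1 (show (k * A) ^ 2 = 1 by linarith) with h3 | h3
    exacts [h1 h3, h2 h3]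
  obtain ⟨m, hm'⟩ := exists_phase_eq (fun t => (dτ t).const_mul k) (hasDerivAt_vertPhase hm h hk)
    (T := T) (by simp only [hper]) hne
  rw [hτ0, mul_zero, sub_zero] at hm'
  refine le_period_of_windings hk1 (neg_le_of_abs_le (abs_le_of_sq_le_sq (by simpa using hkA)
    zero_le_one)) hθ0 hTτ hT hm' (n := j - m) ?_
  push_cast
  linarith

end Flow

end RotatingKepler

namespace RotatingKepler

/-! ### The energy level in the coordinates of the rotating Kepler problem -/

theorem plane_norm_sq (x : Plane) : ‖x‖ ^ 2 = x 0 ^ 2 + x 1 ^ 2 := by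
  rw [EuclideanSpace.real_norm_sq_eq, Fin.sum_univ_two]

theorem plane_inner (x y : Plane) : inner ℝ x y = x 0 * y 0 + x 1 * y 1 := by
  simp [PiLp.inner_apply, Fin.sum_univ_two, mul_comm]

theorem norm_stereoLift (x y : Plane) : ‖(stereoLift x y).2‖ = (‖x‖ ^ 2 + 1) / 2 * ‖y‖ := by
  refine (pow_left_inj₀ (norm_nonneg _) (by positivity) two_ne_zero).1 ?_
  rw [norm_sq_coords, mul_pow, plane_norm_sq y]
  simp only [stereoLift, plane_inner, plane_norm_sq x]
  simp
  ring

theorem radius_stereoLift (x y : Plane) : radius (stereoLift x y) = ‖y‖ := by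
  rw [radius, norm_stereoLift]
  simp [stereoLift, stereo]
  have : ‖x‖ ^ 2 + 1 ≠ 0 := by positivity
  field_simp
  ring

theorem angMom_stereoLift (x y : Plane) :
    angMom (stereoLift x y) = x 1 * y 0 - x 0 * y 1 := by
  have : ‖x‖ ^ 2 + 1 ≠ 0 := by positivity
  simp [angMom, stereoLift, stereo]
  field_simp
  ring

theorem levelFun_stereoLift (c : ℝ) (x y : Plane) :
    levelFun c (stereoLift x y) = ‖y‖ * (‖x‖ ^ 2 / 2 + c + (x 1 * y 0 - x 0 * y 1)) := by
  rw [levelFun, norm_stereoLift, radius_stereoLift, angMom_stereoLift]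
  ring

theorem levelFun_moser (c : ℝ) {z : Plane × Plane} (hz : z.1 ≠ 0) :
    levelFun c (moser z) = 1 + ‖z.1‖ * (hamiltonian z + c) := by
  have : ‖z.1‖ ≠ 0 := norm_ne_zero_iff.2 hz
  rw [moser, levelFun_stereoLift, hamiltonian, norm_neg]
  simp only [PiLp.neg_apply]
  field_simp
  ring

theorem levelFun_moser_eq_one_iff (c : ℝ) {z : Plane × Plane} (hz : z.1 ≠ 0) :
    levelFun c (moser z) = 1 ↔ hamiltonian z = -c := by
  have : ‖z.1‖ ≠ 0 := norm_ne_zero_iff.2 hz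
  rw [levelFun_moser c hz, add_eq_left, mul_eq_zero, or_iff_right this, add_eq_zero_iff_eq_neg]

theorem radius_moser (z : Plane × Plane) : radius (moser z) = ‖z.1‖ := radius_stereoLift _ _

theorem moser_mem (z : Plane × Plane) : moser z ∈ cotangentSphere := stereoLift_mem _ _

/-! ### The retrograde orbit -/

theorem hasFDerivAt_hamiltonian_apply {z : Plane × Plane} (hz : z.1 ≠ 0) (w : Plane × Plane) :
    fderiv ℝ hamiltonian z w = inner ℝ z.2 w.2 + inner ℝ z.1 w.1 / ‖z.1‖ ^ 3 +
      (w.2 0 * z.1 1 + z.2 0 * w.1 1 - (w.2 1 * z.1 0 + z.2 1 * w.1 0)) := by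
  have hn : ‖z.1‖ ≠ 0 := norm_ne_zero_iff.2 hz
  have p (i : Fin 2) (x : Plane) : DifferentiableAt ℝ (fun v : Plane => v i) x :=
    (EuclideanSpace.proj (𝕜 := ℝ) i).differentiableAt
  have hd : DifferentiableAt ℝ hamiltonian z := by
    have h1 : DifferentiableAt ℝ (fun z : Plane × Plane => ‖z.2‖ ^ 2 / 2) z := by
      simp only [div_eq_mul_inv]
      exact ((show DifferentiableAt ℝ (fun z : Plane × Plane => z.2) z from
        differentiableAt_snd).norm_sq ℝ).mul_const _
    have h2 : DifferentiableAt ℝ (fun z : Plane × Plane => 1 / ‖z.1‖) z := by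
      have : DifferentiableAt ℝ (fun z : Plane × Plane => ‖z.1‖) z :=
        (show DifferentiableAt ℝ (fun z : Plane × Plane => z.1) z from
          differentiableAt_fst).norm ℝ hz
      fun_prop (disch := assumption)
    have q1 (i : Fin 2) : DifferentiableAt ℝ (fun z : Plane × Plane => z.1 i) z :=
      (p i z.1).comp z differentiableAt_fst
    have q2 (i : Fin 2) : DifferentiableAt ℝ (fun z : Plane × Plane => z.2 i) z :=
      (p i z.2).comp z differentiableAt_snd
    exact (h1.sub h2).add (((q2 0).mul (q1 1)).sub ((q2 1).mul (q1 0)))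
  have hl : HasDerivAt (fun s : ℝ => z + s • w) w 0 := by
    simpa using ((hasDerivAt_id (0 : ℝ)).smul_const w).const_add z
  have hcomp : HasDerivAt (fun s : ℝ => hamiltonian (z + s • w)) (fderiv ℝ hamiltonian z w) 0 := by
    refine HasFDerivAt.comp_hasDerivAt (l := hamiltonian) 0 ?_ hl
    simpa using hd.hasFDerivAt
  have l1 : HasDerivAt (fun s : ℝ => (z + s • w).1) w.1 0 := hl.fst
  have l2 : HasDerivAt (fun s : ℝ => (z + s • w).2) w.2 0 := hl.snd
  have c1 (i : Fin 2) : HasDerivAt (fun s : ℝ => (z + s • w).1 i) (w.1 i) 0 :=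
    ((EuclideanSpace.proj (𝕜 := ℝ) i).hasFDerivAt).comp_hasDerivAt 0 l1
  have c2 (i : Fin 2) : HasDerivAt (fun s : ℝ => (z + s • w).2 i) (w.2 i) 0 :=
    ((EuclideanSpace.proj (𝕜 := ℝ) i).hasFDerivAt).comp_hasDerivAt 0 l2
  have n1 : HasDerivAt (fun s : ℝ => ‖(z + s • w).1‖) (inner ℝ z.1 w.1 / ‖z.1‖) 0 := by
    have h1 := l1.norm_sq.sqrt (by simpa using hz)
    simp only [Real.sqrt_sq (norm_nonneg _)] at h1
    refine h1.congr_deriv ?_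
    simp
    ring
  have n2 := ((l2.norm_sq.div_const 2).sub ((hasDerivAt_const 0 (1 : ℝ)).div n1 (by simpa))).add
    (((c2 0).mul (c1 1)).sub ((c2 1).mul (c1 0)))
  rw [hcomp.unique n2]
  simp
  field_simp
  ring

theorem hasDerivAt_const_mul_self (a t : ℝ) : HasDerivAt (fun s => a * s) a t := by
  simpa using (hasDerivAt_id t).const_mul a

/-- The image of the retrograde circular orbit with action `L` and phase `φ` in `T*S²`. -/
noncomputable def retrogradeLift (L φ : ℝ) : Space × Space :=
  (!₂[2 * L / (1 + L ^ 2) * Real.sin φ, 2 * L / (1 + L ^ 2) * Real.cos φ, (1 - L ^ 2) / (1 + L ^ 2)],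
    !₂[(1 + L ^ 2) / 2 * Real.cos φ, -((1 + L ^ 2) / 2 * Real.sin φ), 0])

section Retrograde

variable {c L : ℝ}

theorem moser_retrogradeOrbit (hL : 0 < L) (t : ℝ) :
    moser (retrogradeOrbit (L ^ 2) t) = retrogradeLift L ((1 / (L ^ 2 * L) + 1) * t) := by
  have hx : ‖-(retrogradeOrbit (L ^ 2) t).2‖ ^ 2 = 1 / L ^ 2 := by
    rw [norm_neg, plane_norm_sq]
    simp only [retrogradeOrbit, Real.sqrt_sq hL.le]
    generalize (1 / (L ^ 2 * L) + 1) * t = φ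
    simp
    field_simp
    rw [Real.sin_sq_add_cos_sq]
  have hxy : inner ℝ (-(retrogradeOrbit (L ^ 2) t).2) (retrogradeOrbit (L ^ 2) t).1 = 0 := by
    rw [plane_inner]
    simp only [retrogradeOrbit, Real.sqrt_sq hL.le]
    simp
    ring
  simp only [moser, stereoLift, stereo, hx, hxy]
  simp only [retrogradeOrbit, retrogradeLift, Real.sqrt_sq hL.le]
  generalize (1 / (L ^ 2 * L) + 1) * t = φ
  refine Prod.ext ?_ ?_
  · ext i
    fin_cases i <;> simp <;> field_simp
  · ext i
    fin_cases i <;> simp <;> field_simp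

theorem hamiltonian_retrogradeOrbit (hL : 0 < L) (hc : c = 1 / (2 * L ^ 2) - L) (t : ℝ) :
    hamiltonian (retrogradeOrbit (L ^ 2) t) = -c := by
  have h1 : ‖(retrogradeOrbit (L ^ 2) t).2‖ ^ 2 = 1 / L ^ 2 := by
    rw [plane_norm_sq]
    simp only [retrogradeOrbit, Real.sqrt_sq hL.le]
    generalize (1 / (L ^ 2 * L) + 1) * t = φ
    simp
    field_simp
    rw [Real.sin_sq_add_cos_sq]
  have h2 : ‖(retrogradeOrbit (L ^ 2) t).1‖ = L ^ 2 := by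
    refine (pow_left_inj₀ (norm_nonneg _) (by positivity) two_ne_zero).1 ?_
    rw [plane_norm_sq]
    simp only [retrogradeOrbit]
    generalize (1 / (L ^ 2 * √(L ^ 2)) + 1) * t = φ
    simp
    linear_combination L ^ 4 * Real.sin_sq_add_cos_sq φ
  rw [hamiltonian, h1, h2, hc]
  simp only [retrogradeOrbit, Real.sqrt_sq hL.le]
  generalize (1 / (L ^ 2 * L) + 1) * t = φ
  simp
  field_simp
  linear_combination 2 * L ^ 3 * Real.sin_sq_add_cos_sq φ

theorem norm_retrogradeOrbit_fst (hL : 0 < L) (t : ℝ) :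
    ‖(retrogradeOrbit (L ^ 2) t).1‖ = L ^ 2 := by
  refine (pow_left_inj₀ (norm_nonneg _) (by positivity) two_ne_zero).1 ?_
  rw [plane_norm_sq]
  simp only [retrogradeOrbit]
  generalize (1 / (L ^ 2 * √(L ^ 2)) + 1) * t = φ
  simp
  linear_combination L ^ 4 * Real.sin_sq_add_cos_sq φ

theorem isHamiltonianOrbit_retrogradeOrbit (hL : 0 < L) :
    IsHamiltonianOrbit (retrogradeOrbit (L ^ 2)) := by
  intro t
  have h2 := norm_retrogradeOrbit_fst hL t
  have hq : (retrogradeOrbit (L ^ 2) t).1 ≠ 0 := norm_ne_zero_iff.1 (by rw [h2]; positivity)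
  have hφ := hasDerivAt_const_mul_self (1 / (L ^ 2 * L) + 1) t
  have hs := hφ.sin
  have hcs := hφ.cos
  refine ⟨hq, (!₂[L ^ 2 * (-Real.sin ((1 / (L ^ 2 * L) + 1) * t) * (1 / (L ^ 2 * L) + 1)),
    -(L ^ 2 * (Real.cos ((1 / (L ^ 2 * L) + 1) * t) * (1 / (L ^ 2 * L) + 1)))],
    !₂[-(1 / L * (Real.cos ((1 / (L ^ 2 * L) + 1) * t) * (1 / (L ^ 2 * L) + 1))),
    -(1 / L * (-Real.sin ((1 / (L ^ 2 * L) + 1) * t) * (1 / (L ^ 2 * L) + 1)))]),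
    HasDerivAt.prodMk ?_ ?_, fun w => ?_⟩
  · refine (EuclideanSpace.equiv (Fin 2) ℝ).symm.hasFDerivAt.comp_hasDerivAt t (hasDerivAt_pi.2 ?_)
    intro i
    rw [Real.sqrt_sq hL.le]
    fin_cases i
    · exact hcs.const_mul (L ^ 2)
    · exact (hs.const_mul (L ^ 2)).neg
  · refine (EuclideanSpace.equiv (Fin 2) ℝ).symm.hasFDerivAt.comp_hasDerivAt t (hasDerivAt_pi.2 ?_)
    intro i
    rw [Real.sqrt_sq hL.le]
    fin_cases i
    · exact (hs.const_mul (1 / L)).neg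
    · exact (hcs.const_mul (1 / L)).neg
  · rw [hasFDerivAt_hamiltonian_apply hq, h2]
    simp only [symp, plane_inner, retrogradeOrbit, Real.sqrt_sq hL.le]
    generalize (1 / (L ^ 2 * L) + 1) * t = φ
    simp
    field_simp
    ring

theorem hasDerivAt_retrogradeLift (L φ : ℝ) : HasDerivAt (retrogradeLift L)
    (!₂[2 * L / (1 + L ^ 2) * Real.cos φ, 2 * L / (1 + L ^ 2) * -Real.sin φ, 0],
      !₂[(1 + L ^ 2) / 2 * -Real.sin φ, -((1 + L ^ 2) / 2 * Real.cos φ), 0]) φ := by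
  refine HasDerivAt.prodMk (hasDerivAt_of_coord fun i => ?_) (hasDerivAt_of_coord fun i => ?_)
  · fin_cases i
    · exact (Real.hasDerivAt_sin φ).const_mul _
    · exact (Real.hasDerivAt_cos φ).const_mul _
    · exact hasDerivAt_const _ _
  · fin_cases i
    · exact (Real.hasDerivAt_cos φ).const_mul _
    · exact ((Real.hasDerivAt_sin φ).const_mul _).neg
    · exact hasDerivAt_const _ _

theorem norm_retrogradeLift (L φ : ℝ) : ‖(retrogradeLift L φ).2‖ = (1 + L ^ 2) / 2 := by
  refine (pow_left_inj₀ (norm_nonneg _) (by positivity) two_ne_zero).1 ?_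
  rw [norm_sq_coords]
  simp [retrogradeLift]
  linear_combination ((1 + L ^ 2) / 2) ^ 2 * Real.sin_sq_add_cos_sq φ

theorem radius_retrogradeLift (L φ : ℝ) : radius (retrogradeLift L φ) = L ^ 2 := by
  rw [radius, norm_retrogradeLift]
  simp [retrogradeLift]
  field_simp
  ring

theorem angMom_retrogradeLift (L φ : ℝ) : angMom (retrogradeLift L φ) = L := by
  simp [angMom, retrogradeLift]
  field_simp
  linear_combination L * Real.sin_sq_add_cos_sq φ

theorem reebField_retrogradeLift (hL : 0 < L) (hc : c = 1 / (2 * L ^ 2) - L) (φ : ℝ) :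
    reebField c (retrogradeLift L φ) = (1 / L) •
    (!₂[2 * L / (1 + L ^ 2) * Real.cos φ, 2 * L / (1 + L ^ 2) * -Real.sin φ, 0],
      !₂[(1 + L ^ 2) / 2 * -Real.sin φ, -((1 + L ^ 2) / 2 * Real.cos φ), 0]) := by
  have h3 : 1 + L ^ 2 * L ≠ 0 := by positivity
  rw [reebField, radius_retrogradeLift, norm_retrogradeLift, angMom_retrogradeLift, hc]
  refine Prod.ext ?_ ?_
  · ext i
    fin_cases i <;> simp [retrogradeLift, rotGen, -mul_eq_mul_left_iff, -mul_eq_zero] <;> field_simp <;> ring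
  · ext i
    fin_cases i <;> simp [retrogradeLift, rotGen, -mul_eq_mul_left_iff, -mul_eq_zero] <;> (field_simp; ring)

theorem lt_one_of_eq (hc : 3 / 2 < c) (hL : 0 < L) (h : c = 1 / (2 * L ^ 2) - L) : L < 1 := by
  by_contra! h1
  have : 1 / (2 * L ^ 2) ≤ 1 := by
    rw [div_le_one (by positivity)]
    nlinarith
  linarith

theorem retrogradeLift_mem (hc : 3 / 2 < c) (hL : 0 < L) (h : c = 1 / (2 * L ^ 2) - L) (φ : ℝ) :
    retrogradeLift L φ ∈ boundedLevel c := by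
  have hL1 := lt_one_of_eq hc hL h
  refine ⟨(mem_cotangentSphere_iff _).2 ⟨?_, ?_⟩, ?_, ?_⟩
  · simp [retrogradeLift]
    field_simp
    linear_combination 4 * L ^ 2 * Real.sin_sq_add_cos_sq φ
  · simp [retrogradeLift]
    ring
  · rw [levelFun, radius_retrogradeLift, norm_retrogradeLift, angMom_retrogradeLift, h]
    field_simp
    ring
  · rw [radius_retrogradeLift]
    nlinarith

/-- The retrograde orbit, with time rescaled by a constant, is a Reeb orbit of period `2πL`. -/
theorem exists_isReebOrbit_retrograde (hc : 3 / 2 < c) (hL : 0 < L)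
    (h : c = 1 / (2 * L ^ 2) - L) : ∃ k : ℝ, 0 < k ∧
      IsReebOrbit (boundedLevel c) (fun s => moser (retrogradeOrbit (L ^ 2) (k * s))) ∧
      Function.Periodic (fun s => moser (retrogradeOrbit (L ^ 2) (k * s))) (2 * Real.pi * L) := by
  set w := 1 / (L ^ 2 * L) + 1 with hw
  have hw0 : 0 < w := by positivity
  -- The phase of the circle moves with speed w in the Hamiltonian flow and with speed 1/L in the
  -- Reeb flow.
  refine ⟨1 / (w * L), by positivity, ?_⟩
  have e : (fun s => moser (retrogradeOrbit (L ^ 2) (1 / (w * L) * s))) =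
      fun s => retrogradeLift L (1 / L * s) := by
    funext s
    rw [moser_retrogradeOrbit hL, ← hw]
    congr 1
    field_simp
  rw [e]
  constructor
  · refine isReebOrbit_of_hasDerivAt hc (fun s => retrogradeLift_mem hc hL h _) fun t => ?_
    rw [reebField_retrogradeLift hL h]
    exact (hasDerivAt_retrogradeLift L (1 / L * t)).scomp t (hasDerivAt_const_mul_self (1 / L) t)
  · intro s
    have : 1 / L * (s + 2 * Real.pi * L) = 1 / L * s + 2 * Real.pi := by field_simp
    simp only [this, retrogradeLift, Real.sin_add_two_pi, Real.cos_add_two_pi]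

end Retrograde

/-! ### The action equation and the smallest period. -/

/-- The equation for the action of the retrograde orbit has exactly one positive solution. -/
theorem exists_action_eq {c : ℝ} (hc : 3 / 2 < c) :
    ∃ L : ℝ, ∀ x : ℝ, (0 < x ∧ c = 1 / (2 * x ^ 2) - x) ↔ x = L := by
  have anti : ∀ x y : ℝ, 0 < x → x < y → 1 / (2 * y ^ 2) - y < 1 / (2 * x ^ 2) - x := by
    intro x y hx hxy
    have : 1 / (2 * y ^ 2) ≤ 1 / (2 * x ^ 2) :=
      one_div_le_one_div_of_le (by positivity) (by gcongr)
    linarith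
  have hcont : ContinuousOn (fun x : ℝ => 1 / (2 * x ^ 2) - x) (Icc (1 / (c + 1)) 1) := by
    refine ContinuousOn.sub (continuousOn_const.div (by fun_prop) fun x hx => ?_) continuousOn_id
    have : 0 < x := lt_of_lt_of_le (by positivity) hx.1
    positivity
  have hle : 1 / (c + 1) ≤ 1 := by rw [div_le_one (by linarith)]; linarith
  -- The function is -1/2 at x = 1 and (c + 1)²/2 - 1/(c + 1) ≥ c at x = 1/(c + 1).
  obtain ⟨L, ⟨hL1, -⟩, hL⟩ := intermediate_value_Icc' hle hcont (show c ∈ Icc _ _ by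
    constructor
    · norm_num; linarith
    · have h1 : 1 / (2 * (1 / (c + 1)) ^ 2) = (c + 1) ^ 2 / 2 := by field_simp
      rw [h1]
      nlinarith)
  have hL0 : 0 < L := lt_of_lt_of_le (by positivity) hL1
  refine ⟨L, fun x => ⟨fun ⟨hx, h⟩ => ?_, fun h => h ▸ ⟨hL0, hL.symm⟩⟩⟩
  rcases lt_trichotomy x L with h1 | h1 | h1
  · have := anti x L hx h1
    simp only at hL
    linarith
  · exact h1
  · have := anti L x hL0 h1
    simp only at hL
    linarith

/-- The smallest period of a periodic Reeb orbit. -/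
theorem isLeast_reebPeriods {c L : ℝ} (hc : 3 / 2 < c) (hL : 0 < L)
    (h : c = 1 / (2 * L ^ 2) - L) :
    IsLeast (reebPeriods (boundedLevel c)) (2 * Real.pi * L) := by
  have hpi := Real.pi_pos
  constructor
  · obtain ⟨k, -, h1, h2⟩ := exists_isReebOrbit_retrograde hc hL h
    exact ⟨by positivity, _, h1, h2⟩
  · rintro T ⟨hT, γ, hγ, hper⟩
    have hm : ∀ t, γ t ∈ boundedLevel c := fun t => (hγ t).1
    have hA1 := neg_one_lt_angMom hc (hm 0)
    have hpos : 0 < 2 * (c + angMom (γ 0)) := by linarith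
    have hk0 := Real.sqrt_pos.2 hpos
    have hk := Real.sq_sqrt hpos.le
    set k := √(2 * (c + angMom (γ 0)))
    have hT' := le_period hc hm (fun t => hγ.hasDerivAt hc t) hT (by simpa using hper 0) hk0 hk
    refine le_trans ?_ hT'
    have hkA : (k * angMom (γ 0)) ^ 2 ≤ 1 := by
      have := normSq_vertPhase (hm 0) hk
      linarith [Complex.normSq_nonneg (vertPhase k (γ 0))]
    have hA : angMom (γ 0) ≤ 1 / k := by
      rw [le_div_iff₀ hk0, mul_comm]
      exact le_of_abs_le (abs_le_of_sq_le_sq (by simpa using hkA) zero_le_one)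
    -- A ≤ 1/k gives c = k²/2 - A ≥ k²/2 - 1/k, the value of 1/(2x²) - x at x = 1/k; this function
    -- decreases and equals c at L.
    have hLk : L ≤ 1 / k := by
      by_contra! hlt
      have h1 : 1 / k < L := hlt
      have h2 : 1 / (2 * L ^ 2) ≤ k ^ 2 / 2 := by
        have : k ^ 2 / 2 = 1 / (2 * (1 / k) ^ 2) := by field_simp
        rw [this]
        exact one_div_le_one_div_of_le (by positivity) (by gcongr)
      linarith
    rw [div_eq_mul_one_div]
    gcongr

end RotatingKepler

namespace RotatingKepler

/-! ### The bounded component of the energy level -/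

variable {c : ℝ}

/-- Away from the fibre over the north pole, `stereoLift` is onto. -/
theorem exists_stereoLift_eq {z : Space × Space} (hT : z ∈ cotangentSphere) (hz : 0 < radius z) :
    ∃ x y, stereoLift x y = z := by
  obtain ⟨h1, h2⟩ := (mem_cotangentSphere_iff z).1 hT
  have hm : 1 - z.1 2 ≠ 0 := fun h => by simp [radius, h] at hz
  refine ⟨!₂[z.1 0 / (1 - z.1 2), z.1 1 / (1 - z.1 2)],
    !₂[(1 - z.1 2) * z.2 0 + z.2 2 * z.1 0, (1 - z.1 2) * z.2 1 + z.2 2 * z.1 1], ?_⟩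
  have e : ‖(!₂[z.1 0 / (1 - z.1 2), z.1 1 / (1 - z.1 2)] : Plane)‖ ^ 2 =
      (1 + z.1 2) / (1 - z.1 2) := by
    rw [plane_norm_sq]
    simp
    field_simp
    linarith
  have e2 : inner ℝ (!₂[z.1 0 / (1 - z.1 2), z.1 1 / (1 - z.1 2)] : Plane)
    !₂[(1 - z.1 2) * z.2 0 + z.2 2 * z.1 0, (1 - z.1 2) * z.2 1 + z.2 2 * z.1 1] = z.2 2 := by
    rw [plane_inner]
    simp
    field_simp
    linear_combination z.2 2 * h1 + (1 - z.1 2) * h2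
  have e3 : (1 + z.1 2) / (1 - z.1 2) + 1 = 2 / (1 - z.1 2) := by field_simp; ring
  have e4 : (1 + z.1 2) / (1 - z.1 2) - 1 = 2 * z.1 2 / (1 - z.1 2) := by field_simp; ring
  simp only [stereoLift, stereo, e, e2, e3, e4]
  refine Prod.ext ?_ ?_
  · ext i
    fin_cases i <;> simp <;> field_simp
  · ext i
    fin_cases i <;> simp <;> field_simp <;> ring

theorem mem_image_moser {z : Space × Space} (hT : z ∈ cotangentSphere) (hl : levelFun c z = 1)
    (hz : 0 < radius z) : z ∈ moser '' {z | z.1 ≠ 0 ∧ hamiltonian z = -c} := by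
  obtain ⟨x, y, rfl⟩ := exists_stereoLift_eq hT hz
  have e : moser (y, -x) = stereoLift x y := by simp [moser]
  have hy : y ≠ 0 := by
    rw [radius_stereoLift] at hz
    exact norm_pos_iff.1 hz
  exact ⟨(y, -x), ⟨hy, (levelFun_moser_eq_one_iff c hy).1 (by rwa [e])⟩, e⟩

theorem energyClosure_subset :
    energyClosure c ⊆ {z | z ∈ cotangentSphere ∧ levelFun c z = 1} := by
  refine closure_minimal ?_ (isClosed_cotangentSphere.inter
    (isClosed_eq (continuous_levelFun c) continuous_const))
  rintro _ ⟨z, ⟨h1, h2⟩, rfl⟩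
  exact ⟨moser_mem z, (levelFun_moser_eq_one_iff c h1).2 h2⟩

/-- The image of `moser` misses only the fibre over the north pole, ρ = 0. Such points are limits
along `baseCurve`, projected to the level: the base point leaves the pole at height cos s < 1. -/
theorem boundedLevel_subset_energyClosure (hc : 3 / 2 < c) :
    boundedLevel c ⊆ energyClosure c := by
  intro z hz
  have he := norm_pos_of_level hz.2.1
  have he0 : z.2 ≠ 0 := norm_pos_iff.1 he
  rcases (radius_nonneg hz.1).eq_or_lt with h | h
  · obtain ⟨κ, hκ⟩ := exists_hasDerivAt_baseCurve hc hz
    set δ : ℝ → Space × Space := fun s => ((baseCurve z s).1, scale c (baseCurve z s) • z.2)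
    have hδ0 : δ 0 = z := by simp only [δ, baseCurve_zero, scale_eq_one hc hz, one_smul]
    have hcont : Filter.Tendsto δ (nhdsWithin 0 (Ioo 0 (Real.pi / 2))) (nhds z) := by
      rw [← hδ0]
      exact hκ.continuousAt.tendsto.mono_left nhdsWithin_le_nhds
    have hz2 : z.1 2 = 1 := by
      unfold radius at h
      have := (mul_eq_zero.1 h.symm).resolve_left he.ne'
      linarith
    have h01 : z.1 0 = 0 ∧ z.1 1 = 0 := by
      have h1 := ((mem_cotangentSphere_iff z).1 hz.1).1
      rw [hz2] at h1
      constructor <;> nlinarith [sq_nonneg (z.1 0), sq_nonneg (z.1 1)]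
    have hne : (nhdsWithin (0 : ℝ) (Ioo 0 (Real.pi / 2))).NeBot :=
      left_nhdsWithin_Ioo_neBot (by positivity)
    refine mem_closure_of_tendsto hcont (eventually_nhdsWithin_of_forall fun s hs => ?_)
    have hT := baseCurve_mem hz.1 he0 s
    have hm : δ s ∈ boundedLevel c := scale_mem hc hT he0
    refine mem_image_moser hm.1 hm.2.1 ?_
    refine mul_pos (norm_pos_of_level hm.2.1) ?_
    have h2 : (δ s).1 2 = Real.cos s := by
      simp [δ, baseCurve, cross, h01.1, h01.2, hz2]
    rw [h2, sub_pos]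
    have := Real.cos_lt_cos_of_nonneg_of_le_pi_div_two le_rfl hs.2.le hs.1
    rwa [Real.cos_zero] at this
  · exact subset_closure (mem_image_moser hz.1 hz.2.1 h)

theorem norm_prod_le_of_mem (hc : 3 / 2 < c) {z : Space × Space} (hz : z ∈ boundedLevel c) :
    ‖z‖ ≤ 1 := by
  rw [Prod.norm_def, max_le_iff]
  exact ⟨hz.1.1.le, norm_le_one hc hz⟩

/-- The velocity, in the rotating frame, of a point on the energy level at distance `ρ`. -/
noncomputable def hillSpeed (c ρ : ℝ) : ℝ := √(2 / ρ + ρ ^ 2 - 2 * c)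

/-- The hamiltonian in terms of the position and the velocity in the rotating frame. -/
theorem hamiltonian_eq (q u : Plane) : hamiltonian (q, !₂[u 0 - q 1, u 1 + q 0]) =
    ‖u‖ ^ 2 / 2 - 1 / ‖q‖ - ‖q‖ ^ 2 / 2 := by
  rw [hamiltonian]
  simp only [plane_norm_sq]
  simp
  ring

/-- Push q outward along its ray, keep the direction of the velocity u in the rotating frame and let
the energy fix |u|. Since |u|² = 2/ρ + ρ² - 2c does not decrease for ρ ≥ 1, the path exists for all
s ≥ 1, and |η| ≥ |q|/2 makes it unbounded. -/
theorem not_isBounded_component {z : Space × Space}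
    (hz : z ∈ energyClosure c) (hr : 1 < radius z) :
    ¬ Bornology.IsBounded (connectedComponentIn (energyClosure c) z) := by
  obtain ⟨hT, hl⟩ := energyClosure_subset hz
  obtain ⟨⟨q, p⟩, ⟨hq, hH⟩, rfl⟩ := mem_image_moser hT hl (by linarith)
  simp only at hq
  rw [radius_moser] at hr
  simp only at hr
  have hq0 : 0 < ‖q‖ := by linarith
  set u : Plane := !₂[p 0 + q 1, p 1 - q 0] with hu
  have hp : p = !₂[u 0 - q 1, u 1 + q 0] := by
    ext i; fin_cases i <;> simp [hu]
  have hu2 : ‖u‖ ^ 2 = 2 / ‖q‖ + ‖q‖ ^ 2 - 2 * c := by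
    rw [hp, hamiltonian_eq] at hH
    linear_combination 2 * hH
  obtain ⟨d, hd1, hd⟩ : ∃ d : Plane, ‖d‖ = 1 ∧ u = ‖u‖ • d := by
    by_cases h0 : u = 0
    · exact ⟨EuclideanSpace.single 0 1, by simp, by simp [h0]⟩
    · have h1 : ‖u‖ ≠ 0 := norm_ne_zero_iff.2 h0
      exact ⟨‖u‖⁻¹ • u, by rw [norm_smul, norm_inv, norm_norm, inv_mul_cancel₀ h1],
        by rw [smul_smul, mul_inv_cancel₀ h1, one_smul]⟩
  set v : ℝ → ℝ := fun s => hillSpeed c (s * ‖q‖) with hv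
  set path : ℝ → Plane × Plane := fun s =>
    (s • q, !₂[v s * d 0 - s * q 1, v s * d 1 + s * q 0]) with hpath
  have hpos : ∀ s ∈ Ici (1 : ℝ), 0 ≤ 2 / (s * ‖q‖) + (s * ‖q‖) ^ 2 - 2 * c := by
    intro s hs
    have hs1 : (1 : ℝ) ≤ s := hs
    have h0 : 0 ≤ 2 / ‖q‖ + ‖q‖ ^ 2 - 2 * c := hu2 ▸ sq_nonneg _
    have h1 : 2 / (s * ‖q‖) + (s * ‖q‖) ^ 2 - (2 / ‖q‖ + ‖q‖ ^ 2) =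
        (s - 1) * (s * (s + 1) * ‖q‖ ^ 3 - 2) / (s * ‖q‖) := by
      field_simp
      ring
    have h2 : 0 ≤ (s - 1) * (s * (s + 1) * ‖q‖ ^ 3 - 2) / (s * ‖q‖) := by
      have h3 : 1 < ‖q‖ ^ 3 := one_lt_pow₀ hr (by norm_num)
      have h4 : 2 ≤ s * (s + 1) := by nlinarith
      have : 0 ≤ s * (s + 1) * ‖q‖ ^ 3 - 2 := by nlinarith
      have : 0 ≤ s - 1 := by linarith
      positivity
    linarith
  have hmem : ∀ s ∈ Ici (1 : ℝ), moser (path s) ∈ energyClosure c := by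
    intro s hs
    have hs1 : (1 : ℝ) ≤ s := hs
    have hs0 : s ≠ 0 := by linarith
    refine subset_closure ⟨path s, ⟨smul_ne_zero hs0 hq, ?_⟩, rfl⟩
    have e1 : path s = (s • q, !₂[(v s • d) 0 - (s • q) 1, (v s • d) 1 + (s • q) 0]) := by
      simp [hpath]
    have e2 : ‖s • q‖ = s * ‖q‖ := by rw [norm_smul, Real.norm_of_nonneg (by linarith)]
    rw [e1, hamiltonian_eq, e2, norm_smul, hd1, mul_one, Real.norm_eq_abs, sq_abs]
    simp only [hv, hillSpeed]
    rw [Real.sq_sqrt (hpos s hs)]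
    ring
  have hcont : ContinuousOn (fun s => moser (path s)) (Ici 1) := by
    have hvc : ContinuousOn v (Ici 1) := by
      refine ContinuousOn.sqrt (ContinuousOn.sub (ContinuousOn.add (continuousOn_const.div
        (by fun_prop) fun s hs => ?_) (by fun_prop)) continuousOn_const)
      have : (1 : ℝ) ≤ s := hs
      positivity
    have hpc : ContinuousOn path (Ici 1) := by
      refine ContinuousOn.prodMk (by fun_prop) ?_
      refine (EuclideanSpace.equiv (Fin 2) ℝ).symm.continuous.comp_continuousOn
        (continuousOn_pi.2 fun i => ?_)
      fin_cases i
      · exact (hvc.mul continuousOn_const).sub (by fun_prop)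
      · exact (hvc.mul continuousOn_const).add (by fun_prop)
    have hmc : Continuous moser := by
      have hn : ∀ x : Plane, ‖x‖ ^ 2 + 1 ≠ 0 := fun x => by positivity
      have hp2 (i : Fin 2) : Continuous fun v : Plane => v i :=
        (EuclideanSpace.proj (𝕜 := ℝ) i).continuous
      refine Continuous.prodMk ?_ ?_
      · refine (EuclideanSpace.equiv (Fin 3) ℝ).symm.continuous.comp (continuous_pi fun i => ?_)
        fin_cases i
        · exact (((hp2 0).comp continuous_snd.neg).const_mul 2).div (by fun_prop) fun z => hn _
        · exact (((hp2 1).comp continuous_snd.neg).const_mul 2).div (by fun_prop) fun z => hn _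
        · exact Continuous.div (by fun_prop) (by fun_prop) fun z => hn _
      · have q1 (i : Fin 2) : Continuous fun z : Plane × Plane => z.1 i := (hp2 i).comp continuous_fst
        have q2 (i : Fin 2) : Continuous fun z : Plane × Plane => (-z.2) i :=
          (hp2 i).comp continuous_snd.neg
        refine (EuclideanSpace.equiv (Fin 3) ℝ).symm.continuous.comp (continuous_pi fun i => ?_)
        fin_cases i
        · exact (Continuous.mul (by fun_prop) (q1 0)).sub (Continuous.mul (by fun_prop) (q2 0))
        · exact (Continuous.mul (by fun_prop) (q1 1)).sub (Continuous.mul (by fun_prop) (q2 1))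
        · change Continuous fun z : Plane × Plane => inner ℝ (-z.2) z.1
          fun_prop
    exact hmc.comp_continuousOn hpc
  have hv1 : v 1 = ‖u‖ := by
    simp only [hv, hillSpeed, one_mul]
    rw [← hu2, Real.sqrt_sq (norm_nonneg _)]
  have hpath1 : path 1 = (q, p) := by
    have d0 : u 0 = ‖u‖ * d 0 := congrArg (fun v : Plane => v 0) hd
    have d1 : u 1 = ‖u‖ * d 1 := congrArg (fun v : Plane => v 1) hd
    simp only [hpath, one_smul, one_mul, hv1]
    rw [← d0, ← d1, ← hp]
  have hsub : (fun s => moser (path s)) '' Ici 1 ⊆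
      connectedComponentIn (energyClosure c) (moser (q, p)) := by
    refine IsPreconnected.subset_connectedComponentIn
      (isPreconnected_Ici.image _ hcont) ⟨1, self_mem_Ici, by simp only [hpath1]⟩ ?_
    rintro _ ⟨s, hs, rfl⟩
    exact hmem s hs
  intro hb
  obtain ⟨C, hC⟩ := (hb.subset hsub).exists_norm_le
  have h1 := hC _ ⟨max 1 (2 * (C + 1)), mem_Ici.2 (le_max_left _ _), rfl⟩
  set s := max 1 (2 * (C + 1)) with hs
  have hs1 : 1 ≤ s := le_max_left _ _
  have hs2 : 2 * (C + 1) ≤ s := le_max_right _ _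
  have h2 : s * ‖q‖ / 2 ≤ ‖(moser (path s)).2‖ := by
    rw [moser, norm_stereoLift]
    have : ‖(path s).1‖ = s * ‖q‖ := by
      simp only [hpath]
      rw [norm_smul, Real.norm_of_nonneg (by linarith)]
    rw [this]
    have h3 : 0 ≤ s * ‖q‖ := by positivity
    nlinarith [sq_nonneg ‖-(path s).2‖, mul_nonneg (sq_nonneg ‖-(path s).2‖) h3]
  have h3 := (norm_snd_le (moser (path s))).trans h1
  nlinarith

/-- ρ is continuous and omits the value 1 on the level, so a component that meets ρ < 1 stays there,
within the unit ball. Components in ρ > 1 are unbounded. -/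
theorem hypersurface_eq (hc : 3 / 2 < c) : hypersurface c = boundedLevel c := by
  ext z
  constructor
  · rintro ⟨hz, hb⟩
    obtain ⟨hT, hl⟩ := energyClosure_subset hz
    refine ⟨hT, hl, ?_⟩
    by_contra! h
    exact not_isBounded_component hz (h.lt_of_ne (radius_ne_one hc hT hl).symm) hb
  · intro hz
    have hz' := boundedLevel_subset_energyClosure hc hz
    refine ⟨hz', ?_⟩
    have hconn := isPreconnected_connectedComponentIn (F := energyClosure c) (x := z)
    refine (Metric.isBounded_closedBall (x := (0 : Space × Space)) (r := 1)).subset fun w hw => ?_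
    obtain ⟨hT, hl⟩ := energyClosure_subset (connectedComponentIn_subset _ _ hw)
    rw [mem_closedBall_zero_iff]
    refine norm_prod_le_of_mem hc ⟨hT, hl, ?_⟩
    by_contra! h
    obtain ⟨y, hy, hy1⟩ := hconn.intermediate_value (mem_connectedComponentIn hz') hw
      continuous_radius.continuousOn ⟨hz.2.2.le, h⟩
    obtain ⟨hT', hl'⟩ := energyClosure_subset (connectedComponentIn_subset _ _ hy)
    exact radius_ne_one hc hT' hl' hy1

end RotatingKepler

namespace RotatingKepler

/-! ### Thickening the energy level to an open subset of `ℝ³ × ℝ³` -/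

/-- The coordinate space `ℝ³`. -/
abbrev Coord := Fin 3 → ℝ

/-- The six-dimensional family of points around `(ξ, η)`. -/
def thickPoint (z : Space × Space) (b : Coord) : Coord × Coord :=
  (fun i => b 0 * z.1 i, fun i => b 1 * z.2 i + b 2 * z.1 i)

/-- The thickening of a parametrization of the energy level. -/
def thicken (f : Coord → Space × Space) (x : Coord × Coord) : Coord × Coord :=
  thickPoint (f x.1) x.2

/-- The open unit cube. -/
def cube : Set Coord := Set.pi univ fun _ => Ioo 0 1

theorem exists_hasFDerivAt_thicken {f : Coord → Space × Space} {f' : Coord →L[ℝ] Space × Space}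
    {x : Coord × Coord} (hf : HasFDerivAt f f' x.1) :
    ∃ D : Coord × Coord →L[ℝ] Coord × Coord, HasFDerivAt (thicken f) D x ∧
      ∀ a b, D (a, b) = (fun i => x.2 0 * (f' a).1 i + b 0 * (f x.1).1 i,
        fun i => x.2 1 * (f' a).2 i + b 1 * (f x.1).2 i +
          (x.2 2 * (f' a).1 i + b 2 * (f x.1).1 i)) := by
  have h := hf.comp x (hasFDerivAt_fst (𝕜 := ℝ) (p := x))
  have h1 (i : Fin 3) := ((EuclideanSpace.proj (𝕜 := ℝ) i).hasFDerivAt (x := (f x.1).1)).comp x h.fst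
  have h2 (i : Fin 3) := ((EuclideanSpace.proj (𝕜 := ℝ) i).hasFDerivAt (x := (f x.1).2)).comp x h.snd
  have hb (i : Fin 3) := ((ContinuousLinearMap.proj (R := ℝ) (φ := fun _ : Fin 3 => ℝ) i).hasFDerivAt
    (x := x.2)).comp x (hasFDerivAt_snd (𝕜 := ℝ) (p := x))
  refine ⟨_, HasFDerivAt.prodMk (hasFDerivAt_pi.2 fun i => (hb 0).mul (h1 i))
    (hasFDerivAt_pi.2 fun i => ((hb 1).mul (h2 i)).add ((hb 2).mul (h1 i))), fun a b => ?_⟩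
  refine Prod.ext ?_ ?_
  · funext i
    simp
    ring
  · funext i
    simp
    ring

open Matrix in
/-- The Jacobian determinant of the thickening in terms of `λ ∧ dλ`. -/
theorem abs_det_thicken {z : Space × Space} (hT : z ∈ cotangentSphere) (he : z.2 ≠ 0)
    {V : Coord →L[ℝ] Space × Space} (hV1 : ∀ a, inner ℝ z.1 (V a).1 = 0) {t s u : ℝ}
    {D : Coord × Coord →L[ℝ] Coord × Coord}
    (hD : ∀ a b, D (a, b) = (fun i => t * (V a).1 i + b 0 * z.1 i,
        fun i => s * (V a).2 i + b 1 * z.2 i + (u * (V a).1 i + b 2 * z.1 i))) :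
    |D.det| = |t ^ 2 * s| * |contactForm3 z (V (Pi.single 0 1)) (V (Pi.single 1 1))
      (V (Pi.single 2 1))| := by
  set B := (Pi.basisFun ℝ (Fin 3)).prod (Pi.basisFun ℝ (Fin 3)) with hB
  set n := cross z.1 z.2 with hn
  set E := ‖z.2‖ ^ 2 with hE
  have hE0 : 0 < E := by positivity
  have k1 : z.1 0 * z.1 0 + z.1 1 * z.1 1 + z.1 2 * z.1 2 = 1 := by
    rw [← inner_coords, real_inner_self_eq_norm_sq, hT.1, one_pow]
  have k2 : z.1 0 * z.2 0 + z.1 1 * z.2 1 + z.1 2 * z.2 2 = 0 := by rw [← inner_coords, hT.2]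
  have k3 : z.2 0 * z.2 0 + z.2 1 * z.2 1 + z.2 2 * z.2 2 = E := by
    rw [← inner_coords, real_inner_self_eq_norm_sq]
  have k4 : z.1 0 * n 0 + z.1 1 * n 1 + z.1 2 * n 2 = 0 := by
    rw [← inner_coords]; exact inner_cross_left _ _
  have k5 : z.2 0 * n 0 + z.2 1 * n 1 + z.2 2 * n 2 = 0 := by
    rw [← inner_coords]; exact inner_cross_right _ _
  have k6 : n 0 * n 0 + n 1 * n 1 + n 2 * n 2 = E := by
    rw [← inner_coords, real_inner_self_eq_norm_sq, hn, norm_cross_sq hT]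
  set v : Fin 3 → Space × Space := fun j => V (Pi.single j 1) with hv
  have kv (j : Fin 3) : z.1 0 * (v j).1 0 + z.1 1 * (v j).1 1 + z.1 2 * (v j).1 2 = 0 := by
    rw [← inner_coords]; exact hV1 _
  set M : Matrix (Fin 3 ⊕ Fin 3) (Fin 3 ⊕ Fin 3) ℝ := fromBlocks (of fun i j => t * (v j).1 i)
    (of fun i j => ![z.1 i, 0, 0] j) (of fun i j => s * (v j).2 i + u * (v j).1 i)
    (of fun i j => ![0, z.2 i, z.1 i] j) with hM
  have hMD : LinearMap.toMatrix B B (D : Coord × Coord →ₗ[ℝ] Coord × Coord) = M := by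
    ext i j
    rw [LinearMap.toMatrix_apply]
    rcases j with j | j
    · have : B (Sum.inl j) = (Pi.single j 1, 0) := by simp [hB]
      rw [this]
      simp only [ContinuousLinearMap.coe_coe, hD]
      rcases i with i | i <;> simp [hB, hM, hv]
    · have : B (Sum.inr j) = (0, Pi.single j 1) := by simp [hB]
      rw [this]
      simp only [ContinuousLinearMap.coe_coe, hD]
      rcases i with i | i <;> fin_cases j <;> simp [hB, hM, hv]
  have hdet : D.det = M.det := by
    rw [← hMD, LinearMap.det_toMatrix]
  -- With n = ξ × η, the rows of Q are the orthogonal vectors (η,0), (n,0), (0,n), (ξ,0), (0,η),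
  -- (0,ξ).
  set Q : Matrix (Fin 3 ⊕ Fin 3) (Fin 3 ⊕ Fin 3) ℝ := fromBlocks
    !![z.2 0, z.2 1, z.2 2; n 0, n 1, n 2; 0, 0, 0] !![0, 0, 0; 0, 0, 0; n 0, n 1, n 2]
    !![z.1 0, z.1 1, z.1 2; 0, 0, 0; 0, 0, 0]
    !![0, 0, 0; z.2 0, z.2 1, z.2 2; z.1 0, z.1 1, z.1 2] with hQ
  have hQQ : Q * Qᵀ = fromBlocks !![E, 0, 0; 0, E, 0; 0, 0, E] 0 0 !![1, 0, 0; 0, E, 0; 0, 0, 1] := by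
    rw [hQ, fromBlocks_transpose, fromBlocks_multiply]
    congr 1
    all_goals
      ext i j
      simp only [Matrix.add_apply, Matrix.mul_apply, Fin.sum_univ_three, transpose_apply]
      fin_cases i <;> fin_cases j <;> simp <;> linarith
  have hQd : Q.det ^ 2 = (E ^ 2) ^ 2 := by
    have := congrArg Matrix.det hQQ
    rw [det_mul, det_transpose, det_fromBlocks_zero₁₂, det_fin_three, det_fin_three] at this
    rw [sq, this]
    simp
    ring
  -- The last three columns of M are (ξ,0), (0,η), (0,ξ), orthogonal to the first three rows of Q,
  -- so the product is block triangular.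
  have hQM : Q * M = fromBlocks
      !![t * inner ℝ z.2 (v 0).1, t * inner ℝ z.2 (v 1).1, t * inner ℝ z.2 (v 2).1;
        t * inner ℝ n (v 0).1, t * inner ℝ n (v 1).1, t * inner ℝ n (v 2).1;
        s * inner ℝ n (v 0).2 + u * inner ℝ n (v 0).1, s * inner ℝ n (v 1).2 + u * inner ℝ n (v 1).1,
        s * inner ℝ n (v 2).2 + u * inner ℝ n (v 2).1] 0
      (!![z.1 0, z.1 1, z.1 2; 0, 0, 0; 0, 0, 0] * (of fun i j => t * (v j).1 i) +
        !![0, 0, 0; z.2 0, z.2 1, z.2 2; z.1 0, z.1 1, z.1 2] *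
          (of fun i j => s * (v j).2 i + u * (v j).1 i))
      !![1, 0, 0; 0, E, 0; 0, 0, 1] := by
    rw [hQ, hM, fromBlocks_multiply]
    congr 1
    · ext i j
      simp only [Matrix.add_apply, Matrix.mul_apply, Fin.sum_univ_three, inner_coords]
      fin_cases i <;> fin_cases j <;> simp <;> ring
    · ext i j
      simp only [Matrix.add_apply, Matrix.mul_apply, Fin.sum_univ_three, of_apply]
      fin_cases i <;> fin_cases j <;> simp <;> linarith
    · ext i j
      simp only [Matrix.add_apply, Matrix.mul_apply, Fin.sum_univ_three, of_apply]
      fin_cases i <;> fin_cases j <;> simp <;> linarith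
  have hfr (i j : Fin 3) : E * inner ℝ (v i).2 (v j).1 =
      inner ℝ z.2 (v i).2 * inner ℝ z.2 (v j).1 + inner ℝ n (v i).2 * inner ℝ n (v j).1 := by
    have := inner_eq_frame hT he (v i).2 (v j).1
    rw [hV1] at this
    rw [this]
    ring
  -- The terms with u are a multiple of the second row and drop out of the determinant. The
  -- η-components of dλ cancel because they are wedged with λ.
  have hcf : E * contactForm3 z (v 0) (v 1) (v 2) * (t ^ 2 * s) = -(!![t * inner ℝ z.2 (v 0).1, t * inner ℝ z.2 (v 1).1, t * inner ℝ z.2 (v 2).1;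
        t * inner ℝ n (v 0).1, t * inner ℝ n (v 1).1, t * inner ℝ n (v 2).1;
        s * inner ℝ n (v 0).2 + u * inner ℝ n (v 0).1, s * inner ℝ n (v 1).2 + u * inner ℝ n (v 1).1,
        s * inner ℝ n (v 2).2 + u * inner ℝ n (v 2).1] : Matrix (Fin 3) (Fin 3) ℝ).det := by
    rw [det_fin_three]
    simp [contactForm3, liouville, symp]
    have a01 := hfr 0 1
    have a10 := hfr 1 0
    have a02 := hfr 0 2
    have a20 := hfr 2 0
    have a12 := hfr 1 2
    have a21 := hfr 2 1
    linear_combination (t ^ 2 * s) * (inner ℝ z.2 (v 0).1 * (a12 - a21) -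
      inner ℝ z.2 (v 1).1 * (a02 - a20) + inner ℝ z.2 (v 2).1 * (a01 - a10))
  have hfin := congrArg Matrix.det hQM
  rw [det_mul, det_fromBlocks_zero₁₂, ← neg_eq_iff_eq_neg.2 hcf] at hfin
  have hdE : (!![1, 0, 0; 0, E, 0; 0, 0, 1] : Matrix (Fin 3) (Fin 3) ℝ).det = E := by
    simp [det_fin_three]
  rw [hdE] at hfin
  have hQa : |Q.det| = E ^ 2 := by
    rw [← abs_of_pos (show 0 < E ^ 2 by positivity)]
    exact sq_eq_sq_iff_abs_eq_abs _ _ |>.1 hQd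
  have habs := congrArg abs hfin
  rw [abs_mul, hQa, abs_mul, abs_neg, abs_mul, abs_mul, abs_of_pos hE0] at habs
  rw [hdet]
  have : E ^ 2 * |M.det| = E ^ 2 * (|t ^ 2 * s| * |contactForm3 z (v 0) (v 1) (v 2)|) := by
    linarith
  exact mul_left_cancel₀ (by positivity) this

end RotatingKepler

/-! ### Contact volume as Lebesgue measure of the thickening. -/

namespace RotatingKepler

variable {c : ℝ}

instance isAddHaarMeasure_volume_coord :
    (volume : Measure (Coord × Coord)).IsAddHaarMeasure :=
  Measure.prod.instIsAddHaarMeasure volume volume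

theorem mem_cube {b : Coord} : b ∈ cube ↔ ∀ i, 0 < b i ∧ b i < 1 := by
  simp [cube, mem_pi]

theorem measurableSet_cube : MeasurableSet cube :=
  MeasurableSet.univ_pi fun _ => measurableSet_Ioo

theorem volume_cube : volume cube = 1 := by
  simp [cube, volume_pi_pi]

/-- The thickening does not overlap itself. -/
theorem thickPoint_injOn (hc : 3 / 2 < c) {z z' : Space × Space} {b b' : Coord}
    (hz : z ∈ boundedLevel c) (hz' : z' ∈ boundedLevel c) (hb : b ∈ cube) (hb' : b' ∈ cube)
    (h : thickPoint z b = thickPoint z' b') : z = z' ∧ b = b' := by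
  rw [mem_cube] at hb hb'
  have e1 : b 0 • z.1 = b' 0 • z'.1 := by
    ext i
    simpa [thickPoint] using congrFun (congrArg Prod.fst h) i
  have e2 : b 1 • z.2 + b 2 • z.1 = b' 1 • z'.2 + b' 2 • z'.1 := by
    ext i
    simpa [thickPoint] using congrFun (congrArg Prod.snd h) i
  -- The norm of the first component gives b 0, the ξ-component of the second gives b 2, and b 1
  -- follows because a ray meets the level only once.
  have hb0 : b 0 = b' 0 := by
    have := congrArg norm e1
    rwa [norm_smul, norm_smul, hz.1.1, hz'.1.1, mul_one, mul_one, Real.norm_of_nonneg (hb 0).1.le,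
      Real.norm_of_nonneg (hb' 0).1.le] at this
  have hξ : z.1 = z'.1 := by
    rw [← hb0] at e1
    exact smul_right_injective _ (hb 0).1.ne' e1
  have hb2 : b 2 = b' 2 := by
    have := congrArg (fun v => inner ℝ z.1 v) e2
    simp only [inner_add_right, inner_smul_right, hz.1.2] at this
    rw [hξ, hz'.1.2, real_inner_self_eq_norm_sq, hz'.1.1] at this
    linarith
  have e3 : b 1 • z.2 = b' 1 • z'.2 := by
    rw [hξ, hb2] at e2
    exact add_right_cancel e2
  have e4 : z'.2 = (b 1 / b' 1) • z.2 := by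
    rw [div_eq_inv_mul, mul_smul, e3, smul_smul, inv_mul_cancel₀ (hb' 1).1.ne', one_smul]
  have h1 : b 1 / b' 1 = 1 := by
    refine eq_one_of_smul_mem hc hz (div_pos (hb 1).1 (hb' 1).1) ?_
    rw [← e4, hξ]
    exact hz'
  have hb1 : b 1 = b' 1 := by
    rwa [div_eq_one_iff_eq (hb' 1).1.ne'] at h1
  refine ⟨Prod.ext hξ (by rw [e4, h1, one_smul]), ?_⟩
  funext i
  fin_cases i
  exacts [hb0, hb1, hb2]

/-- The weight of the fibres of the thickening. -/
noncomputable def cubeWeight : ℝ≥0∞ := ∫⁻ b in cube, ENNReal.ofReal |b 0 ^ 2 * b 1|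

theorem measurable_weight : Measurable fun b : Coord => ENNReal.ofReal |b 0 ^ 2 * b 1| := by
  fun_prop

theorem cubeWeight_ne_zero : cubeWeight ≠ 0 := by
  intro h
  rw [cubeWeight, setLIntegral_eq_zero_iff measurableSet_cube measurable_weight] at h
  have h2 : volume cube = 0 := by
    refine measure_mono_null (fun b hb => ?_) h
    intro hcon
    have h3 := hcon hb
    have h0 := ((mem_cube.1 hb) 0).1
    have h1 := ((mem_cube.1 hb) 1).1
    rw [ENNReal.ofReal_eq_zero] at h3
    have : 0 < |b 0 ^ 2 * b 1| := by positivity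
    linarith
  rw [volume_cube] at h2
  exact one_ne_zero h2

theorem cubeWeight_ne_top : cubeWeight ≠ ⊤ := by
  refine ne_top_of_le_ne_top (b := 1) ENNReal.one_ne_top ?_
  calc cubeWeight ≤ ∫⁻ _ in cube, 1 := by
        refine setLIntegral_mono measurable_const fun b hb => ?_
        rw [ENNReal.ofReal_le_one]
        have h0 := (mem_cube.1 hb) 0
        have h1 := (mem_cube.1 hb) 1
        rw [abs_of_nonneg (by have := h1.1; positivity)]
        have : b 0 ^ 2 ≤ 1 := by nlinarith
        nlinarith
    _ = 1 := by rw [setLIntegral_const, volume_cube, one_mul]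

theorem contDiffOn_fderiv_continuousOn {f : Coord → Space × Space} {s : Set Coord} (hs : IsOpen s)
    (hf : ContDiffOn ℝ ∞ f s) (e : Coord) : ContinuousOn (fun a => fderiv ℝ f a e) s :=
  (hf.continuousOn_fderiv_of_isOpen hs (by simp)).clm_apply continuousOn_const

namespace Patch

variable (P : Patch (boundedLevel c))

theorem differentiableAt {a : Coord} (ha : a ∈ P.domain) : DifferentiableAt ℝ P.map a :=
  (P.contDiffOn_map.contDiffAt (P.isOpen_domain.mem_nhds ha)).differentiableAt (by simp)

theorem inner_fderiv_eq_zero {a : Coord} (ha : a ∈ P.domain) (v : Coord) :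
    inner ℝ (P.map a).1 (fderiv ℝ P.map a v).1 = 0 := by
  have hd := (P.differentiableAt ha).hasFDerivAt
  have hl : HasDerivAt (fun s : ℝ => a + s • v) v 0 := by
    simpa using ((hasDerivAt_id (0 : ℝ)).smul_const v).const_add a
  have hcomp : HasDerivAt (fun s : ℝ => P.map (a + s • v)) (fderiv ℝ P.map a v) 0 := by
    refine HasFDerivAt.comp_hasDerivAt (l := P.map) 0 ?_ hl
    simpa using hd
  have hf : HasDerivAt (fun s : ℝ => (P.map (a + s • v)).1) (fderiv ℝ P.map a v).1 0 := hcomp.fst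
  have h1 : HasDerivAt (fun s : ℝ => ‖(P.map (a + s • v)).1‖ ^ 2) 0 0 := by
    refine (hasDerivAt_const (0 : ℝ) (1 : ℝ)).congr_of_eventuallyEq ?_
    have : ∀ᶠ s in nhds (0 : ℝ), a + s • v ∈ P.domain := by
      refine hl.continuousAt.eventually (P.isOpen_domain.mem_nhds ?_)
      simpa using ha
    filter_upwards [this] with s hs
    rw [(P.mapsTo_map hs).1.1, one_pow]
  have h2 := hf.norm_sq.unique h1
  simp only [zero_smul, add_zero] at h2
  linarith

/-- The density of `λ ∧ dλ` in a patch. -/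
noncomputable def density (a : Coord) : ℝ := contactForm3 (P.map a)
  (fderiv ℝ P.map a (Pi.single 0 1)) (fderiv ℝ P.map a (Pi.single 1 1))
  (fderiv ℝ P.map a (Pi.single 2 1))

theorem continuousOn_density : ContinuousOn P.density P.domain := by
  have h (e : Coord) := contDiffOn_fderiv_continuousOn P.isOpen_domain P.contDiffOn_map e
  have h0 := P.contDiffOn_map.continuousOn
  have f1 (e : Coord) := continuous_fst.comp_continuousOn (h e)
  have f2 (e : Coord) := continuous_snd.comp_continuousOn (h e)
  have g2 := continuous_snd.comp_continuousOn h0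
  have l (e : Coord) : ContinuousOn (fun a => liouville (P.map a) (fderiv ℝ P.map a e)) P.domain :=
    g2.inner (f1 e)
  have s (e e' : Coord) : ContinuousOn
      (fun a => symp (fderiv ℝ P.map a e) (fderiv ℝ P.map a e')) P.domain :=
    ((f2 e).inner (f1 e')).sub ((f2 e').inner (f1 e))
  exact (((l _).mul (s _ _)).sub ((l _).mul (s _ _))).add ((l _).mul (s _ _))

theorem exists_hasFDerivAt {x : Coord × Coord} (hx : x.1 ∈ P.domain) :
    ∃ D : Coord × Coord →L[ℝ] Coord × Coord, HasFDerivAt (thicken P.map) D x ∧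
      |D.det| = |x.2 0 ^ 2 * x.2 1| * |P.density x.1| := by
  obtain ⟨D, h1, h2⟩ := exists_hasFDerivAt_thicken (P.differentiableAt hx).hasFDerivAt
  have hm := P.mapsTo_map hx
  exact ⟨D, h1, abs_det_thicken hm.1 (norm_pos_iff.1 (norm_pos_of_level hm.2.1))
    (P.inner_fderiv_eq_zero hx) h2⟩

theorem injOn_thicken (hc : 3 / 2 < c) : InjOn (thicken P.map) (P.piece ×ˢ cube) := by
  rintro ⟨a, b⟩ ⟨ha, hb⟩ ⟨a', b'⟩ ⟨ha', hb'⟩ h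
  obtain ⟨h1, h2⟩ := thickPoint_injOn hc (P.mapsTo_map (P.piece_subset ha))
    (P.mapsTo_map (P.piece_subset ha')) hb hb' h
  exact Prod.ext (P.injOn_map (P.piece_subset ha) (P.piece_subset ha') h1) h2

theorem hasFDerivWithinAt_thicken : ∀ x ∈ P.piece ×ˢ cube,
    HasFDerivWithinAt (thicken P.map) (fderiv ℝ (thicken P.map) x) (P.piece ×ˢ cube) x := by
  intro x hx
  obtain ⟨D, h1, -⟩ := P.exists_hasFDerivAt (P.piece_subset hx.1)
  exact h1.differentiableAt.hasFDerivAt.hasFDerivWithinAt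

theorem measurableSet_image_thicken (hc : 3 / 2 < c) :
    MeasurableSet (thicken P.map '' (P.piece ×ˢ cube)) :=
  measurable_image_of_fderivWithin (P.measurableSet_piece.prod measurableSet_cube)
    P.hasFDerivWithinAt_thicken (P.injOn_thicken hc)

/-- The Lebesgue measure of the thickening of a patch is a multiple of its contact volume. -/
theorem volume_image_thicken (hc : 3 / 2 < c) :
    MeasureTheory.volume (thicken P.map '' (P.piece ×ˢ cube)) = P.volume * cubeWeight := by
  have hm := P.measurableSet_piece.prod measurableSet_cube
  rw [← lintegral_abs_det_fderiv_eq_addHaar_image MeasureTheory.volume hm P.hasFDerivWithinAt_thicken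
    (P.injOn_thicken hc)]
  have h1 : ∫⁻ x in P.piece ×ˢ cube, ENNReal.ofReal |(fderiv ℝ (thicken P.map) x).det| =
      ∫⁻ x in P.piece ×ˢ cube, ENNReal.ofReal |P.density x.1| *
        ENNReal.ofReal |x.2 0 ^ 2 * x.2 1| := by
    refine setLIntegral_congr_fun hm fun x hx => ?_
    obtain ⟨D, h1, h2⟩ := P.exists_hasFDerivAt (P.piece_subset hx.1)
    rw [h1.fderiv, h2, ENNReal.ofReal_mul (abs_nonneg _), mul_comm]
  rw [h1, Measure.volume_eq_prod, ← Measure.prod_restrict]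
  refine lintegral_prod_mul (f := fun a => ENNReal.ofReal |P.density a|)
    (g := fun b : Coord => ENNReal.ofReal |b 0 ^ 2 * b 1|) ?_ measurable_weight.aemeasurable
  have h2 := ((P.continuousOn_density.mono P.piece_subset).abs).aemeasurable (μ := MeasureTheory.volume)
    P.measurableSet_piece
  exact h2.ennreal_ofReal

end Patch

/-- If the thickening of a single patch fills the thickening of the whole hypersurface up to a null
set, then this patch computes the contact volume. -/
theorem contactVolume_eq_of_patch (hc : 3 / 2 < c) (P : Patch (boundedLevel c)) {N : Set (Coord × Coord)}
    (hN : volume N = 0) (h : ∀ z ∈ boundedLevel c, ∀ b ∈ cube,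
      thickPoint z b ∈ thicken P.map '' (P.piece ×ˢ cube) ∪ N) :
    contactVolume (boundedLevel c) = P.volume := by
  apply le_antisymm
  · refine iSup_le fun n => iSup_le fun Q => iSup_le fun hQ => ?_
    -- The weight is neither zero nor infinite, so volumes may be compared through the measures of
    -- the thickenings.
    rw [← ENNReal.mul_le_mul_iff_left cubeWeight_ne_zero cubeWeight_ne_top, Finset.sum_mul]
    calc ∑ i, (Q i).volume * cubeWeight
        = ∑ i, volume (thicken (Q i).map '' ((Q i).piece ×ˢ cube)) :=
          Finset.sum_congr rfl fun i _ => ((Q i).volume_image_thicken hc).symm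
      _ = volume (⋃ i, thicken (Q i).map '' ((Q i).piece ×ˢ cube)) := by
          rw [measure_iUnion ?_ fun i => (Q i).measurableSet_image_thicken hc, tsum_fintype]
          intro i j hij
          rw [Function.onFun, Set.disjoint_left]
          rintro _ ⟨⟨a, b⟩, ⟨ha, hb⟩, rfl⟩ ⟨⟨a', b'⟩, ⟨ha', hb'⟩, h'⟩
          obtain ⟨h1, -⟩ := thickPoint_injOn hc ((Q j).mapsTo_map ((Q j).piece_subset ha'))
            ((Q i).mapsTo_map ((Q i).piece_subset ha)) hb' hb h'
          exact Set.disjoint_left.1 (hQ hij) ⟨a, ha, rfl⟩ ⟨a', ha', h1⟩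
      _ ≤ volume (thicken P.map '' (P.piece ×ˢ cube) ∪ N) := by
          refine measure_mono (iUnion_subset fun i => ?_)
          rintro _ ⟨⟨a, b⟩, ⟨ha, hb⟩, rfl⟩
          exact h _ ((Q i).mapsTo_map ((Q i).piece_subset ha)) b hb
      _ ≤ P.volume * cubeWeight := by
          refine (measure_union_le _ _).trans ?_
          rw [hN, add_zero, P.volume_image_thicken hc]
  · refine le_iSup_of_le 1 (le_iSup_of_le (fun _ => P) (le_iSup_of_le ?_ ?_))
    · intro i j hij
      exact absurd (Subsingleton.elim i j) hij
    · simp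

end RotatingKepler

namespace RotatingKepler

/-! ### Polar coordinates on the energy level -/

/-- The point of `S²` over the point with polar coordinates `r, φ`. -/
noncomputable def polarPoint (r φ : ℝ) : Space :=
  !₂[2 * r / (r ^ 2 + 1) * Real.cos φ, 2 * r / (r ^ 2 + 1) * Real.sin φ, (r ^ 2 - 1) / (r ^ 2 + 1)]

/-- The unit tangent vector along the meridian. -/
noncomputable def meridian (r φ : ℝ) : Space :=
  !₂[(1 - r ^ 2) / (r ^ 2 + 1) * Real.cos φ, (1 - r ^ 2) / (r ^ 2 + 1) * Real.sin φ,
    2 * r / (r ^ 2 + 1)]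

/-- The unit tangent vector along the parallel. -/
noncomputable def parallel (φ : ℝ) : Space := !₂[-Real.sin φ, Real.cos φ, 0]

/-- The unit covector of angle `θ`. -/
noncomputable def polarDir (r φ θ : ℝ) : Space :=
  Real.sin θ • meridian r φ - Real.cos θ • parallel φ

/-- The radicand `(r² + 2c)² + 16 r cos θ`. -/
noncomputable def radicand (c r θ : ℝ) : ℝ := (r ^ 2 + 2 * c) ^ 2 + 16 * r * Real.cos θ

/-- The norm of the covector of angle `θ` on the energy level. -/
noncomputable def polarNorm (c r θ : ℝ) : ℝ :=
  2 * (r ^ 2 + 1) / ((r ^ 2 + 2 * c) + √(radicand c r θ))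

/-- The parametrization of the energy level by the polar coordinates `r, φ` of the stereographic
projection and the angle `θ` of the covector. -/
noncomputable def polarMap (c : ℝ) (a : Coord) : Space × Space :=
  (polarPoint (a 0) (a 1), polarNorm c (a 0) (a 2) • polarDir (a 0) (a 1) (a 2))

variable {c : ℝ}

theorem inner_polarPoint_self (r φ : ℝ) : inner ℝ (polarPoint r φ) (polarPoint r φ) = (1 : ℝ) := by
  have h : r ^ 2 + 1 ≠ 0 := by positivity
  rw [inner_coords]
  simp [polarPoint]
  field_simp
  linear_combination 4 * r ^ 2 * Real.sin_sq_add_cos_sq φ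

theorem inner_meridian_self (r φ : ℝ) : inner ℝ (meridian r φ) (meridian r φ) = (1 : ℝ) := by
  have h : r ^ 2 + 1 ≠ 0 := by positivity
  rw [inner_coords]
  simp [meridian]
  field_simp
  linear_combination (1 - r ^ 2) ^ 2 * Real.sin_sq_add_cos_sq φ

theorem inner_parallel_self (φ : ℝ) : inner ℝ (parallel φ) (parallel φ) = (1 : ℝ) := by
  rw [inner_coords]
  simp [parallel]
  linear_combination Real.sin_sq_add_cos_sq φ

theorem inner_polarPoint_meridian (r φ : ℝ) :
    inner ℝ (polarPoint r φ) (meridian r φ) = (0 : ℝ) := by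
  have h : r ^ 2 + 1 ≠ 0 := by positivity
  simp [inner_coords, polarPoint, meridian]
  field_simp
  linear_combination 2 * (1 - r ^ 2) * r * Real.sin_sq_add_cos_sq φ

theorem inner_polarPoint_parallel (r φ : ℝ) :
    inner ℝ (polarPoint r φ) (parallel φ) = (0 : ℝ) := by
  simp [inner_coords, polarPoint, parallel]
  ring

theorem inner_meridian_parallel (r φ : ℝ) :
    inner ℝ (meridian r φ) (parallel φ) = (0 : ℝ) := by
  simp [inner_coords, meridian, parallel]
  ring

theorem inner_polarDir_meridian (r φ θ : ℝ) :
    inner ℝ (polarDir r φ θ) (meridian r φ) = Real.sin θ := by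
  rw [polarDir, inner_sub_left, real_inner_smul_left, real_inner_smul_left, inner_meridian_self,
    real_inner_comm, inner_meridian_parallel]
  ring

theorem inner_polarDir_parallel (r φ θ : ℝ) :
    inner ℝ (polarDir r φ θ) (parallel φ) = -Real.cos θ := by
  rw [polarDir, inner_sub_left, real_inner_smul_left, real_inner_smul_left, inner_parallel_self,
    inner_meridian_parallel]
  ring

theorem norm_polarDir (r φ θ : ℝ) : ‖polarDir r φ θ‖ = 1 := by
  rw [← pow_eq_one_iff_of_nonneg (norm_nonneg _) two_ne_zero, ← real_inner_self_eq_norm_sq]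
  nth_rewrite 2 [polarDir]
  rw [inner_sub_right, inner_smul_right, inner_smul_right, inner_polarDir_meridian,
    inner_polarDir_parallel]
  linear_combination Real.sin_sq_add_cos_sq θ

theorem polarDir_mem (r φ θ : ℝ) : (polarPoint r φ, polarDir r φ θ) ∈ cotangentSphere := by
  constructor
  · rw [← pow_eq_one_iff_of_nonneg (norm_nonneg _) two_ne_zero, ← real_inner_self_eq_norm_sq]
    exact inner_polarPoint_self r φ
  · change inner ℝ (polarPoint r φ) (polarDir r φ θ) = 0
    rw [polarDir, inner_sub_right, inner_smul_right, inner_smul_right, inner_polarPoint_meridian,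
      inner_polarPoint_parallel]
    ring

/-- (r² + 2c)² > (r² + 3)² ≥ 16|r|, the last difference being (|r| - 1)²(|r|² + 2|r| + 9). Real r of
either sign are allowed, so that `polarMap` is smooth on all of ℝ³. -/
theorem radicand_pos (hc : 3 / 2 < c) (r θ : ℝ) : 0 < radicand c r θ := by
  have h1 := Real.abs_cos_le_one θ
  have h2 : |r * Real.cos θ| ≤ |r| := by
    rw [abs_mul]
    exact mul_le_of_le_one_right (abs_nonneg _) h1
  have h3 := neg_le_of_abs_le h2
  have h4 : (r ^ 2 + 3) ^ 2 < (r ^ 2 + 2 * c) ^ 2 := by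
    refine pow_lt_pow_left₀ (by linarith) (by positivity) two_ne_zero
  have h5 : (r ^ 2 + 3) ^ 2 - 16 * |r| = (|r| - 1) ^ 2 * (|r| ^ 2 + 2 * |r| + 9) := by
    rw [← sq_abs r]; ring
  have h6 : 0 ≤ (|r| - 1) ^ 2 * (|r| ^ 2 + 2 * |r| + 9) := by positivity
  unfold radicand
  linarith

theorem denominator_pos (hc : 3 / 2 < c) (r θ : ℝ) :
    0 < (r ^ 2 + 2 * c) + √(radicand c r θ) := by
  have := Real.sqrt_nonneg (radicand c r θ)
  nlinarith [sq_nonneg r]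

theorem polarNorm_pos (hc : 3 / 2 < c) (r θ : ℝ) : 0 < polarNorm c r θ :=
  div_pos (by positivity) (denominator_pos hc r θ)

theorem polarNorm_eq_scale (hc : 3 / 2 < c) (r φ θ : ℝ) :
    polarNorm c r θ = scale c (polarPoint r φ, polarDir r φ θ) := by
  have h : 0 < r ^ 2 + 1 := by positivity
  have e1 : radius (polarPoint r φ, polarDir r φ θ) = 2 / (r ^ 2 + 1) := by
    simp only [radius, norm_polarDir]
    simp [polarPoint]
    field_simp
    ring
  -- The sign of `parallel` in `polarDir` is chosen so that A is a positive multiple of r cos θ, as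
  -- in the radicand of the theorem.
  have e2 : angMom (polarPoint r φ, polarDir r φ θ) = 2 * r / (r ^ 2 + 1) * Real.cos θ := by
    simp [angMom, polarPoint, polarDir, meridian, parallel]
    field_simp
    linear_combination r * (1 + r ^ 2) * Real.cos θ * Real.sin_sq_add_cos_sq φ
  have e3 : linCoeff c (polarPoint r φ, polarDir r φ θ) = (r ^ 2 + 2 * c) / (r ^ 2 + 1) := by
    simp only [linCoeff, e1, norm_polarDir]
    field_simp
    ring
  have e4 : ((r ^ 2 + 2 * c) / (r ^ 2 + 1)) ^ 2 +
      4 * (2 * r / (r ^ 2 + 1) * Real.cos θ * (2 / (r ^ 2 + 1))) =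
      radicand c r θ / (r ^ 2 + 1) ^ 2 := by
    unfold radicand
    field_simp
    ring
  have hd := denominator_pos hc r θ
  rw [scale, e1, e2, e3, e4, Real.sqrt_div' _ (by positivity), Real.sqrt_sq h.le, ← add_div,
    polarNorm]
  field_simp

theorem polarMap_mem (hc : 3 / 2 < c) (a : Coord) : polarMap c a ∈ boundedLevel c := by
  have h := norm_polarDir (a 0) (a 1) (a 2)
  have h0 : polarDir (a 0) (a 1) (a 2) ≠ 0 := norm_ne_zero_iff.1 (h ▸ one_ne_zero)
  have := scale_mem hc (polarDir_mem (a 0) (a 1) (a 2)) h0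
  rwa [← polarNorm_eq_scale hc] at this

theorem contDiff_polarMap (hc : 3 / 2 < c) : ContDiff ℝ ∞ (polarMap c) := by
  have p (i : Fin 3) : ContDiff ℝ ∞ fun a : Coord => a i := contDiff_apply ℝ ℝ i
  have hn (a : Coord) : a 0 ^ 2 + 1 ≠ 0 := by positivity
  have i : ContDiff ℝ ∞ fun a : Coord => (a 0 ^ 2 + 1)⁻¹ :=
    (((p 0).pow 2).add contDiff_const).inv hn
  have co (j : Fin 3) : ContDiff ℝ ∞ fun a : Coord => Real.cos (a j) := Real.contDiff_cos.comp (p j)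
  have si (j : Fin 3) : ContDiff ℝ ∞ fun a : Coord => Real.sin (a j) := Real.contDiff_sin.comp (p j)
  have h1 : ContDiff ℝ ∞ fun a : Coord => polarPoint (a 0) (a 1) := by
    rw [contDiff_euclidean]
    intro j
    fin_cases j
    · exact (((p 0).const_smul (2 : ℝ)).mul i).mul (co 1)
    · exact (((p 0).const_smul (2 : ℝ)).mul i).mul (si 1)
    · exact (((p 0).pow 2).sub contDiff_const).mul i
  have h2 : ContDiff ℝ ∞ fun a : Coord => meridian (a 0) (a 1) := by
    rw [contDiff_euclidean]
    intro j
    fin_cases j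
    · exact ((contDiff_const.sub ((p 0).pow 2)).mul i).mul (co 1)
    · exact ((contDiff_const.sub ((p 0).pow 2)).mul i).mul (si 1)
    · exact ((p 0).const_smul (2 : ℝ)).mul i
  have h3 : ContDiff ℝ ∞ fun a : Coord => parallel (a 1) := by
    rw [contDiff_euclidean]
    intro j
    fin_cases j
    · exact (si 1).neg
    · exact co 1
    · exact contDiff_const
  have h4 : ContDiff ℝ ∞ fun a : Coord => polarNorm c (a 0) (a 2) := by
    have r : ContDiff ℝ ∞ fun a : Coord => radicand c (a 0) (a 2) :=
      ((((p 0).pow 2).add contDiff_const).pow 2).add ((contDiff_const.mul (p 0)).mul (co 2))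
    exact (contDiff_const.mul (((p 0).pow 2).add contDiff_const)).div
      ((((p 0).pow 2).add contDiff_const).add (r.sqrt fun a => (radicand_pos hc _ _).ne'))
      fun a => (denominator_pos hc _ _).ne'
  exact h1.prodMk (h4.smul (((si 2).smul h2).sub ((co 2).smul h3)))

/-! ### The contact form in polar coordinates -/

theorem hasDerivAt_polarPoint_fst (r φ : ℝ) :
    HasDerivAt (fun r => polarPoint r φ) ((2 / (r ^ 2 + 1)) • meridian r φ) r := by
  have hn : r ^ 2 + 1 ≠ 0 := by positivity
  have hd : HasDerivAt (fun r : ℝ => r ^ 2) (2 * r) r := by simpa using hasDerivAt_pow 2 r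
  have h1 : HasDerivAt (fun r : ℝ => 2 * r / (r ^ 2 + 1)) (2 * (1 - r ^ 2) / (r ^ 2 + 1) ^ 2) r := by
    refine ((hasDerivAt_const_mul_self 2 r).div (hd.add_const 1) hn).congr_deriv ?_
    ring
  have h2 : HasDerivAt (fun r : ℝ => (r ^ 2 - 1) / (r ^ 2 + 1)) (4 * r / (r ^ 2 + 1) ^ 2) r := by
    refine ((hd.sub_const 1).div (hd.add_const 1) hn).congr_deriv ?_
    ring
  refine hasDerivAt_of_coord fun i => ?_
  fin_cases i
  · refine (h1.mul_const (Real.cos φ)).congr_deriv ?_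
    simp [meridian]
    field_simp
  · refine (h1.mul_const (Real.sin φ)).congr_deriv ?_
    simp [meridian]
    field_simp
  · refine h2.congr_deriv ?_
    simp [meridian]
    field_simp
    ring

theorem hasDerivAt_polarPoint_snd (r φ : ℝ) :
    HasDerivAt (fun φ => polarPoint r φ) ((2 * r / (r ^ 2 + 1)) • parallel φ) φ := by
  refine hasDerivAt_of_coord fun i => ?_
  fin_cases i
  · refine ((Real.hasDerivAt_cos φ).const_mul (2 * r / (r ^ 2 + 1))).congr_deriv ?_
    simp [parallel]
  · refine ((Real.hasDerivAt_sin φ).const_mul (2 * r / (r ^ 2 + 1))).congr_deriv ?_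
    simp [parallel]
  · refine (hasDerivAt_const φ ((r ^ 2 - 1) / (r ^ 2 + 1))).congr_deriv ?_
    simp [parallel]

theorem hasDerivAt_polarDir (r φ θ : ℝ) : HasDerivAt (fun θ => polarDir r φ θ)
    (Real.cos θ • meridian r φ + Real.sin θ • parallel φ) θ := by
  refine (((Real.hasDerivAt_sin θ).smul_const (meridian r φ)).sub
    ((Real.hasDerivAt_cos θ).smul_const (parallel φ))).congr_deriv ?_
  rw [neg_smul, sub_neg_eq_add]

theorem hasDerivAt_polarMap_update (hc : 3 / 2 < c) (a : Coord) (j : Fin 3) :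
    HasDerivAt (fun s => polarMap c (Function.update a j s))
      (fderiv ℝ (polarMap c) a (Pi.single j 1)) (a j) := by
  have hd := ((contDiff_polarMap hc).differentiable (by simp) a).hasFDerivAt
  have h2 := hasDerivAt_update a j (a j)
  refine HasFDerivAt.comp_hasDerivAt (l := polarMap c) (a j) ?_ h2
  rwa [Function.update_eq_self]

theorem fderiv_polarMap_zero (hc : 3 / 2 < c) (a : Coord) :
    (fderiv ℝ (polarMap c) a (Pi.single 0 1)).1 = (2 / (a 0 ^ 2 + 1)) • meridian (a 0) (a 1) := by
  have h : HasDerivAt (fun s => (polarMap c (Function.update a 0 s)).1)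
    (fderiv ℝ (polarMap c) a (Pi.single 0 1)).1 (a 0) := (hasDerivAt_polarMap_update hc a 0).fst
  refine h.unique ?_
  simpa [polarMap] using hasDerivAt_polarPoint_fst (a 0) (a 1)

theorem fderiv_polarMap_one (hc : 3 / 2 < c) (a : Coord) :
    (fderiv ℝ (polarMap c) a (Pi.single 1 1)).1 =
      (2 * a 0 / (a 0 ^ 2 + 1)) • parallel (a 1) := by
  have h : HasDerivAt (fun s => (polarMap c (Function.update a 1 s)).1)
    (fderiv ℝ (polarMap c) a (Pi.single 1 1)).1 (a 1) := (hasDerivAt_polarMap_update hc a 1).fst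
  refine h.unique ?_
  simpa [polarMap] using hasDerivAt_polarPoint_snd (a 0) (a 1)

/-- This vector is vertical, so λ ∧ dλ sees only the base components of the other two. The radial
coefficient d may stay unspecified: it enters as a multiple of λ wedged with λ. -/
theorem fderiv_polarMap_two (hc : 3 / 2 < c) (a : Coord) :
    (fderiv ℝ (polarMap c) a (Pi.single 2 1)).1 = 0 ∧
    ∃ d : ℝ, (fderiv ℝ (polarMap c) a (Pi.single 2 1)).2 =
      polarNorm c (a 0) (a 2) • (Real.cos (a 2) • meridian (a 0) (a 1) +
        Real.sin (a 2) • parallel (a 1)) + d • polarDir (a 0) (a 1) (a 2) := by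
  have h1 : HasDerivAt (fun s => (polarMap c (Function.update a 2 s)).1)
    (fderiv ℝ (polarMap c) a (Pi.single 2 1)).1 (a 2) := (hasDerivAt_polarMap_update hc a 2).fst
  have h2 : HasDerivAt (fun s => (polarMap c (Function.update a 2 s)).2)
    (fderiv ℝ (polarMap c) a (Pi.single 2 1)).2 (a 2) := (hasDerivAt_polarMap_update hc a 2).snd
  constructor
  · refine h1.unique ?_
    simpa [polarMap] using hasDerivAt_const (a 2) (polarPoint (a 0) (a 1))
  · have h3 : DifferentiableAt ℝ (fun θ => polarNorm c (a 0) θ) (a 2) := by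
      have r : DifferentiableAt ℝ (fun θ => radicand c (a 0) θ) (a 2) :=
        ((Real.hasDerivAt_cos (a 2)).differentiableAt.const_mul (16 * a 0)).const_add _
      exact (differentiableAt_const (2 * (a 0 ^ 2 + 1))).div
        ((r.sqrt (radicand_pos hc _ _).ne').const_add _) (denominator_pos hc _ _).ne'
    refine ⟨deriv (fun θ => polarNorm c (a 0) θ) (a 2), h2.unique ?_⟩
    have e : HasDerivAt (fun s => polarNorm c (a 0) s • polarDir (a 0) (a 1) s) _ (a 2) :=
      h3.hasDerivAt.smul (hasDerivAt_polarDir (a 0) (a 1) (a 2))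
    simpa [polarMap] using e

/-- The density of `λ ∧ dλ` in polar coordinates. -/
theorem contactForm3_polarMap (hc : 3 / 2 < c) (a : Coord) :
    contactForm3 (polarMap c a) (fderiv ℝ (polarMap c) a (Pi.single 0 1))
      (fderiv ℝ (polarMap c) a (Pi.single 1 1)) (fderiv ℝ (polarMap c) a (Pi.single 2 1)) =
      -(16 * a 0 / ((a 0 ^ 2 + 2 * c) + √(radicand c (a 0) (a 2))) ^ 2) := by
  have h0 := fderiv_polarMap_zero hc a
  have h1 := fderiv_polarMap_one hc a
  obtain ⟨h2, d, h3⟩ := fderiv_polarMap_two hc a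
  have m1 := inner_meridian_self (a 0) (a 1)
  have m2 := inner_parallel_self (a 1)
  have m3 := inner_meridian_parallel (a 0) (a 1)
  have m3' : inner ℝ (parallel (a 1)) (meridian (a 0) (a 1)) = (0 : ℝ) := by
    rw [real_inner_comm, m3]
  simp only [contactForm3, liouville, symp, h0, h1, h2, h3, polarMap, inner_zero_right,
    real_inner_smul_left, inner_smul_right, inner_polarDir_meridian, inner_polarDir_parallel,
    inner_add_left, m1, m2, m3, m3']
  have hd := denominator_pos hc (a 0) (a 2)
  have hs := Real.sin_sq_add_cos_sq (a 2)
  have hN : polarNorm c (a 0) (a 2) ^ 2 * (4 / (a 0 ^ 2 + 1) ^ 2) =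
      16 / ((a 0 ^ 2 + 2 * c) + √(radicand c (a 0) (a 2))) ^ 2 := by
    unfold polarNorm
    field_simp
    norm_num
  have : 16 * a 0 / ((a 0 ^ 2 + 2 * c) + √(radicand c (a 0) (a 2))) ^ 2 =
      a 0 * (polarNorm c (a 0) (a 2) ^ 2 * (4 / (a 0 ^ 2 + 1) ^ 2)) := by
    rw [hN]; ring
  rw [this]
  have e : (4 / (a 0 ^ 2 + 1) ^ 2 : ℝ) = (2 / (a 0 ^ 2 + 1)) ^ 2 := by rw [div_pow]; norm_num
  have e2 : (2 * a 0 / (a 0 ^ 2 + 1) : ℝ) = a 0 * (2 / (a 0 ^ 2 + 1)) := by ring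
  rw [e, e2]
  generalize 2 / (a 0 ^ 2 + 1) = w
  linear_combination (-polarNorm c (a 0) (a 2) ^ 2 * w ^ 2 * a 0) * hs

/-- A linear map whose columns span a volume with respect to `λ ∧ dλ` is injective. -/
theorem injective_of_contactForm3_ne_zero {z : Space × Space} {V : Coord →L[ℝ] Space × Space}
    (h : contactForm3 z (V (Pi.single 0 1)) (V (Pi.single 1 1)) (V (Pi.single 2 1)) ≠ 0) :
    Function.Injective V := by
  rw [injective_iff_map_eq_zero]
  intro a ha
  set v : Fin 3 → Space × Space := fun j => V (Pi.single j 1) with hv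
  have hsum : a 0 • v 0 + a 1 • v 1 + a 2 • v 2 = 0 := by
    rw [← ha]
    simp only [hv, ← map_smul, ← map_add]
    congr 1
    funext i
    fin_cases i <;> simp
  have hl : a 0 * liouville z (v 0) + a 1 * liouville z (v 1) + a 2 * liouville z (v 2) = 0 := by
    have := congrArg (liouville z) hsum
    simpa [liouville, inner_add_right, inner_smul_right] using this
  have hs (j : Fin 3) : a 0 * symp (v 0) (v j) + a 1 * symp (v 1) (v j) +
      a 2 * symp (v 2) (v j) = 0 := by
    have := congrArg (fun u => symp u (v j)) hsum
    simp only [symp, Prod.fst_add, Prod.snd_add, Prod.smul_fst, Prod.smul_snd, inner_add_left,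
      inner_add_right, real_inner_smul_left, inner_smul_right, Prod.fst_zero, Prod.snd_zero,
      inner_zero_left, inner_zero_right] at this ⊢
    linarith
  have anti (i j : Fin 3) : symp (v i) (v j) = -symp (v j) (v i) := by
    simp only [symp]; ring
  have self (i : Fin 3) : symp (v i) (v i) = 0 := by simp [symp]
  have s0 := hs 0
  have s1 := hs 1
  have s2 := hs 2
  rw [self, anti 1 0, anti 2 0] at s0
  rw [self, anti 2 1] at s1
  rw [self] at s2
  change contactForm3 z (v 0) (v 1) (v 2) ≠ 0 at h
  -- Cramer's rule: contracting the relation Σ aᵢ vᵢ = 0 with λ ∧ dλ isolates one coefficient at a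
  -- time.
  have c0 : a 0 * contactForm3 z (v 0) (v 1) (v 2) = 0 := by
    unfold contactForm3
    linear_combination symp (v 1) (v 2) * hl - liouville z (v 1) * s2 + liouville z (v 2) * s1
  have c1 : a 1 * contactForm3 z (v 0) (v 1) (v 2) = 0 := by
    unfold contactForm3
    linear_combination (-symp (v 0) (v 2)) * hl + liouville z (v 0) * s2 - liouville z (v 2) * s0
  have c2 : a 2 * contactForm3 z (v 0) (v 1) (v 2) = 0 := by
    unfold contactForm3
    linear_combination symp (v 0) (v 1) * hl - liouville z (v 0) * s1 + liouville z (v 1) * s0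
  funext i
  fin_cases i
  exacts [(mul_eq_zero.1 c0).resolve_right h, (mul_eq_zero.1 c1).resolve_right h,
    (mul_eq_zero.1 c2).resolve_right h]

end RotatingKepler

namespace RotatingKepler

variable {c : ℝ}

/-! ### The polar patch covers almost all of the energy level -/

/-- The open box of polar coordinates. -/
def polarBox : Set Coord :=
  {a | 0 < a 0 ∧ a 1 ∈ Ioo 0 (2 * Real.pi) ∧ a 2 ∈ Ioo 0 (2 * Real.pi)}

theorem isOpen_polarBox : IsOpen polarBox := by
  have p (i : Fin 3) : Continuous fun a : Coord => a i := continuous_apply i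
  exact (isOpen_Ioi.preimage (p 0)).inter
    ((isOpen_Ioo.preimage (p 1)).inter (isOpen_Ioo.preimage (p 2)))

theorem eq_of_cos_eq_of_sin_eq {x y : ℝ} (hx : x ∈ Ioc 0 (2 * Real.pi))
    (hy : y ∈ Ioc 0 (2 * Real.pi)) (hc : Real.cos x = Real.cos y)
    (hs : Real.sin x = Real.sin y) : x = y := by
  have h : (x : Real.Angle) = y := Real.Angle.cos_sin_inj hc hs
  obtain ⟨k, hk⟩ := Real.Angle.angle_eq_iff_two_pi_dvd_sub.1 h
  have hpi := Real.pi_pos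
  have h1 : (k : ℝ) < 1 := by
    by_contra! hk1
    nlinarith [hx.1, hx.2, hy.1, hy.2]
  have h2 : (-1 : ℝ) < k := by
    by_contra! hk1
    nlinarith [hx.1, hx.2, hy.1, hy.2]
  have h3 : k = 0 := by
    have : k < 1 := by exact_mod_cast h1
    have : -1 < k := by exact_mod_cast h2
    omega
  rw [h3] at hk
  simp at hk
  linarith

theorem exists_cos_eq_sin_eq {x y : ℝ} (h : x ^ 2 + y ^ 2 = 1) :
    ∃ φ ∈ Ioc 0 (2 * Real.pi), Real.cos φ = x ∧ Real.sin φ = y := by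
  have hn : ‖(⟨x, y⟩ : ℂ)‖ = 1 := by
    rw [← pow_eq_one_iff_of_nonneg (norm_nonneg _) two_ne_zero, Complex.sq_norm,
      Complex.normSq_mk]
    linarith
  have h0 : (⟨x, y⟩ : ℂ) ≠ 0 := norm_ne_zero_iff.1 (hn ▸ one_ne_zero)
  have hc : Real.cos (Complex.arg ⟨x, y⟩) = x := by rw [Complex.cos_arg h0, hn, div_one]
  have hs : Real.sin (Complex.arg ⟨x, y⟩) = y := by rw [Complex.sin_arg, hn, div_one]
  by_cases hpos : 0 < Complex.arg ⟨x, y⟩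
  · exact ⟨_, ⟨hpos, by linarith [Complex.arg_le_pi ⟨x, y⟩, Real.pi_pos]⟩, hc, hs⟩
  · refine ⟨Complex.arg ⟨x, y⟩ + 2 * Real.pi, ⟨?_, by linarith⟩, ?_, ?_⟩
    · linarith [Complex.neg_pi_lt_arg ⟨x, y⟩, Real.pi_pos]
    · rw [Real.cos_add_two_pi, hc]
    · rw [Real.sin_add_two_pi, hs]

theorem polarPoint_injective {r r' φ φ' : ℝ} (hr : 0 < r) (hr' : 0 < r')
    (hφ : φ ∈ Ioc 0 (2 * Real.pi)) (hφ' : φ' ∈ Ioc 0 (2 * Real.pi))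
    (h : polarPoint r φ = polarPoint r' φ') : r = r' ∧ φ = φ' := by
  have h0 : 2 * r / (r ^ 2 + 1) * Real.cos φ = 2 * r' / (r' ^ 2 + 1) * Real.cos φ' := by
    simpa [polarPoint] using congrArg (fun v : Space => v 0) h
  have h1 : 2 * r / (r ^ 2 + 1) * Real.sin φ = 2 * r' / (r' ^ 2 + 1) * Real.sin φ' := by
    simpa [polarPoint] using congrArg (fun v : Space => v 1) h
  have h2 : (r ^ 2 - 1) / (r ^ 2 + 1) = (r' ^ 2 - 1) / (r' ^ 2 + 1) := by
    simpa [polarPoint] using congrArg (fun v : Space => v 2) h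
  have e : r = r' := by
    rw [div_eq_div_iff (by positivity) (by positivity)] at h2
    have : r ^ 2 = r' ^ 2 := by linarith
    exact (pow_left_inj₀ hr.le hr'.le two_ne_zero).1 this
  subst e
  have hne : 2 * r / (r ^ 2 + 1) ≠ 0 := by positivity
  exact ⟨rfl, eq_of_cos_eq_of_sin_eq hφ hφ' (mul_left_cancel₀ hne h0) (mul_left_cancel₀ hne h1)⟩

theorem injOn_polarMap (hc : 3 / 2 < c) : InjOn (polarMap c) polarBox := by
  rintro a ⟨ha0, ha1, ha2⟩ b ⟨hb0, hb1, hb2⟩ h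
  have hf : polarPoint (a 0) (a 1) = polarPoint (b 0) (b 1) := congrArg Prod.fst h
  obtain ⟨e0, e1⟩ := polarPoint_injective ha0 hb0 (Ioo_subset_Ioc_self ha1)
    (Ioo_subset_Ioc_self hb1) hf
  have hg : polarNorm c (a 0) (a 2) • polarDir (a 0) (a 1) (a 2) =
      polarNorm c (b 0) (b 2) • polarDir (b 0) (b 1) (b 2) := congrArg Prod.snd h
  have hn := congrArg norm hg
  rw [norm_smul, norm_smul, norm_polarDir, norm_polarDir, mul_one, mul_one,
    Real.norm_of_nonneg (polarNorm_pos hc _ _).le, Real.norm_of_nonneg (polarNorm_pos hc _ _).le]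
    at hn
  rw [hn] at hg
  have hd := smul_right_injective Space (polarNorm_pos hc (b 0) (b 2)).ne' hg
  rw [← e0, ← e1] at hd
  have hs := congrArg (fun v => inner ℝ v (meridian (a 0) (a 1))) hd
  have hco := congrArg (fun v => inner ℝ v (parallel (a 1))) hd
  simp only [inner_polarDir_meridian, inner_polarDir_parallel, neg_inj] at hs hco
  have e2 := eq_of_cos_eq_of_sin_eq (Ioo_subset_Ioc_self ha2) (Ioo_subset_Ioc_self hb2) hco hs
  funext i
  fin_cases i
  exacts [e0, e1, e2]

/-- The patch of the energy level given by polar coordinates. -/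
noncomputable def polarPatch (hc : 3 / 2 < c) : Patch (boundedLevel c) where
  map := polarMap c
  domain := polarBox
  piece := polarBox
  isOpen_domain := isOpen_polarBox
  contDiffOn_map := (contDiff_polarMap hc).contDiffOn
  injOn_map := injOn_polarMap hc
  injective_fderiv a ha := by
    refine injective_of_contactForm3_ne_zero (z := polarMap c a) ?_
    rw [contactForm3_polarMap hc, neg_ne_zero]
    have h0 := ha.1
    have := denominator_pos hc (a 0) (a 2)
    positivity
  mapsTo_map a _ := polarMap_mem hc a
  measurableSet_piece := isOpen_polarBox.measurableSet
  piece_subset := subset_rfl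

theorem eq_polarDir {r φ : ℝ} {v : Space} (h : inner ℝ (polarPoint r φ) v = (0 : ℝ)) (hv : v ≠ 0) :
    ∃ θ ∈ Ioc 0 (2 * Real.pi), v = ‖v‖ • polarDir r φ θ := by
  have hr : r ^ 2 + 1 ≠ 0 := by positivity
  set s := inner ℝ v (meridian r φ) with hs
  set t := inner ℝ v (parallel φ) with ht
  have hsc := Real.sin_sq_add_cos_sq φ
  obtain ⟨a, ha⟩ : ∃ a, a = 2 * r / (r ^ 2 + 1) := ⟨_, rfl⟩
  obtain ⟨b, hb⟩ : ∃ b, b = (1 - r ^ 2) / (r ^ 2 + 1) := ⟨_, rfl⟩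
  have hb' : (r ^ 2 - 1) / (r ^ 2 + 1) = -b := by
    rw [hb]
    ring
  have hab : a ^ 2 + b ^ 2 = 1 := by
    rw [ha, hb]
    field_simp
    ring
  have hdec : v = s • meridian r φ + t • parallel φ := by
    rw [inner_coords] at h hs ht
    simp only [polarPoint, meridian, parallel, ← ha, ← hb, hb'] at h hs ht
    simp at h hs ht
    ext i
    fin_cases i
    · simp [meridian, parallel, hs, ht, ← ha, ← hb]
      linear_combination a * Real.cos φ * h - v 0 * hsc -
        (Real.cos φ ^ 2 * v 0 + Real.sin φ * Real.cos φ * v 1) * hab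
    · simp [meridian, parallel, hs, ht, ← ha, ← hb]
      linear_combination a * Real.sin φ * h - v 1 * hsc -
        (Real.sin φ ^ 2 * v 1 + Real.sin φ * Real.cos φ * v 0) * hab
    · simp [meridian, parallel, hs, ht, ← ha, ← hb]
      linear_combination (-b) * h - v 2 * hab
  have hnorm : s ^ 2 + t ^ 2 = ‖v‖ ^ 2 := by
    rw [← real_inner_self_eq_norm_sq]
    nth_rewrite 2 [hdec]
    rw [inner_add_right, inner_smul_right, inner_smul_right, ← hs, ← ht]
    ring
  have hv' := norm_ne_zero_iff.2 hv
  obtain ⟨θ, hθ, hcos, hsin⟩ := exists_cos_eq_sin_eq (x := -t / ‖v‖) (y := s / ‖v‖) (by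
    field_simp
    linarith)
  refine ⟨θ, hθ, ?_⟩
  nth_rewrite 1 [hdec]
  rw [polarDir, hcos, hsin, smul_sub, smul_smul, smul_smul, mul_div_cancel₀ _ hv',
    mul_div_cancel₀ _ hv', neg_smul, sub_neg_eq_add]

theorem exists_polarPoint {x : Space} (hx : ‖x‖ = 1) (h : x 0 ≠ 0 ∨ x 1 ≠ 0) :
    ∃ r > 0, ∃ φ ∈ Ioc 0 (2 * Real.pi), polarPoint r φ = x := by
  have hx2 : x 0 ^ 2 + x 1 ^ 2 + x 2 ^ 2 = 1 := by
    rw [← norm_sq_coords, hx, one_pow]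
  have hpos : 0 < x 0 ^ 2 + x 1 ^ 2 := by
    rcases h with h | h
    · positivity
    · positivity
  set m := √(x 0 ^ 2 + x 1 ^ 2) with hm
  have hm0 : 0 < m := Real.sqrt_pos.2 hpos
  have hm2 : m ^ 2 = x 0 ^ 2 + x 1 ^ 2 := Real.sq_sqrt hpos.le
  have h1 : 0 < 1 - x 2 := by nlinarith
  have hmm : m ^ 2 = (1 - x 2) * (1 + x 2) := by rw [hm2]; linarith
  obtain ⟨φ, hφ, hcos, hsin⟩ := exists_cos_eq_sin_eq (x := x 0 / m) (y := x 1 / m) (by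
    field_simp
    linarith)
  have hr : (m / (1 - x 2)) ^ 2 = (1 + x 2) / (1 - x 2) := by
    rw [div_pow, hmm]
    field_simp
  have e : (1 + x 2) / (1 - x 2) + 1 = 2 / (1 - x 2) := by
    field_simp
    ring
  have e1 : 2 * (m / (1 - x 2)) / (2 / (1 - x 2)) = m := by field_simp
  refine ⟨m / (1 - x 2), div_pos hm0 h1, φ, hφ, ?_⟩
  ext i
  fin_cases i
  · simp only [polarPoint, hr, e, e1, hcos]
    simp
    field_simp
  · simp only [polarPoint, hr, e, e1, hsin]
    simp
    field_simp
  · simp only [polarPoint, hr, e]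
    simp
    field_simp
    ring

theorem exists_polarMap_eq (hc : 3 / 2 < c) {z : Space × Space} (hz : z ∈ boundedLevel c)
    (h : z.1 0 ≠ 0 ∨ z.1 1 ≠ 0) :
    ∃ a : Coord, 0 < a 0 ∧ a 1 ∈ Ioc 0 (2 * Real.pi) ∧ a 2 ∈ Ioc 0 (2 * Real.pi) ∧
      polarMap c a = z := by
  obtain ⟨hm, hl, -⟩ := id hz
  obtain ⟨r, hr, φ, hφ, hx⟩ := exists_polarPoint hm.1 h
  have hv := norm_pos_of_level hl
  have hi : inner ℝ (polarPoint r φ) z.2 = (0 : ℝ) := by rw [hx, hm.2]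
  obtain ⟨θ, hθ, e⟩ := eq_polarDir hi (norm_pos_iff.1 hv)
  have hm' : polarMap c ![r, φ, θ] = (polarPoint r φ, polarNorm c r θ • polarDir r φ θ) := by
    simp [polarMap]
  have hp := polarMap_mem hc ![r, φ, θ]
  rw [hm'] at hp
  refine ⟨![r, φ, θ], by simpa using hr, by simpa using hφ, by simpa using hθ, hm'.trans ?_⟩
  have hN := polarNorm_pos hc r θ
  have e' : (‖z.2‖ / polarNorm c r θ) • (polarNorm c r θ • polarDir r φ θ) = z.2 := by
    rw [smul_smul, div_mul_cancel₀ _ hN.ne', ← e]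
  have hz' : (polarPoint r φ, (‖z.2‖ / polarNorm c r θ) • (polarNorm c r θ • polarDir r φ θ)) ∈
      boundedLevel c := by rwa [e', hx]
  -- The given point and its polar candidate lie on the same ray of covectors and both on the level.
  have := eq_one_of_smul_mem hc hp (div_pos hv hN) hz'
  rw [this, one_smul] at e'
  rw [e', hx]

/-- The coordinates and the covectors that the polar patch misses. -/
def polarSlit : Set (Coord × Coord) :=
  {x | x.1 1 = 2 * Real.pi} ∪ {x | x.1 2 = 2 * Real.pi}

theorem mem_thicken_polarMap (hc : 3 / 2 < c) {z : Space × Space} (hz : z ∈ boundedLevel c)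
    {b : Coord} (hb : b ∈ cube) :
    thickPoint z b ∈ thicken (polarMap c) '' (polarBox ×ˢ cube) ∪
      (thicken (polarMap c) '' polarSlit ∪ {w | w.1 0 = 0}) := by
  by_cases h : z.1 0 ≠ 0 ∨ z.1 1 ≠ 0
  · obtain ⟨a, h0, h1, h2, rfl⟩ := exists_polarMap_eq hc hz h
    rcases h1.2.eq_or_lt with e1 | e1
    · exact Or.inr (Or.inl ⟨(a, b), Or.inl e1, rfl⟩)
    rcases h2.2.eq_or_lt with e2 | e2
    · exact Or.inr (Or.inl ⟨(a, b), Or.inr e2, rfl⟩)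
    · exact Or.inl ⟨(a, b), ⟨⟨h0, ⟨h1.1, e1⟩, ⟨h2.1, e2⟩⟩, hb⟩, rfl⟩
  · push Not at h
    -- Over the two poles ξ₀ = 0, so the thickened point lies in a hyperplane.
    refine Or.inr (Or.inr ?_)
    simp [thickPoint, h.1]

theorem volume_coord_fst_eq (i : Fin 3) (t : ℝ) :
    volume {x : Coord × Coord | x.1 i = t} = 0 := by
  have h : {x : Coord × Coord | x.1 i = t} = {a : Coord | a i = t} ×ˢ univ := by ext; simp
  rw [h, Measure.volume_eq_prod, Measure.prod_prod, volume_pi, Measure.pi_hyperplane, zero_mul]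

theorem volume_polar_null (hc : 3 / 2 < c) :
    volume (thicken (polarMap c) '' polarSlit ∪ {w : Coord × Coord | w.1 0 = 0}) = 0 := by
  refine measure_union_null ?_ (volume_coord_fst_eq 0 0)
  -- A differentiable map of ℝ⁶ to itself preserves null sets, and the slit consists of two
  -- hyperplanes.
  refine addHaar_image_eq_zero_of_differentiableOn_of_addHaar_eq_zero volume (fun x _ => ?_)
    (measure_union_null (volume_coord_fst_eq 1 _) (volume_coord_fst_eq 2 _))
  have hd := ((contDiff_polarMap hc).differentiable (by simp) x.1).hasFDerivAt
  obtain ⟨D, hD, -⟩ := exists_hasFDerivAt_thicken hd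
  exact hD.differentiableAt.differentiableWithinAt

theorem contactVolume_eq_polarPatch (hc : 3 / 2 < c) :
    contactVolume (boundedLevel c) = (polarPatch hc).volume :=
  contactVolume_eq_of_patch hc (polarPatch hc) (volume_polar_null hc)
    fun _ hz _ hb => mem_thicken_polarMap hc hz hb

end RotatingKepler

namespace RotatingKepler

variable {c : ℝ}

/-! ### The contact volume as an integral -/

/-- The density of the contact volume in the polar coordinates `r, θ`. -/
noncomputable def density (c : ℝ) (z : ℝ × ℝ) : ℝ :=
  32 * Real.pi * z.1 / ((z.1 ^ 2 + 2 * c) + √(radicand c z.1 z.2)) ^ 2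

theorem continuous_density (hc : 3 / 2 < c) : Continuous (density c) := by
  have hr : Continuous fun z : ℝ × ℝ => radicand c z.1 z.2 := by
    unfold radicand
    fun_prop
  refine (continuous_const.mul continuous_fst).div₀ ?_
    fun z => (pow_pos (denominator_pos hc z.1 z.2) 2).ne'
  exact (((continuous_fst.pow 2).add continuous_const).add hr.sqrt).pow 2

theorem density_nonneg {z : ℝ × ℝ} (hz : 0 ≤ z.1) : 0 ≤ density c z := by
  unfold density
  positivity

/-- The denominator is at least (1 + r²)² and r ≤ 1 + r². The factor 1 is the constant function of
θ, so that the bound is a product of integrable functions of r and θ. -/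
theorem density_le (hc : 3 / 2 < c) {z : ℝ × ℝ} (hz : 0 < z.1) :
    density c z ≤ 32 * Real.pi * (1 + z.1 ^ 2)⁻¹ * 1 := by
  have hs := Real.sqrt_nonneg (radicand c z.1 z.2)
  have h1 : z.1 * (1 + z.1 ^ 2) ≤ (1 + z.1 ^ 2) ^ 2 := by nlinarith [sq_nonneg (z.1 - 1)]
  have h2 : (1 + z.1 ^ 2) ^ 2 ≤ ((z.1 ^ 2 + 2 * c) + √(radicand c z.1 z.2)) ^ 2 :=
    pow_le_pow_left₀ (by positivity) (by linarith) 2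
  have h3 := pow_pos (denominator_pos hc z.1 z.2) 2
  rw [mul_one, density, ← div_eq_mul_inv, div_le_div_iff₀ h3 (by positivity), mul_assoc]
  exact mul_le_mul_of_nonneg_left (h1.trans h2) (by positivity)

theorem integrableOn_density (hc : 3 / 2 < c) :
    IntegrableOn (density c) (Ioi 0 ×ˢ Ioc 0 (2 * Real.pi)) := by
  have h1 : Integrable (fun r : ℝ => 32 * Real.pi * (1 + r ^ 2)⁻¹) (volume.restrict (Ioi 0)) :=
    (integrable_inv_one_add_sq.const_mul _).restrict
  have h2 : Integrable (fun _ : ℝ => (1 : ℝ)) (volume.restrict (Ioc 0 (2 * Real.pi))) :=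
    integrable_const 1
  have h3 := h1.mul_prod h2
  rw [Measure.prod_restrict, ← Measure.volume_eq_prod] at h3
  refine h3.mono' (continuous_density hc).aestronglyMeasurable ?_
  filter_upwards [ae_restrict_mem (measurableSet_Ioi.prod measurableSet_Ioc)] with z hz
  rw [Real.norm_of_nonneg (density_nonneg (le_of_lt hz.1))]
  exact density_le hc hz.1

/-- The projection that splits off the angle `φ`. -/
noncomputable def splitAngle (a : Coord) : ℝ × ℝ × ℝ := (a 1, a 0, a 2)

theorem measurePreserving_splitAngle : MeasurePreserving splitAngle volume volume :=
  ((MeasurePreserving.id volume).prod (volume_preserving_finTwoArrow ℝ)).comp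
    (volume_preserving_piFinSuccAbove (fun _ : Fin 3 => ℝ) 1)

theorem volume_polarPatch (hc : 3 / 2 < c) : (polarPatch hc).volume =
    ∫⁻ z in Ioi 0 ×ˢ Ioo 0 (2 * Real.pi), ENNReal.ofReal (density c z) := by
  have hm : Measurable fun z : ℝ × ℝ => ENNReal.ofReal (density c z / (2 * Real.pi)) :=
    ((continuous_density hc).measurable.div_const _).ennreal_ofReal
  have hbox : polarBox = splitAngle ⁻¹' (Ioo 0 (2 * Real.pi) ×ˢ (Ioi 0 ×ˢ Ioo 0 (2 * Real.pi))) := by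
    ext a
    simp only [polarBox, splitAngle, mem_ofPred_eq, mem_preimage, mem_prod, mem_Ioi]
    tauto
  have h1 : (polarPatch hc).volume = ∫⁻ a in polarBox,
      (fun w : ℝ × ℝ × ℝ => ENNReal.ofReal (density c w.2 / (2 * Real.pi))) (splitAngle a) := by
    refine setLIntegral_congr_fun isOpen_polarBox.measurableSet fun a ha => ?_
    have h0 := ha.1
    have hD := denominator_pos hc (a 0) (a 2)
    change ENNReal.ofReal |contactForm3 (polarMap c a) (fderiv ℝ (polarMap c) a (Pi.single 0 1))
      (fderiv ℝ (polarMap c) a (Pi.single 1 1)) (fderiv ℝ (polarMap c) a (Pi.single 2 1))| = _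
    rw [contactForm3_polarMap hc, abs_neg, abs_of_pos (by positivity)]
    congr 1
    have := Real.pi_ne_zero
    simp only [density, splitAngle]
    field_simp
    norm_num
  have hpi := Real.pi_pos
  have hm' : Measurable fun w : ℝ × ℝ × ℝ => ENNReal.ofReal (density c w.2 / (2 * Real.pi)) :=
    hm.comp measurable_snd
  rw [h1, hbox, measurePreserving_splitAngle.setLIntegral_comp_preimage
    (measurableSet_Ioo.prod (measurableSet_Ioi.prod measurableSet_Ioo)) hm',
    Measure.volume_eq_prod, ← Measure.prod_restrict,
    lintegral_prod _ hm'.aemeasurable]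
  dsimp only
  -- The integrand is constant in φ, whose interval has length 2π; this turns 16r into 32πr.
  rw [lintegral_const, Measure.restrict_apply_univ, Real.volume_Ioo, sub_zero, ← lintegral_mul_const _ hm]
  refine lintegral_congr fun z => ?_
  rw [← ENNReal.ofReal_mul' (by positivity), div_mul_cancel₀ _ (by positivity)]

theorem contactVolume_boundedLevel (hc : 3 / 2 < c) : contactVolume (boundedLevel c) =
    ENNReal.ofReal (∫ r in Ioi (0 : ℝ), ∫ θ in (0 : ℝ)..(2 * Real.pi), density c (r, θ)) := by
  have hi := integrableOn_density hc
  have hset : (Ioi (0 : ℝ) ×ˢ Ioo 0 (2 * Real.pi) : Set (ℝ × ℝ)) =ᵐ[volume]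
      (Ioi (0 : ℝ) ×ˢ Ioc 0 (2 * Real.pi) : Set (ℝ × ℝ)) :=
    Measure.set_prod_ae_eq (Filter.EventuallyEq.refl _ _) Ioo_ae_eq_Ioc
  rw [contactVolume_eq_polarPatch hc, volume_polarPatch hc, setLIntegral_congr hset,
    ← ofReal_integral_eq_lintegral_ofReal hi ?_, Measure.volume_eq_prod,
    setIntegral_prod _ hi]
  · simp only [intervalIntegral.integral_of_le Real.two_pi_pos.le]
  · filter_upwards [ae_restrict_mem (measurableSet_Ioi.prod measurableSet_Ioc)] with z hz
    exact density_nonneg (le_of_lt hz.1)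

theorem integral_density_nonneg :
    0 ≤ ∫ r in Ioi (0 : ℝ), ∫ θ in (0 : ℝ)..(2 * Real.pi), density c (r, θ) :=
  setIntegral_nonneg measurableSet_Ioi fun _ hr =>
    intervalIntegral.integral_nonneg Real.two_pi_pos.le fun _ _ => density_nonneg (le_of_lt hr)

end RotatingKepler

/-! ### Systole and systolic volume of Σ_R^c. -/

open RotatingKepler in
theorem mainTheorem7 (c : ℝ) (hc : 3 / 2 < c) :
    ∃ L : ℝ, (∀ x : ℝ, (0 < x ∧ c = 1 / (2 * x ^ 2) - x) ↔ x = L) ∧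
      IsLeast (reebPeriods (hypersurface c)) (2 * Real.pi * L) ∧
      systole (hypersurface c) = 2 * Real.pi * L ∧
      IsHamiltonianOrbit (retrogradeOrbit (L ^ 2)) ∧
      (∀ t, hamiltonian (retrogradeOrbit (L ^ 2) t) = -c) ∧
      (∃ k : ℝ, 0 < k ∧
        IsReebOrbit (hypersurface c) (fun s => moser (retrogradeOrbit (L ^ 2) (k * s))) ∧
        Function.Periodic (fun s => moser (retrogradeOrbit (L ^ 2) (k * s)))
          (2 * Real.pi * L)) ∧
      contactVolume (hypersurface c) ≠ ⊤ ∧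
      IntegrableOn (fun z : ℝ × ℝ => 32 * Real.pi * z.1 /
        ((z.1 ^ 2 + 2 * c) + √((z.1 ^ 2 + 2 * c) ^ 2 + 16 * z.1 * Real.cos z.2)) ^ 2)
        (Ioi 0 ×ˢ Ioc 0 (2 * Real.pi)) ∧
      systolicVolume (hypersurface c) = 1 / (2 * Real.pi * L) ^ 2 *
        ∫ r in Ioi (0 : ℝ), ∫ θ in (0 : ℝ)..(2 * Real.pi), 32 * Real.pi * r /
          ((r ^ 2 + 2 * c) + √((r ^ 2 + 2 * c) ^ 2 + 16 * r * Real.cos θ)) ^ 2 := by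
  obtain ⟨L, hL⟩ := exists_action_eq hc
  obtain ⟨hL0, h⟩ := (hL L).2 rfl
  have hleast := isLeast_reebPeriods hc hL0 h
  have hsys : systole (boundedLevel c) = 2 * Real.pi * L := hleast.csInf_eq
  have hvol := contactVolume_boundedLevel hc
  rw [hypersurface_eq hc]
  refine ⟨L, hL, hleast, hsys, isHamiltonianOrbit_retrogradeOrbit hL0,
    hamiltonian_retrogradeOrbit hL0 h, exists_isReebOrbit_retrograde hc hL0 h, ?_,
    integrableOn_density hc, ?_⟩
  · rw [hvol]
    exact ENNReal.ofReal_ne_top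
  · rw [systolicVolume, hsys, hvol, ENNReal.toReal_ofReal integral_density_nonneg, one_div_mul_eq_div]
    rfl
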